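/- **Setting.** Write $\mathbb R_0^+=[0,\infty)$, $\lambda_3$ for Lebesgue measure on $\mathbb R^3$ and $\lambda_2$ for surface measure (two-dimensional Hausdorff measure, equal to Lebesgue measure on planes). An open set $A\subseteq\mathbb R^3$ is *polyhedral* if $A=\operatorname{int}\overline A$ and $\overline A$ is a finite union of convex polytopes. A unit vector $n$ is the outer normal of $A$ at $x$ if $A$ coincides with $\{y: n\cdot(y-x)<0\}$ near $x$; $\partial_{\rm reg}A$ is the set of points of $\partial A$ at which an outer normal exists. *Domain.* $\Omega,\Omega_{\rm s},\Omega_{\rm g}\subseteq\mathbb R^3$ are nonempty bounded polyhedral open sets with $\overline\Omega=\overline\Omega_{\rm s}\cup\overline\Omega_{\rm g}$, $\Omega_{\rm s}\cap\Omega_{\rm g}=\emptyset$, and $\partial\Omega_{\rm s}$ is the disjoint union of $\partial\Omega$ and $\Sigma:=\partial\Omega_{\rm g}$. Let $\operatorname{conv}(\overline\Omega)$ be the closed convex hull of $\Omega$, $O:=\operatorname{int}(\operatorname{conv}(\overline\Omega))\setminus\overline\Omega$, $\Gamma_\Omega:=\overline\Omega\cap\overline O$, $\Gamma_{\rm ph}:=\partial\operatorname{conv}(\overline\Omega)\cap\partial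 O$. *Data.* $T>0$, $\sigma>0$, $\theta_{\rm ext}>0$, $\kappa_{\rm s},\kappa_{\rm g}\ge0$; continuous $\varepsilon_{\rm s},\varepsilon_{\rm g}:\mathbb R_0^+\to\mathbb R_0^+$ and $C_\varepsilon>0$ with $\varepsilon_m(\theta_2)\ge(\theta_2-\theta_1)C_\varepsilon+\varepsilon_m(\theta_1)$ for $\theta_2\ge\theta_1\ge0$; an emissivity $\epsilon:\mathbb R_0^+\to(0,1]$ such that, for every $r\ge0$, $L_{\epsilon,r}:=\sup\{|\epsilon(a)-\epsilon(b)|/|a-b|: a,b\in[0,r],\,a\ne b\}<\infty$ (with $\sup\emptyset:=0$); sources $f_m\in L^\infty((0,T)\times\Omega_m)$, $f_m\ge0$ a.e. ($m\in\{{\rm s,g}\}$); and $\theta_{\rm init}\in L^\infty(\Omega)$, $\theta_{\rm init}>0$ a.e. Put $\epsilon_{\min,r}:=\min_{[0,r]}\epsilon$, and let $\operatorname{var}^-\epsilon(r)$ be the negative variation of $\epsilon$ on $[0,r]$, i.e. the supremum of $\sum_{j=1}^n\max\{0,\epsilon(s_{j-1})-\epsilon(s_j)\}$ over all $0=s_0<\dots<s_n=r$.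 *Discretization.* Let $0=t_0<\dots<t_N=T$ and $k_\nu:=t_\nu-t_{\nu-1}$. Let $(\omega_i)_{i\in I}$ be a finite family of pairwise disjoint, nonempty, connected, polyhedral open subsets of $\Omega$ with $\overline\Omega=\bigcup_i\overline\omega_i$. Put $\omega_{m,i}:=\omega_i\cap\Omega_m$, and assume $\partial_{\rm reg}\omega_{{\rm s},i}\cap\Sigma=\partial_{\rm reg}\omega_{{\rm g},i}\cap\Sigma$ for all $i$. There are points $x_i\in\overline\omega_i$ such that: $x_i\in\overline\omega_{m,i}$ whenever $\omega_{m,i}\ne\emptyset$; $x_i\in\Gamma_\Omega$ if $\lambda_2(\overline\omega_i\cap\Gamma_\Omega)\neq0$; $x_i\in\overline{\partial\Omega\setminus\Gamma_\Omega}$ if $\lambda_2(\overline\omega_i\cap(\partial\Omega\setminus\Gamma_\Omega))\ne0$; and, if $i\neq j$ and $\lambda_2(\partial\omega_i\cap\partial\omega_j)\ne0$, then $x_i\ne x_j$ and $(x_j-x_i)/\|x_j-x_i\|_2$ is the outer normal of $\omega_i$ at $\lambda_2$-a.e. point of $\partial\omega_i\cap\partial\omega_j$. Let $(\zeta_\alpha)_{\alpha\in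 I_\Omega}$ and $(\zeta_\alpha)_{\alpha\in I_\Sigma}$ be finite families (with disjoint index sets) of nonempty, connected, relatively open subsets of $\Gamma_\Omega$ and of $\Sigma$, respectively; each $\zeta_\alpha$ spans a plane and is the interior, relative to that plane, of its closure, which is a finite union of convex polytopes. Within each family the sets are pairwise disjoint, and their closures cover $\Gamma_\Omega$, respectively $\Sigma$. For each $\alpha$ there is a unique $i(\alpha)\in I$ with $\zeta_\alpha\subseteq\partial\omega_{i(\alpha)}\cap\Gamma_\Omega$ (if $\alpha\in I_\Omega$), respectively $\zeta_\alpha\subseteq\partial\omega_{{\rm s},i(\alpha)}\cap\Sigma$ (if $\alpha\in I_\Sigma$), and $x_{i(\alpha)}\in\overline\zeta_\alpha$. For $\nu\in\{1,\dots,N\}$ and $\omega_{m,i}\neq\emptyset$, the numbers $f_{m,\nu,i}$ lie between the essential infimum and the $L^\infty$-norm of $f_m$ on $(t_{\nu-1},t_\nu)\times\omega_{m,i}$ (if $\omega_{m,i}=\emptyset$, they are arbitrary reals, multiplied by $\lambda_3(\omega_{m,i})=0$ below); the numbers $\theta_{{\rm init},i}$ lie between the essential infimum and the $L^\infty$-norm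 of $\theta_{\rm init}$ on $\omega_i$. *Radiation.* For $A,B\subseteq\Sigma$ (resp. $A,B\subseteq\Gamma_\Omega\cup\Gamma_{\rm ph}$) let $$\Lambda(A,B):=\int_{A\times B}\Lambda(x,y)\,\frac{\big(n(y)\cdot(x-y)\big)\big(n(x)\cdot(y-x)\big)}{\pi\|y-x\|_2^4}\,d(\lambda_2\otimes\lambda_2)(x,y),$$ where $n$ is the outer normal of $\Omega_{\rm s}$ (resp. the negative of the outer normal of $O$), and $\Lambda(x,y)=1$ if $x$ and $y$ are mutually visible, i.e. if the open segment $]x,y[$ is contained in the transparent region $\Omega_{\rm g}$ (resp. in $O$), and $\Lambda(x,y)=0$ otherwise. Put $\Lambda_{\alpha,\beta}:=\Lambda(\zeta_\alpha,\zeta_\beta)$ and $\Lambda_{\alpha,{\rm ph}}:=\Lambda(\zeta_\alpha,\Gamma_{\rm ph})$. For $u$ in $(\mathbb R_0^+)^{I_\Omega}$, respectively $(\mathbb R_0^+)^{I_\Sigma}$, set $G_{\alpha,\beta}(u):=\delta_{\alpha\beta}\lambda_2(\zeta_\alpha)-(1-\epsilon(u_\alpha))\Lambda_{\alpha,\beta}$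 and $E_\alpha(u):=\sigma\epsilon(u_\alpha)u_\alpha^4\lambda_2(\zeta_\alpha)$, with $\alpha,\beta$ in $I_\Omega$ (giving $G_\Gamma,E_\Gamma$), respectively in $I_\Sigma$ (giving $G_\Sigma,E_\Sigma$), $E_{{\rm ph},\alpha}(u):=\sigma(1-\epsilon(u_\alpha))\theta_{\rm ext}^4\Lambda_{\alpha,{\rm ph}}$, and $$R_\Gamma(u):=G_\Gamma(u)^{-1}(E_\Gamma(u)+E_{\rm ph}(u)),\qquad R_\Sigma(u):=G_\Sigma(u)^{-1}E_\Sigma(u),$$ $$V_{\Gamma,\alpha}(u):=\epsilon(u_\alpha)\sum_{\beta\in I_\Omega}R_{\Gamma,\beta}(u)\Lambda_{\alpha,\beta}+\sigma\epsilon(u_\alpha)\theta_{\rm ext}^4\Lambda_{\alpha,{\rm ph}},\qquad V_{\Sigma,\alpha}(u):=\epsilon(u_\alpha)\sum_{\beta\in I_\Sigma}R_{\Sigma,\beta}(u)\Lambda_{\alpha,\beta}.$$ *Scheme.* Let ${\rm nb}_m(i)$ be the set of $j\neq i$ with $\omega_{m,j}\ne\emptyset$ and $\lambda_2(\partial\omega_{m,i}\cap\partial\omega_{m,j})\ne0$,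 $J_{\Omega,i}:=\{\alpha\in I_\Omega:\lambda_2(\zeta_\alpha\cap\partial\omega_i)\neq0\}$, $J_{\Sigma,i}:=\{\alpha\in I_\Sigma:\lambda_2(\zeta_\alpha\cap\partial\omega_{{\rm s},i})\ne0\}$, and, for $u\in(\mathbb R_0^+)^I$, $u|_{I_\Omega}:=(u_{i(\alpha)})_{\alpha\in I_\Omega}$, $u|_{I_\Sigma}:=(u_{i(\alpha)})_{\alpha\in I_\Sigma}$. For $\tilde u,u\in(\mathbb R_0^+)^I$ let $$\begin{aligned}\mathcal H_{\nu,i}(\tilde u,u):={}&k_\nu^{-1}\sum_m(\varepsilon_m(u_i)-\varepsilon_m(\tilde u_i))\lambda_3(\omega_{m,i})-\sum_m\kappa_m\sum_{j\in{\rm nb}_m(i)}\frac{u_j-u_i}{\|x_i-x_j\|_2}\lambda_2(\partial\omega_{m,i}\cap\partial\omega_{m,j})\\&+\sigma\epsilon(u_i)u_i^4\lambda_2(\partial\omega_{{\rm s},i}\cap\Gamma_\Omega)-\sum_{\alpha\in J_{\Omega,i}}V_{\Gamma,\alpha}(u|_{I_\Omega})+\sigma\epsilon(u_i)(u_i^4-\theta_{\rm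 ext}^4)\lambda_2(\partial\omega_{{\rm s},i}\cap(\partial\Omega\setminus\Gamma_\Omega))\\&+\sigma\epsilon(u_i)u_i^4\lambda_2(\omega_i\cap\Sigma)-\sum_{\alpha\in J_{\Sigma,i}}V_{\Sigma,\alpha}(u|_{I_\Sigma})-\sum_m f_{m,\nu,i}\lambda_3(\omega_{m,i}).\end{aligned}$$ **Theorem.** Let $\nu\in\{1,\dots,N\}$ and $\tilde u\in(\mathbb R_0^+)^I$. Put $$B_{f,\nu}:=\max_i\sum_m f_{m,\nu,i}\frac{\lambda_3(\omega_{m,i})}{\lambda_3(\omega_i)},\quad m(\tilde u):=\min\{\theta_{\rm ext},\min_i\tilde u_i\},\quad M_\nu(\tilde u):=\max\Big\{\theta_{\rm ext},\max_i\tilde u_i+\frac{k_\nu}{C_\varepsilon}B_{f,\nu}\Big\}.$$ Then every $u\in(\mathbb R_0^+)^I$ with $\mathcal H_{\nu,i}(\tilde u,u)=0$ for all $i\in I$ lies in $[m(\tilde u),M_\nu(\tilde u)]^I$. Moreover, let $$L_1:=\sigma\max_i\frac{\lambda_2(\partial\omega_{{\rm s},i}\cap\Gamma_\Omega)}{\lambda_3(\omega_i)},\quad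 L_2:=\sigma\max_i\frac{\lambda_2(\partial\omega_{{\rm s},i}\cap(\partial\Omega\setminus\Gamma_\Omega))}{\lambda_3(\omega_i)},\quad L_3:=\sigma\max_i\frac{\lambda_2(\omega_i\cap\Sigma)}{\lambda_3(\omega_i)},$$ $$l^1(r):=4\operatorname{var}^-\epsilon(r)\,r^3+L_{\epsilon,r}r^4,\quad l^2(r):=4\epsilon_{\min,r}^{-1}r^3+\max\{r^4,\theta_{\rm ext}^4\}L_{\epsilon,r}(2\epsilon_{\min,r}^{-1}+1),\quad l^3(r):=L_{\epsilon,r}\theta_{\rm ext}^4.$$ If, with $M:=M_\nu(\tilde u)$, $$k_\nu\Big((L_1+L_2+L_3)\,l^1(M)+(L_1+L_3)\,l^2(M)+L_2\,l^3(M)\Big)<C_\varepsilon,$$ then there is exactly one $u\in[m(\tilde u),M_\nu(\tilde u)]^I$ with $\mathcal H_{\nu,i}(\tilde u,u)=0$ for all $i\in I$, and it is also the only such $u$ in $(\mathbb R_0^+)^I$. -/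

import Mathlib

open MeasureTheory Set
open scoped ENNReal

namespace ConductionRadiation

/-! ### Geometry of polyhedral sets -/

/-- Three-dimensional Euclidean space. -/
abbrev E3 : Type := EuclideanSpace ℝ (Fin 3)

/-- The two material phases: the opaque solid and the transparent gas. -/
inductive Phase
  | solid
  | gas

/-- `λ₃`, three-dimensional Lebesgue measure, as a real number. -/
noncomputable def vol (A : Set E3) : ℝ := (volume A).toReal

/-- `λ₂`, two-dimensional surface measure (normalized so that it is Lebesgue measure on planes),
as a real number. -/
noncomputable def area (A : Set E3) : ℝ := (μHE[2] A).toReal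

/-- `A` is the union of finitely many convex polytopes. -/
def IsPolytopeUnion (A : Set E3) : Prop :=
  ∃ F : Finset (Finset E3), A = ⋃ S ∈ F, convexHull ℝ (S : Set E3)

/-- Polyhedral open sets of `ℝ³`: interiors of finite unions of convex polytopes, without slits. -/
def IsPolyhedralOpen (A : Set E3) : Prop :=
  A = interior (closure A) ∧ IsPolytopeUnion (closure A)

/-- Polyhedral relatively open pieces of a plane: two-dimensional relative interiors of finite
unions of convex polytopes lying in a common plane. -/
def IsPolygonal (A : Set E3) : Prop :=
  Module.finrank ℝ (vectorSpan ℝ A) = 2 ∧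
    A = intrinsicInterior ℝ (closure A) ∧ IsPolytopeUnion (closure A)

/-- `n` is the outer unit normal of `A` at `x`: near `x`, the set `A` is the open half space
through `x` with outer normal `n`. Such an `n` is unique if it exists. -/
def HasOuterNormal (A : Set E3) (x n : E3) : Prop :=
  ‖n‖ = 1 ∧ ∃ r > 0, ∀ y ∈ Metric.ball x r, y ∈ A ↔ inner ℝ n (y - x) < 0

/-- The regular boundary: the boundary points at which an outer unit normal exists. -/
def regularFrontier (A : Set E3) : Set E3 :=
  {x | x ∈ frontier A ∧ ∃ n, HasOuterNormal A x n}

open Classical in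
/-- The outer unit normal field (zero off the regular boundary). -/
noncomputable def outerNormal (A : Set E3) (x : E3) : E3 :=
  if h : ∃ n, HasOuterNormal A x n then h.choose else 0

/-! ### The domain -/

/-- The space domain with its solid and gas parts, the gas being enclosed by the solid. -/
structure Domain where
  Ω : Set E3
  part : Phase → Set E3
  nonempty : Ω.Nonempty
  isOpen : IsOpen Ω
  bounded : Bornology.IsBounded Ω
  polyhedral : IsPolyhedralOpen Ω
  part_nonempty : ∀ m, (part m).Nonempty
  part_isOpen : ∀ m, IsOpen (part m)
  part_bounded : ∀ m, Bornology.IsBounded (part m)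
  part_polyhedral : ∀ m, IsPolyhedralOpen (part m)
  closure_eq : closure Ω = closure (part .solid) ∪ closure (part .gas)
  part_disjoint : part .solid ∩ part .gas = ∅
  frontier_solid : frontier (part .solid) = frontier Ω ∪ frontier (part .gas)
  frontier_disjoint : Disjoint (frontier Ω) (frontier (part .gas))

namespace Domain

variable (D : Domain)

/-- The interface `Σ = ∂Ω_g` between solid and gas. -/
def interface : Set E3 := frontier (D.part .gas)

/-- The closed convex hull of `Ω`. -/
def hull : Set E3 := convexHull ℝ (closure D.Ω)

/-- The open radiation region `O`. -/
def openRegion : Set E3 := interior D.hull \ closure D.Ω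

/-- `Γ_Ω`, the part of the boundary of `O` that lies on the body. -/
def bodyBoundary : Set E3 := closure D.Ω ∩ closure D.openRegion

/-- `Γ_ph`, the black body phantom closure of the open radiation region. -/
def phantom : Set E3 := frontier D.hull ∩ frontier D.openRegion

/-- `∂Ω \ Γ_Ω`, the part of the outer boundary without nonlocal radiative interaction. -/
def freeBoundary : Set E3 := frontier D.Ω \ D.bodyBoundary

end Domain

/-! ### Physical data -/

/-- The supremum `L_{ε,r}` of the difference quotients of `e` is taken over this set. -/
def slopes (e : ℝ → ℝ) (r : ℝ) : Set ℝ :=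
  {q | ∃ a ∈ Icc 0 r, ∃ b ∈ Icc 0 r, a ≠ b ∧ q = |e a - e b| / |a - b|}

/-- The Lipschitz constant `L_{ε,r}` of `e` on `[0,r]`. -/
noncomputable def lipConst (e : ℝ → ℝ) (r : ℝ) : ℝ := sSup (slopes e r)

/-- The minimum `ε_{min,r}` of `e` on `[0,r]`. -/
noncomputable def minOn (e : ℝ → ℝ) (r : ℝ) : ℝ := sInf (e '' Icc 0 r)

/-- The negative variation of `e` on `[0,r]`: the supremum over all discretizations
`0 = t 0 < ⋯ < t N = r` of the total decrease of `e`. -/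
noncomputable def negVariation (e : ℝ → ℝ) (r : ℝ) : ℝ :=
  sSup {v | ∃ (N : ℕ) (t : Fin (N + 1) → ℝ), StrictMono t ∧ t 0 = 0 ∧ t (Fin.last N) = r ∧
    v = ∑ j : Fin N, -min 0 (e (t j.succ) - e (t j.castSucc))}

/-- The data of the heat problem. Functions of the absolute temperature only matter on `[0,∞)`. -/
structure HeatData (D : Domain) where
  /-- final time -/
  T : ℝ
  T_pos : 0 < T
  /-- internal energies -/
  energy : Phase → ℝ → ℝ
  energy_continuous : ∀ m, ContinuousOn (energy m) (Ici 0)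
  energy_nonneg : ∀ m, ∀ θ ≥ 0, 0 ≤ energy m θ
  /-- the growth constant of the internal energies -/
  Cε : ℝ
  Cε_pos : 0 < Cε
  energy_growth : ∀ m, ∀ θ₁ θ₂ : ℝ, 0 ≤ θ₁ → θ₁ ≤ θ₂ →
    (θ₂ - θ₁) * Cε + energy m θ₁ ≤ energy m θ₂
  /-- thermal conductivities -/
  κ : Phase → ℝ
  κ_nonneg : ∀ m, 0 ≤ κ m
  /-- heat sources, as functions of time and space -/
  f : Phase → ℝ × E3 → ℝ
  f_memLp : ∀ m, MemLp (f m) ∞ (volume.restrict (Ioo 0 T ×ˢ D.part m))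
  f_nonneg : ∀ m, ∀ᵐ p ∂(volume.restrict (Ioo 0 T ×ˢ D.part m)), 0 ≤ f m p
  /-- Boltzmann radiation constant -/
  σ : ℝ
  σ_pos : 0 < σ
  /-- emissivity -/
  emis : ℝ → ℝ
  emis_pos : ∀ θ ≥ 0, 0 < emis θ
  emis_le_one : ∀ θ ≥ 0, emis θ ≤ 1
  emis_locLip : ∀ r ≥ 0, BddAbove (slopes emis r)
  /-- external temperature -/
  θext : ℝ
  θext_pos : 0 < θext
  /-- initial temperature -/
  θinit : E3 → ℝ
  θinit_memLp : MemLp θinit ∞ (volume.restrict D.Ω)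
  θinit_pos : ∀ᵐ x ∂(volume.restrict D.Ω), 0 < θinit x

/-! ### Discretization of time, space and boundary -/

/-- A discretization `0 = t₀ < ⋯ < t_N = T` of the time interval. -/
structure TimeGrid (T : ℝ) (N : ℕ) where
  t : Fin (N + 1) → ℝ
  strictMono : StrictMono t
  zero : t 0 = 0
  last : t (Fin.last N) = T

/-- The time step `k_ν = t_ν - t_{ν-1}`; the index `ν : Fin N` counts the intervals from `0`. -/
def TimeGrid.step {T : ℝ} {N : ℕ} (τ : TimeGrid T N) (ν : Fin N) : ℝ :=
  τ.t ν.succ - τ.t ν.castSucc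

/-- An admissible discretization of the space domain into control volumes `ω i` with
discretization points `x i`. -/
structure SpaceMesh (D : Domain) (I : Type*) where
  ω : I → Set E3
  x : I → E3
  subset : ∀ i, ω i ⊆ D.Ω
  isOpen : ∀ i, IsOpen (ω i)
  isConnected : ∀ i, IsConnected (ω i)
  polyhedral : ∀ i, IsPolyhedralOpen (ω i)
  disjoint : ∀ i j, i ≠ j → Disjoint (ω i) (ω j)
  cover : closure D.Ω = ⋃ i, closure (ω i)
  regular_interface : ∀ i,
    regularFrontier (ω i ∩ D.part .solid) ∩ D.interface =
      regularFrontier (ω i ∩ D.part .gas) ∩ D.interface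
  x_mem_closure : ∀ i, x i ∈ closure (ω i)
  x_mem_part : ∀ m i, (ω i ∩ D.part m).Nonempty → x i ∈ closure (ω i ∩ D.part m)
  x_mem_body : ∀ i, μHE[2] (closure (ω i) ∩ D.bodyBoundary) ≠ 0 → x i ∈ D.bodyBoundary
  x_mem_free : ∀ i, μHE[2] (closure (ω i) ∩ D.freeBoundary) ≠ 0 → x i ∈ closure D.freeBoundary
  /-- Neighbouring points are distinct, and the segment joining them is perpendicular to the
  common boundary, pointing outwards. -/
  x_orthogonal : ∀ i j, i ≠ j → μHE[2] (frontier (ω i) ∩ frontier (ω j)) ≠ 0 →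
    x i ≠ x j ∧
      ∀ᵐ p ∂((μHE[2] : Measure E3).restrict (frontier (ω i) ∩ frontier (ω j))),
        HasOuterNormal (ω i) p (‖x i - x j‖⁻¹ • (x j - x i))

/-- `ω_{m,i}`, the part of the `i`-th control volume in phase `m`. -/
def SpaceMesh.cell {D : Domain} {I : Type*} (M : SpaceMesh D I) (m : Phase) (i : I) : Set E3 :=
  M.ω i ∩ D.part m

/-- Partitions of `Γ_Ω` and `Σ` into plane boundary elements, compatible with the control
volumes; `idxΩ`, `idxSig` give the index `i(α)` of the control volume adjacent to an element. -/
structure BoundaryMesh {D : Domain} {I : Type*} (M : SpaceMesh D I) (IΩ ISig : Type*) where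
  ζΩ : IΩ → Set E3
  ζSig : ISig → Set E3
  ζΩ_connected : ∀ α, IsConnected (ζΩ α)
  ζSig_connected : ∀ α, IsConnected (ζSig α)
  ζΩ_polygonal : ∀ α, IsPolygonal (ζΩ α)
  ζSig_polygonal : ∀ α, IsPolygonal (ζSig α)
  ζΩ_relOpen : ∀ α, ∃ U, IsOpen U ∧ ζΩ α = U ∩ D.bodyBoundary
  ζSig_relOpen : ∀ α, ∃ U, IsOpen U ∧ ζSig α = U ∩ D.interface
  ζΩ_disjoint : ∀ α β, α ≠ β → Disjoint (ζΩ α) (ζΩ β)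
  ζSig_disjoint : ∀ α β, α ≠ β → Disjoint (ζSig α) (ζSig β)
  ζΩ_cover : D.bodyBoundary = ⋃ α, closure (ζΩ α)
  ζSig_cover : D.interface = ⋃ α, closure (ζSig α)
  idxΩ : IΩ → I
  idxSig : ISig → I
  idxΩ_iff : ∀ α i, ζΩ α ⊆ frontier (M.ω i) ∩ D.bodyBoundary ↔ i = idxΩ α
  idxSig_iff : ∀ α i, ζSig α ⊆ frontier (M.cell .solid i) ∩ D.interface ↔ i = idxSig α
  x_mem_ζΩ : ∀ α, M.x (idxΩ α) ∈ closure (ζΩ α)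
  x_mem_ζSig : ∀ α, M.x (idxSig α) ∈ closure (ζSig α)

/-! ### Radiative exchange -/

/-- The view factor `ω(x,y)` for the unit normal field `n`. -/
noncomputable def viewFactor (n : E3 → E3) (x y : E3) : ℝ :=
  (inner ℝ (n y) (x - y) * inner ℝ (n x) (y - x)) / (Real.pi * (inner ℝ (y - x) (y - x)) ^ 2)

open Classical in
/-- The visibility factor `Λ(x,y)`: two boundary points of the transparent radiation region `R`
are mutually visible if the open segment between them runs inside `R`. -/
noncomputable def visibility (R : Set E3) (x y : E3) : ℝ :=
  if openSegment ℝ x y ⊆ R then 1 else 0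

/-- The integral of `Λ ω` over `A × B` with respect to surface measure. -/
noncomputable def exchange (R : Set E3) (n : E3 → E3) (A B : Set E3) : ℝ :=
  ∫ p : E3 × E3, visibility R p.1 p.2 * viewFactor n p.1 p.2
    ∂(((μHE[2] : Measure E3).restrict A).prod ((μHE[2] : Measure E3).restrict B))

/-- Radiative exchange on `Σ` through the gas, with the outer normal of the solid. -/
noncomputable def Domain.exchangeSig (D : Domain) (A B : Set E3) : ℝ :=
  exchange (D.part .gas) (outerNormal (D.part .solid)) A B

/-- Radiative exchange on `Γ = Γ_Ω ∪ Γ_ph` through the open radiation region, with the normal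
pointing into that region. -/
noncomputable def Domain.exchangeΓ (D : Domain) (A B : Set E3) : ℝ :=
  exchange D.openRegion (fun x => -outerNormal D.openRegion x) A B

section Radiation

variable {D : Domain} (P : HeatData D) {I IΩ ISig : Type*} {M : SpaceMesh D I}
  (B : BoundaryMesh M IΩ ISig)

/-- Emitted radiation `E_α(u)` of boundary elements `ζ`. -/
noncomputable def emission {J : Type*} (ζ : J → Set E3) (u : J → ℝ) (α : J) : ℝ :=
  P.σ * P.emis (u α) * u α ^ 4 * area (ζ α)

/-- Reflected radiation `E_{ph,α}(u)` stemming from the phantom closure. -/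
noncomputable def phantomEmission (u : IΩ → ℝ) (α : IΩ) : ℝ :=
  P.σ * (1 - P.emis (u α)) * P.θext ^ 4 * D.exchangeΓ (B.ζΩ α) D.phantom

/-- The radiosity matrix `G(u)` for boundary elements `ζ` with exchange coefficients `Λ`. -/
noncomputable def radiosityMatrix {J : Type*} [DecidableEq J] (ζ : J → Set E3)
    (Λ : J → J → ℝ) (u : J → ℝ) : Matrix J J ℝ :=
  Matrix.of fun α β => (if α = β then area (ζ α) else 0) - (1 - P.emis (u α)) * Λ α β

/-- The exchange coefficients `Λ_{α,β}` on `Γ_Ω`. -/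
noncomputable def coeffΓ (α β : IΩ) : ℝ := D.exchangeΓ (B.ζΩ α) (B.ζΩ β)

/-- The exchange coefficients `Λ_{α,β}` on `Σ`. -/
noncomputable def coeffSig (α β : ISig) : ℝ := D.exchangeSig (B.ζSig α) (B.ζSig β)

/-- The discrete radiosity `R_Γ(u) = G_Γ(u)⁻¹ (E_Γ(u) + E_ph(u))`. -/
noncomputable def radiosityΓ [Fintype IΩ] [DecidableEq IΩ] (u : IΩ → ℝ) : IΩ → ℝ :=
  ((radiosityMatrix P B.ζΩ (coeffΓ B) u)⁻¹).mulVec (emission P B.ζΩ u + phantomEmission P B u)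

/-- The discrete radiosity `R_Σ(u) = G_Σ(u)⁻¹ E_Σ(u)`. -/
noncomputable def radiositySig [Fintype ISig] [DecidableEq ISig] (u : ISig → ℝ) : ISig → ℝ :=
  ((radiosityMatrix P B.ζSig (coeffSig B) u)⁻¹).mulVec (emission P B.ζSig u)

/-- The absorbed radiation `V_{Γ,α}(u)`. -/
noncomputable def absorbedΓ [Fintype IΩ] [DecidableEq IΩ] (u : IΩ → ℝ) (α : IΩ) : ℝ :=
  P.emis (u α) * ∑ β, radiosityΓ P B u β * coeffΓ B α β +
    P.σ * P.emis (u α) * P.θext ^ 4 * D.exchangeΓ (B.ζΩ α) D.phantom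

/-- The absorbed radiation `V_{Σ,α}(u)`. -/
noncomputable def absorbedSig [Fintype ISig] [DecidableEq ISig] (u : ISig → ℝ) (α : ISig) : ℝ :=
  P.emis (u α) * ∑ β, radiositySig P B u β * coeffSig B α β

end Radiation

/-! ### The fully implicit finite volume scheme -/

/-- Admissible approximations `f_{m,ν,i}` of the heat sources and `θ_{init,i}` of the initial
temperature. -/
structure Approximation {D : Domain} (P : HeatData D) {I : Type*} (M : SpaceMesh D I)
    {N : ℕ} (τ : TimeGrid P.T N) where
  f : Phase → Fin N → I → ℝ
  f_ge : ∀ m ν i, (M.cell m i).Nonempty →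
    essInf (P.f m) (volume.restrict (Ioo (τ.t ν.castSucc) (τ.t ν.succ) ×ˢ M.cell m i)) ≤ f m ν i
  f_le : ∀ m ν i, (M.cell m i).Nonempty →
    f m ν i ≤ (eLpNorm (P.f m) ∞
      (volume.restrict (Ioo (τ.t ν.castSucc) (τ.t ν.succ) ×ˢ M.cell m i))).toReal
  θinit : I → ℝ
  θinit_ge : ∀ i, essInf P.θinit (volume.restrict (M.ω i)) ≤ θinit i
  θinit_le : ∀ i, θinit i ≤ (eLpNorm P.θinit ∞ (volume.restrict (M.ω i))).toReal

section Scheme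

variable {D : Domain} (P : HeatData D) {I IΩ ISig : Type*} (M : SpaceMesh D I)
  (B : BoundaryMesh M IΩ ISig) {N : ℕ} (τ : TimeGrid P.T N) (S : Approximation P M τ)
  [Fintype I] [Fintype IΩ] [DecidableEq IΩ] [Fintype ISig] [DecidableEq ISig]

open Classical in
/-- The set `nb_m(i)` of neighbours of `i` within phase `m`. -/
noncomputable def neighbours (m : Phase) (i : I) : Finset I :=
  Finset.univ.filter fun j => (M.cell m j).Nonempty ∧ j ≠ i ∧
    μHE[2] (frontier (M.cell m i) ∩ frontier (M.cell m j)) ≠ 0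

open Classical in
/-- The set `J_{Ω,i}` of boundary elements of `Γ_Ω` adjacent to the `i`-th control volume. -/
noncomputable def adjacentΩ (i : I) : Finset IΩ :=
  Finset.univ.filter fun α => μHE[2] (B.ζΩ α ∩ frontier (M.ω i)) ≠ 0

open Classical in
/-- The set `J_{Σ,i}` of boundary elements of `Σ` adjacent to the `i`-th control volume. -/
noncomputable def adjacentSig (i : I) : Finset ISig :=
  Finset.univ.filter fun α => μHE[2] (B.ζSig α ∩ frontier (M.cell .solid i)) ≠ 0

/-- The stored energy difference of phase `m` (without the factor `k_ν⁻¹`). -/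
noncomputable def storage (m : Phase) (v u : I → ℝ) (i : I) : ℝ :=
  (P.energy m (u i) - P.energy m (v i)) * vol (M.cell m i)

/-- The discrete conductive flux in phase `m` into the `i`-th control volume. -/
noncomputable def conduction (m : Phase) (u : I → ℝ) (i : I) : ℝ :=
  P.κ m * ∑ j ∈ neighbours M m i,
    (u j - u i) / ‖M.x i - M.x j‖ * area (frontier (M.cell m i) ∩ frontier (M.cell m j))

/-- The finite volume operator `H_{ν,i}(v,u)`, with previous state `v` and current state `u`. -/
noncomputable def fvOperator (ν : Fin N) (v u : I → ℝ) (i : I) : ℝ :=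
  (τ.step ν)⁻¹ * (storage P M .solid v u i + storage P M .gas v u i)
    - (conduction P M .solid u i + conduction P M .gas u i)
    + P.σ * P.emis (u i) * u i ^ 4 * area (frontier (M.cell .solid i) ∩ D.bodyBoundary)
    - ∑ α ∈ adjacentΩ M B i, absorbedΓ P B (fun β => u (B.idxΩ β)) α
    + P.σ * P.emis (u i) * (u i ^ 4 - P.θext ^ 4)
        * area (frontier (M.cell .solid i) ∩ D.freeBoundary)
    + P.σ * P.emis (u i) * u i ^ 4 * area (M.ω i ∩ D.interface)
    - ∑ α ∈ adjacentSig M B i, absorbedSig P B (fun β => u (B.idxSig β)) α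
    - (S.f .solid ν i * vol (M.cell .solid i) + S.f .gas ν i * vol (M.cell .gas i))

/-- The source bound `B_{f,ν}`. -/
noncomputable def sourceBound (ν : Fin N) : ℝ :=
  ⨆ i, (S.f .solid ν i * (vol (M.cell .solid i) / vol (M.ω i)) +
    S.f .gas ν i * (vol (M.cell .gas i) / vol (M.ω i)))

/-- The constant `L_{V,Γ_Ω}`. -/
noncomputable def ratioBody : ℝ :=
  P.σ * ⨆ i, area (frontier (M.cell .solid i) ∩ D.bodyBoundary) / vol (M.ω i)

/-- The constant `L_{V,∂Ω∖Γ_Ω}`. -/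
noncomputable def ratioFree : ℝ :=
  P.σ * ⨆ i, area (frontier (M.cell .solid i) ∩ D.freeBoundary) / vol (M.ω i)

/-- The constant `L_{V,Σ}`. -/
noncomputable def ratioInterface : ℝ :=
  P.σ * ⨆ i, area (M.ω i ∩ D.interface) / vol (M.ω i)

/-- The lower bound `m(v)`. -/
noncomputable def lowerBound (v : I → ℝ) : ℝ := min P.θext (⨅ i, v i)

/-- The upper bound `M_ν(v)`. -/
noncomputable def upperBound (ν : Fin N) (v : I → ℝ) : ℝ :=
  max P.θext ((⨆ i, v i) + τ.step ν / P.Cε * sourceBound P M τ S ν)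

/-- The function `l_g^1`. -/
noncomputable def lg1 (r : ℝ) : ℝ :=
  4 * negVariation P.emis r * r ^ 3 + lipConst P.emis r * r ^ 4

/-- The function `l_g^2`. -/
noncomputable def lg2 (r : ℝ) : ℝ :=
  4 * (minOn P.emis r)⁻¹ * r ^ 3 +
    max (r ^ 4) (P.θext ^ 4) * lipConst P.emis r * (2 * (minOn P.emis r)⁻¹ + 1)

/-- The function `l_g^3`. -/
noncomputable def lg3 (r : ℝ) : ℝ := lipConst P.emis r * P.θext ^ 4

/-- The smallness condition on the time step `k_ν`. -/
def SmallStep (ν : Fin N) (v : I → ℝ) : Prop :=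
  τ.step ν *
      ((ratioBody P M + ratioFree P M + ratioInterface P M) * lg1 P (upperBound P M τ S ν v) +
        (ratioBody P M + ratioInterface P M) * lg2 P (upperBound P M τ S ν v) +
        ratioFree P M * lg3 P (upperBound P M τ S ν v)) <
    P.Cε

end Scheme

end ConductionRadiation

/-! Each equation of the scheme balances, at one node with value s, the stored energy `W i s`,
conduction Σ c_ij (w_j - s), the emission σ e(s) s⁴ over an area A_i, the absorption e(s) Q_i(w), an
exchange with the fixed temperature θ_ext on the free boundary, and a source. The other values enter
only through w, and a solution is a state u with s = u_i and w = u. This is the abstract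
`NodalSystem`.

The decisive fact is that the view factors of a closed enclosure sum to one (`lintegral_kernel`), so
that every row of exchange coefficients, including the phantom, sums to the area of its element. The
discrete radiosity equation then has a maximum principle. It makes the radiosity matrix invertible,
and it shows that when θ_ext and all temperatures are at most U, the irradiation is at most A_i σ
U⁴; the lower bound is symmetric. At the hottest node the radiation and conduction terms therefore
cannot heat, and at the coldest node they cannot cool. With the growth of the internal energy this
gives the bounds m and M.

For solvability, the residual is strictly increasing in s with rate `growth` and Lipschitz in w, in
the sup norm, with constant `coupling`. The step condition gives coupling < growth. Solving every
equation for its own value with w frozen then maps the box [m, M]^I into itself and contracts it,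
and Banach's theorem applies.

The row sums rest on a geometric argument. The boundary of a polyhedral set lies in finitely many
planes and is flat at almost every point, so outer normals exist almost everywhere. A half-space
Gaussian of mass one is placed at a regular boundary point x. Its integral over the cone from x
through a visible flat boundary piece equals the integral of the radiation kernel over that piece.
Every inward ray leaves the enclosure at exactly one visible point, so the cones fill the half space
without overlap and the kernel has integral one. -/

namespace ConductionRadiation

/-! ### The discrete radiosity equation -/

section Radiosity

variable {J : Type*} [Fintype J] {a q : J → ℝ} {Λ : J → J → ℝ}

/-- Discrete maximum principle for the radiosity equation in an enclosure. -/
theorem radiosity_le (ha : ∀ α, 0 < a α) (hΛ : ∀ α β, 0 ≤ Λ α β) (hq : ∀ α, 0 ≤ q α)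
    (hrow : ∀ α, ∑ β, Λ α β + q α = a α) {e w : J → ℝ} {C : ℝ}
    (he : ∀ α, 0 < e α) (he1 : ∀ α, e α ≤ 1)
    (hw : ∀ α, a α * w α ≤ (1 - e α) * (∑ β, Λ α β * w β + q α * C) + e α * a α * C) (α : J) :
    w α ≤ C := by
  obtain ⟨γ, -, hγ⟩ := Finset.exists_max_image Finset.univ w ⟨α, Finset.mem_univ α⟩
  refine (hγ α (Finset.mem_univ α)).trans ?_
  by_contra! hlt
  -- At the maximising index γ the row sum bounds the incoming radiation by a γ * w γ. Inserting
  -- this in `hw` leaves e a (w γ - C) ≤ 0, which contradicts C < w γ because e > 0.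
  have h1 : ∑ β, Λ γ β * w β + q γ * C ≤ a γ * w γ := by
    rw [← hrow γ, add_mul, Finset.sum_mul]
    exact add_le_add
      (Finset.sum_le_sum fun β _ => mul_le_mul_of_nonneg_left (hγ β (Finset.mem_univ β)) (hΛ γ β))
      (mul_le_mul_of_nonneg_left hlt.le (hq γ))
  have h2 := mul_le_mul_of_nonneg_left h1 (sub_nonneg.2 (he1 γ))
  have h3 : 0 < e γ * a γ * (w γ - C) := mul_pos (mul_pos (he γ) (ha γ)) (sub_pos.2 hlt)
  nlinarith [hw γ]

theorem le_radiosity (ha : ∀ α, 0 < a α) (hΛ : ∀ α β, 0 ≤ Λ α β) (hq : ∀ α, 0 ≤ q α)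
    (hrow : ∀ α, ∑ β, Λ α β + q α = a α) {e w : J → ℝ} {C : ℝ}
    (he : ∀ α, 0 < e α) (he1 : ∀ α, e α ≤ 1)
    (hw : ∀ α, (1 - e α) * (∑ β, Λ α β * w β + q α * C) + e α * a α * C ≤ a α * w α) (α : J) :
    C ≤ w α := by
  have := radiosity_le ha hΛ hq hrow (w := fun β => -w β) (C := -C) he he1 (fun β => by
    have := hw β
    simp only [mul_neg, Finset.sum_neg_distrib]
    nlinarith) α
  linarith

/-- The maximum principle with C = 0, applied from above and from below, kills every solution of the
homogeneous system. The matrix is therefore invertible, so `⁻¹` is a genuine inverse and not the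
default value. -/
theorem radiosity_unique_solution [DecidableEq J] (ha : ∀ α, 0 < a α) (hΛ : ∀ α β, 0 ≤ Λ α β)
    (hq : ∀ α, 0 ≤ q α) (hrow : ∀ α, ∑ β, Λ α β + q α = a α) {e : J → ℝ}
    (he : ∀ α, 0 < e α) (he1 : ∀ α, e α ≤ 1) (b : J → ℝ) (α : J) :
    a α * ((Matrix.of fun α β => (if α = β then a α else 0) - (1 - e α) * Λ α β)⁻¹.mulVec b) α =
      (1 - e α) * ∑ β, Λ α β *
        ((Matrix.of fun α β => (if α = β then a α else 0) - (1 - e α) * Λ α β)⁻¹.mulVec b) β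
        + b α := by
  set G : Matrix J J ℝ := Matrix.of fun α β => (if α = β then a α else 0) - (1 - e α) * Λ α β
    with hG
  have hmul (w : J → ℝ) (γ : J) : G.mulVec w γ = a γ * w γ - (1 - e γ) * ∑ β, Λ γ β * w β := by
    simp only [hG, Matrix.mulVec, dotProduct, Matrix.of_apply, sub_mul, Finset.sum_sub_distrib,
      ite_mul, zero_mul, Finset.sum_ite_eq, Finset.mem_univ, if_true, Finset.mul_sum, mul_assoc]
  have hinj : Function.Injective G.mulVec := by
    intro w w' h
    have h0 : G.mulVec (w - w') = 0 := by rw [Matrix.mulVec_sub]; exact sub_eq_zero.2 h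
    have h1 (γ : J) : a γ * (w - w') γ = (1 - e γ) * ∑ β, Λ γ β * (w - w') β := by
      have := congrFun h0 γ
      rw [hmul] at this
      exact sub_eq_zero.1 this
    ext γ
    refine sub_eq_zero.1 (le_antisymm ?_ ?_ : (w - w') γ = 0)
    · exact radiosity_le ha hΛ hq hrow (C := 0) he he1 (fun β => by rw [h1]; simp) γ
    · exact le_radiosity ha hΛ hq hrow (C := 0) he he1 (fun β => by rw [h1]; simp) γ
  have hu : IsUnit G := Matrix.mulVec_injective_iff_isUnit.1 hinj
  have hsol : G.mulVec (G⁻¹.mulVec b) = b := by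
    rw [Matrix.mulVec_mulVec, Matrix.mul_nonsing_inv _ ((Matrix.isUnit_iff_isUnit_det _).1 hu),
      Matrix.one_mulVec]
  have := congrFun hsol α
  rw [hmul] at this
  linarith

/-- The radiosity equation with emissivity `e`, temperature `u` and external temperature `θ`. -/
def IsRadiosity (a q : J → ℝ) (Λ : J → J → ℝ) (σ θ : ℝ) (e : ℝ → ℝ) (u R : J → ℝ) : Prop :=
  ∀ α, a α * R α =
    (1 - e (u α)) * (∑ β, Λ α β * R β + q α * (σ * θ ^ 4)) + σ * e (u α) * u α ^ 4 * a α

variable {σ θ : ℝ} {e : ℝ → ℝ} {u v R R' : J → ℝ}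

/-- The constant σU⁴ is a supersolution of the radiosity equation, so it dominates R. The row sum
turns this into the bound on the incoming radiation. -/
theorem IsRadiosity.irradiance_le (ha : ∀ α, 0 < a α) (hΛ : ∀ α β, 0 ≤ Λ α β)
    (hq : ∀ α, 0 ≤ q α) (hrow : ∀ α, ∑ β, Λ α β + q α = a α) (hσ : 0 < σ) (hθ : 0 < θ)
    (he : ∀ x ≥ 0, 0 < e x) (he1 : ∀ x ≥ 0, e x ≤ 1) (h : IsRadiosity a q Λ σ θ e u R)
    (hu : ∀ α, 0 ≤ u α) {U : ℝ} (hU : ∀ α, u α ≤ U) (hθU : θ ≤ U) (α : J) :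
    ∑ β, Λ α β * R β + q α * (σ * θ ^ 4) ≤ a α * (σ * U ^ 4) := by
  have hθ4 : σ * θ ^ 4 ≤ σ * U ^ 4 := by gcongr
  have hR := radiosity_le ha hΛ hq hrow (w := R) (C := σ * U ^ 4) (e := fun α => e (u α))
    (fun α => he _ (hu α)) (fun α => he1 _ (hu α)) (fun β => by
      rw [h β]
      have h1 : q β * (σ * θ ^ 4) ≤ q β * (σ * U ^ 4) := mul_le_mul_of_nonneg_left hθ4 (hq β)
      have h2 : u β ^ 4 ≤ U ^ 4 := pow_le_pow_left₀ (hu β) (hU β) 4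
      have h3 : 0 ≤ e (u β) * a β := mul_nonneg (he _ (hu β)).le (ha β).le
      have h4 : 0 ≤ 1 - e (u β) := sub_nonneg.2 (he1 _ (hu β))
      have h5 := mul_le_mul_of_nonneg_left h1 h4
      have h6 := mul_le_mul_of_nonneg_left h2 (mul_nonneg h3 hσ.le)
      nlinarith)
  rw [← hrow α, add_mul, Finset.sum_mul]
  exact add_le_add (Finset.sum_le_sum fun β _ => mul_le_mul_of_nonneg_left (hR β) (hΛ α β))
    (mul_le_mul_of_nonneg_left hθ4 (hq α))

/-- Here σL⁴ is a subsolution. The case L = 0 gives the nonnegativity of the irradiation. -/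
theorem IsRadiosity.le_irradiance (ha : ∀ α, 0 < a α) (hΛ : ∀ α β, 0 ≤ Λ α β)
    (hq : ∀ α, 0 ≤ q α) (hrow : ∀ α, ∑ β, Λ α β + q α = a α) (hσ : 0 < σ)
    (he : ∀ x ≥ 0, 0 < e x) (he1 : ∀ x ≥ 0, e x ≤ 1) (h : IsRadiosity a q Λ σ θ e u R)
    (hu : ∀ α, 0 ≤ u α) {L : ℝ} (hL : 0 ≤ L) (hLu : ∀ α, L ≤ u α) (hLθ : L ≤ θ) (α : J) :
    a α * (σ * L ^ 4) ≤ ∑ β, Λ α β * R β + q α * (σ * θ ^ 4) := by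
  have hθ4 : σ * L ^ 4 ≤ σ * θ ^ 4 := by gcongr
  have hR := le_radiosity ha hΛ hq hrow (w := R) (C := σ * L ^ 4) (e := fun α => e (u α))
    (fun α => he _ (hu α)) (fun α => he1 _ (hu α)) (fun β => by
      rw [h β]
      have h1 : q β * (σ * L ^ 4) ≤ q β * (σ * θ ^ 4) := mul_le_mul_of_nonneg_left hθ4 (hq β)
      have h2 : L ^ 4 ≤ u β ^ 4 := pow_le_pow_left₀ hL (hLu β) 4
      have h3 : 0 ≤ e (u β) * a β := mul_nonneg (he _ (hu β)).le (ha β).le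
      have h4 : 0 ≤ 1 - e (u β) := sub_nonneg.2 (he1 _ (hu β))
      have h5 := mul_le_mul_of_nonneg_left h1 h4
      have h6 := mul_le_mul_of_nonneg_left h2 (mul_nonneg h3 hσ.le)
      nlinarith)
  rw [← hrow α, add_mul, Finset.sum_mul]
  exact add_le_add (Finset.sum_le_sum fun β _ => mul_le_mul_of_nonneg_left (hR β) (hΛ α β))
    (mul_le_mul_of_nonneg_left hθ4 (hq α))

theorem abs_pow_four_sub_le {x y d M : ℝ} (hx : 0 ≤ x) (hy : 0 ≤ y) (hxM : x ≤ M) (hyM : y ≤ M)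
    (hd : |x - y| ≤ d) : |x ^ 4 - y ^ 4| ≤ 4 * M ^ 3 * d := by
  have h : x ^ 4 - y ^ 4 = (x ^ 3 + x ^ 2 * y + x * y ^ 2 + y ^ 3) * (x - y) := by ring
  have hM : 0 ≤ M := hx.trans hxM
  have h1 : 0 ≤ x ^ 3 + x ^ 2 * y + x * y ^ 2 + y ^ 3 := by positivity
  have h2 : x ^ 3 + x ^ 2 * y + x * y ^ 2 + y ^ 3 ≤ 4 * M ^ 3 := by
    have : x ^ 3 + x ^ 2 * y + x * y ^ 2 + y ^ 3 ≤ M ^ 3 + M ^ 2 * M + M * M ^ 2 + M ^ 3 := by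
      gcongr
    linarith [this, (by ring : M ^ 3 + M ^ 2 * M + M * M ^ 2 + M ^ 3 = 4 * M ^ 3)]
  rw [h, abs_mul, abs_of_nonneg h1]
  exact mul_le_mul h2 hd (abs_nonneg _) (by positivity)

/-- The difference R - R' solves a radiosity equation whose source measures the change of
temperature and of emissivity. The maximum principle needs that source in the form e a C. The
temperature part carries the factor e already and gives 4M³; the emissivity part does not, which
costs the factor `em⁻¹`. -/
theorem IsRadiosity.irradiance_sub_le (ha : ∀ α, 0 < a α) (hΛ : ∀ α β, 0 ≤ Λ α β)
    (hq : ∀ α, 0 ≤ q α) (hrow : ∀ α, ∑ β, Λ α β + q α = a α) (hσ : 0 < σ) (hθ : 0 < θ)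
    (he : ∀ x ≥ 0, 0 < e x) (he1 : ∀ x ≥ 0, e x ≤ 1) (h : IsRadiosity a q Λ σ θ e u R)
    (h' : IsRadiosity a q Λ σ θ e v R') {M Lip em d : ℝ} (hθM : θ ≤ M) (hem : 0 < em)
    (hu : ∀ α, u α ∈ Icc 0 M) (hv : ∀ α, v α ∈ Icc 0 M)
    (hLip : ∀ x ∈ Icc 0 M, ∀ y ∈ Icc 0 M, |e x - e y| ≤ Lip * |x - y|) (hLip0 : 0 ≤ Lip)
    (hmin : ∀ x ∈ Icc 0 M, em ≤ e x) (hd : ∀ α, |u α - v α| ≤ d) (α : J) :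
    (∑ β, Λ α β * R β + q α * (σ * θ ^ 4)) - (∑ β, Λ α β * R' β + q α * (σ * θ ^ 4)) ≤
      a α * (σ * (4 * M ^ 3 + M ^ 4 * Lip * em⁻¹) * d) := by
  have hd0 : 0 ≤ d := (abs_nonneg _).trans (hd α)
  have hM0 : 0 ≤ M := hθ.le.trans hθM
  set C := σ * (4 * M ^ 3 + M ^ 4 * Lip * em⁻¹) * d with hC
  have hC0 : 0 ≤ C := by positivity
  have hδ := radiosity_le ha hΛ hq hrow (w := fun β => R β - R' β) (C := C)
    (e := fun α => e (u α)) (fun α => he _ (hu α).1) (fun α => he1 _ (hu α).1) (fun β => by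
      have hle := h'.irradiance_le ha hΛ hq hrow hσ hθ he he1 (fun γ => (hv γ).1)
        (fun γ => (hv γ).2) hθM β
      have hge := h'.le_irradiance ha hΛ hq hrow hσ he he1 (fun γ => (hv γ).1) le_rfl
        (fun γ => (hv γ).1) hθ.le β
      set K' := ∑ γ, Λ β γ * R' γ + q β * (σ * θ ^ 4) with hK'
      -- The phantom contribution cancels apart from its share in K', and the change of emissivity
      -- multiplies the net balance of the element in the state v.
      have heq : a β * (R β - R' β) = (1 - e (u β)) * (∑ γ, Λ β γ * (R γ - R' γ)) +
          e (u β) * (a β * (σ * (u β ^ 4 - v β ^ 4))) +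
          (e (u β) - e (v β)) * (a β * σ * v β ^ 4 - K') := by
        have h1 := h β
        have h2 := h' β
        simp only [mul_sub, Finset.sum_sub_distrib]
        rw [h1, h2, hK']
        ring
      have hb1 : a β * (σ * (u β ^ 4 - v β ^ 4)) ≤ a β * (σ * (4 * M ^ 3 * d)) := by
        have := (le_abs_self _).trans (abs_pow_four_sub_le (hu β).1 (hv β).1 (hu β).2 (hv β).2 (hd β))
        have := (ha β).le
        gcongr
      have hv4 : a β * σ * v β ^ 4 ≤ a β * σ * M ^ 4 := by
        have := (ha β).le
        have := (hv β).1
        have := (hv β).2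
        gcongr
      have hv40 : 0 ≤ a β * σ * v β ^ 4 :=
        mul_nonneg (mul_nonneg (ha β).le hσ.le) (pow_nonneg (hv β).1 4)
      have hb2 : (e (u β) - e (v β)) * (a β * σ * v β ^ 4 - K') ≤
          e (u β) * (a β * (σ * (M ^ 4 * Lip * em⁻¹ * d))) := by
        -- Both terms lie in [0, aσM⁴], so their difference is bounded by aσM⁴ and not by twice
        -- that.
        have h3 : |a β * σ * v β ^ 4 - K'| ≤ a β * σ * M ^ 4 := by
          rw [abs_le]; constructor <;> nlinarith
        have h4 : |e (u β) - e (v β)| ≤ Lip * d :=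
          (hLip _ (hu β) _ (hv β)).trans (mul_le_mul_of_nonneg_left (hd β) hLip0)
        have h5 : (1 : ℝ) ≤ e (u β) * em⁻¹ := by
          rw [← div_eq_mul_inv, one_le_div hem]; exact hmin _ (hu β)
        calc _ ≤ |e (u β) - e (v β)| * |a β * σ * v β ^ 4 - K'| := by
              rw [← abs_mul]; exact le_abs_self _
          _ ≤ (Lip * d) * (a β * σ * M ^ 4) := by gcongr
          _ = 1 * ((Lip * d) * (a β * σ * M ^ 4)) := (one_mul _).symm
          _ ≤ (e (u β) * em⁻¹) * ((Lip * d) * (a β * σ * M ^ 4)) := by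
              have := (ha β).le
              gcongr
          _ = _ := by ring
      -- The maximum principle allows this phantom term on the right-hand side; here it is slack.
      have hqC : 0 ≤ (1 - e (u β)) * (q β * C) :=
        mul_nonneg (sub_nonneg.2 (he1 _ (hu β).1)) (mul_nonneg (hq β) hC0)
      have hb1' := mul_le_mul_of_nonneg_left hb1 (he _ (hu β).1).le
      have hsum : e (u β) * a β * C = e (u β) * (a β * (σ * (4 * M ^ 3 * d))) +
          e (u β) * (a β * (σ * (M ^ 4 * Lip * em⁻¹ * d))) := by rw [hC]; ring
      rw [heq, hsum]
      linarith)
  have hsum : (∑ β, Λ α β * R β + q α * (σ * θ ^ 4)) - (∑ β, Λ α β * R' β + q α * (σ * θ ^ 4)) =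
      ∑ β, Λ α β * (R β - R' β) := by
    simp only [mul_sub, Finset.sum_sub_distrib]; ring
  rw [hsum, ← hrow α, add_mul, Finset.sum_mul]
  have := mul_nonneg (hq α) hC0
  have := Finset.sum_le_sum fun β (_ : β ∈ Finset.univ) =>
    mul_le_mul_of_nonneg_left (hδ β) (hΛ α β)
  linarith

end Radiosity

/-! ### Nodal systems -/

/-- The algebraic structure of one implicit time step: storage `W`, conductances `c`, emitted
radiation with surface weights `A`, `Fr`, irradiation `Q`, and sources `F`. -/
structure NodalSystem (I : Type*) [Fintype I] where
  W : I → ℝ → ℝ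
  slope : I → ℝ
  slope_pos : ∀ i, 0 < slope i
  W_growth : ∀ i s t, 0 ≤ s → s ≤ t → slope i * (t - s) ≤ W i t - W i s
  W_cont : ∀ i, ContinuousOn (W i) (Ici 0)
  v : I → ℝ
  v_nonneg : ∀ i, 0 ≤ v i
  W_v : ∀ i, W i (v i) = 0
  c : I → I → ℝ
  c_nonneg : ∀ i j, 0 ≤ c i j
  σ : ℝ
  σ_pos : 0 < σ
  θ : ℝ
  θ_pos : 0 < θ
  e : ℝ → ℝ
  e_pos : ∀ x ≥ 0, 0 < e x
  e_le_one : ∀ x ≥ 0, e x ≤ 1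
  A : I → ℝ
  A_nonneg : ∀ i, 0 ≤ A i
  Fr : I → ℝ
  Fr_nonneg : ∀ i, 0 ≤ Fr i
  F : I → ℝ
  F_nonneg : ∀ i, 0 ≤ F i
  Q : I → (I → ℝ) → ℝ
  Q_le : ∀ w U, (∀ j, 0 ≤ w j) → (∀ j, w j ≤ U) → θ ≤ U → ∀ i, Q i w ≤ A i * (σ * U ^ 4)
  le_Q : ∀ w L, 0 ≤ L → (∀ j, L ≤ w j) → L ≤ θ → ∀ i, A i * (σ * L ^ 4) ≤ Q i w

namespace NodalSystem

variable {I : Type*} [Fintype I] (S : NodalSystem I)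

/-- The residual at node `i` with nodal value `s`, all other values being given by `w`. -/
def residual (i : I) (s : ℝ) (w : I → ℝ) : ℝ :=
  S.W i s - ∑ j, S.c i j * (w j - s) + S.σ * S.e s * s ^ 4 * S.A i - S.e s * S.Q i w
    + S.σ * S.e s * (s ^ 4 - S.θ ^ 4) * S.Fr i - S.F i

/-- At the hottest node j, if u j > M ≥ θ, conduction flows outwards, emission covers the absorbed
irradiation and the free boundary loses heat. So `W j (u j)` is at most the source, hence at most
slope * (M - v j), whereas growth from v j forces it to be strictly larger. -/
theorem le_of_residual_eq_zero [Nonempty I] {M : ℝ} (hθM : S.θ ≤ M)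
    (hM : ∀ i, S.F i ≤ S.slope i * (M - S.v i)) {u : I → ℝ} (hu : ∀ i, 0 ≤ u i)
    (h : ∀ i, S.residual i (u i) u = 0) (i : I) : u i ≤ M := by
  obtain ⟨j, -, hj⟩ := Finset.exists_max_image Finset.univ u Finset.univ_nonempty
  refine (hj i (Finset.mem_univ i)).trans ?_
  by_contra! hlt
  have hθ : S.θ < u j := hθM.trans_lt hlt
  have hvM : S.v j ≤ M := by
    by_contra! hv
    have := mul_neg_of_pos_of_neg (S.slope_pos j) (sub_neg.2 hv)
    linarith [S.F_nonneg j, hM j]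
  have hQ := S.Q_le u (u j) hu (fun k => hj k (Finset.mem_univ k)) hθ.le j
  have hW := S.W_growth j (S.v j) (u j) (S.v_nonneg j) (hvM.trans hlt.le)
  rw [S.W_v, sub_zero] at hW
  have hW' : S.slope j * (M - S.v j) < S.slope j * (u j - S.v j) :=
    mul_lt_mul_of_pos_left (by linarith) (S.slope_pos j)
  have hc : ∑ k, S.c j k * (u k - u j) ≤ 0 := Finset.sum_nonpos fun k _ =>
    mul_nonpos_of_nonneg_of_nonpos (S.c_nonneg j k) (sub_nonpos.2 (hj k (Finset.mem_univ k)))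
  have he := (S.e_pos (u j) (hu j)).le
  have h4 : S.θ ^ 4 ≤ u j ^ 4 := pow_le_pow_left₀ S.θ_pos.le hθ.le 4
  have hfr : 0 ≤ S.σ * S.e (u j) * (u j ^ 4 - S.θ ^ 4) * S.Fr j :=
    mul_nonneg (mul_nonneg (mul_nonneg S.σ_pos.le he) (sub_nonneg.2 h4)) (S.Fr_nonneg j)
  have hQ' := mul_le_mul_of_nonneg_left hQ he
  have := h j
  unfold residual at this
  linarith [hM j]

/-- At the coldest node, if below m, no flux removes heat and the sources are nonnegative, so the
stored energy could not have dropped below its old value. -/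
theorem le_of_residual_eq_zero_of_le [Nonempty I] {m : ℝ} (hmθ : m ≤ S.θ)
    (hmv : ∀ i, m ≤ S.v i) {u : I → ℝ} (hu : ∀ i, 0 ≤ u i)
    (h : ∀ i, S.residual i (u i) u = 0) (i : I) : m ≤ u i := by
  obtain ⟨j, -, hj⟩ := Finset.exists_min_image Finset.univ u Finset.univ_nonempty
  refine le_trans ?_ (hj i (Finset.mem_univ i))
  by_contra! hlt
  have hθ : u j < S.θ := hlt.trans_le hmθ
  have hQ := S.le_Q u (u j) (hu j) (fun k => hj k (Finset.mem_univ k)) hθ.le j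
  have hv : u j < S.v j := hlt.trans_le (hmv j)
  have hW := S.W_growth j (u j) (S.v j) (hu j) hv.le
  rw [S.W_v] at hW
  have hW' : 0 < S.slope j * (S.v j - u j) := mul_pos (S.slope_pos j) (sub_pos.2 hv)
  have hc : 0 ≤ ∑ k, S.c j k * (u k - u j) := Finset.sum_nonneg fun k _ =>
    mul_nonneg (S.c_nonneg j k) (sub_nonneg.2 (hj k (Finset.mem_univ k)))
  have he := (S.e_pos (u j) (hu j)).le
  have h4 : u j ^ 4 ≤ S.θ ^ 4 := pow_le_pow_left₀ (hu j) hθ.le 4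
  have hfr : S.σ * S.e (u j) * (u j ^ 4 - S.θ ^ 4) * S.Fr j ≤ 0 :=
    mul_nonpos_of_nonpos_of_nonneg (mul_nonpos_of_nonneg_of_nonpos
      (mul_nonneg S.σ_pos.le he) (sub_nonpos.2 h4)) (S.Fr_nonneg j)
  have hQ' := mul_le_mul_of_nonneg_left hQ he
  have := h j
  unfold residual at this
  linarith [S.F_nonneg j]

variable {m M Lip em : ℝ}

/-- The growth rate of the residual in the nodal value. -/
def growth (M Lip : ℝ) (i : I) : ℝ :=
  S.slope i + ∑ j, S.c i j - S.σ * (Lip * M ^ 4) * (S.A i + S.Fr i)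
    - S.σ * (Lip * S.θ ^ 4) * S.Fr i - S.σ * (Lip * M ^ 4) * S.A i

/-- The Lipschitz constant of the residual in the remaining values. -/
noncomputable def coupling (M Lip em : ℝ) (i : I) : ℝ :=
  ∑ j, S.c i j + S.A i * (S.σ * (4 * M ^ 3 + M ^ 4 * Lip * em⁻¹))

/-- Storage and conduction increase with s. Only variations of the emissivity can work against this:
e(t)t⁴ - e(s)s⁴ ≥ (e(t) - e(s))s⁴ costs Lip M⁴ on A and Fr, the factor in front of Q costs Lip σM⁴
A, and the external term costs Lip σθ⁴ Fr. -/
theorem growth_mul_le (hθM : S.θ ≤ M) (hm : 0 ≤ m) (hLip0 : 0 ≤ Lip)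
    (hLip : ∀ x ∈ Icc 0 M, ∀ y ∈ Icc 0 M, |S.e x - S.e y| ≤ Lip * |x - y|) {w : I → ℝ}
    (hw : ∀ j, w j ∈ Icc m M) {s t : ℝ} (hs : 0 ≤ s) (hst : s ≤ t) (ht : t ≤ M) (i : I) :
    S.growth M Lip i * (t - s) ≤ S.residual i t w - S.residual i s w := by
  have hW := S.W_growth i s t hs hst
  have hM0 : 0 ≤ M := hs.trans (hst.trans ht)
  have hQ := S.Q_le w M (fun j => hm.trans (hw j).1) (fun j => (hw j).2) hθM i
  have hQ0 := S.le_Q w 0 le_rfl (fun j => hm.trans (hw j).1) S.θ_pos.le i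
  have hL := hLip t ⟨hs.trans hst, ht⟩ s ⟨hs, hst.trans ht⟩
  rw [abs_of_nonneg (sub_nonneg.2 hst)] at hL
  obtain ⟨hL1, hL2⟩ := abs_le.1 hL
  have hts : 0 ≤ t - s := sub_nonneg.2 hst
  have hs4 : s ^ 4 ≤ M ^ 4 := pow_le_pow_left₀ hs (hst.trans ht) 4
  have hst4 : s ^ 4 ≤ t ^ 4 := pow_le_pow_left₀ hs hst 4
  have hs40 : 0 ≤ s ^ 4 := by positivity
  have het := (S.e_pos t (hs.trans hst)).le
  have hrad : -(Lip * M ^ 4) * (t - s) ≤ S.e t * t ^ 4 - S.e s * s ^ 4 := by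
    have h1 : 0 ≤ S.e t * (t ^ 4 - s ^ 4) := mul_nonneg het (sub_nonneg.2 hst4)
    have h2 := mul_le_mul_of_nonneg_right hL1 hs40
    have h3 := mul_le_mul_of_nonneg_left hs4 (mul_nonneg hLip0 hts)
    nlinarith
  have hrad' := mul_le_mul_of_nonneg_left hrad
    (mul_nonneg S.σ_pos.le (add_nonneg (S.A_nonneg i) (S.Fr_nonneg i)))
  have hfree := mul_le_mul_of_nonneg_left hL2
    (mul_nonneg (mul_nonneg S.σ_pos.le (pow_nonneg S.θ_pos.le 4)) (S.Fr_nonneg i))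
  have hirr : (S.e t - S.e s) * S.Q i w ≤ (Lip * (t - s)) * (S.A i * (S.σ * M ^ 4)) := by
    have : 0 ≤ S.Q i w := by simpa using hQ0
    exact mul_le_mul hL2 hQ this (mul_nonneg hLip0 hts)
  have hsum : ∑ j, S.c i j * (w j - t) - ∑ j, S.c i j * (w j - s) =
      -((∑ j, S.c i j) * (t - s)) := by
    rw [← Finset.sum_sub_distrib, Finset.sum_mul, ← Finset.sum_neg_distrib]
    exact Finset.sum_congr rfl fun j _ => by ring
  unfold residual growth
  linarith

/-- Only conduction and irradiation see the frozen values. The one-sided bound on Q is used in both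
directions, and e ≤ 1 removes the emissivity. -/
theorem abs_residual_sub_le (hm : 0 ≤ m)
    (hQL : ∀ w w' d, (∀ j, w j ∈ Icc 0 M) → (∀ j, w' j ∈ Icc 0 M) → (∀ j, |w j - w' j| ≤ d) →
      ∀ i, S.Q i w - S.Q i w' ≤ S.A i * (S.σ * (4 * M ^ 3 + M ^ 4 * Lip * em⁻¹) * d))
    {w w' : I → ℝ} (hw : ∀ j, w j ∈ Icc m M) (hw' : ∀ j, w' j ∈ Icc m M) {d : ℝ}
    (hd : ∀ j, |w j - w' j| ≤ d) {s : ℝ} (hs : 0 ≤ s) (i : I) :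
    |S.residual i s w - S.residual i s w'| ≤ S.coupling M Lip em i * d := by
  have h0 (j) : w j ∈ Icc 0 M := ⟨hm.trans (hw j).1, (hw j).2⟩
  have h0' (j) : w' j ∈ Icc 0 M := ⟨hm.trans (hw' j).1, (hw' j).2⟩
  have h1 := hQL w w' d h0 h0' hd i
  have h2 := hQL w' w d h0' h0 (fun j => by rw [abs_sub_comm]; exact hd j) i
  have hQ : |S.e s * (S.Q i w - S.Q i w')| ≤
      S.A i * (S.σ * (4 * M ^ 3 + M ^ 4 * Lip * em⁻¹) * d) := by
    rw [abs_mul, abs_of_nonneg (S.e_pos s hs).le]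
    refine (mul_le_of_le_one_left (abs_nonneg _) (S.e_le_one s hs)).trans ?_
    rw [abs_le]; constructor <;> linarith
  have hc : |∑ j, S.c i j * (w j - w' j)| ≤ (∑ j, S.c i j) * d := by
    rw [Finset.sum_mul]
    refine (Finset.abs_sum_le_sum_abs _ _).trans (Finset.sum_le_sum fun j _ => ?_)
    rw [abs_mul, abs_of_nonneg (S.c_nonneg i j)]
    exact mul_le_mul_of_nonneg_left (hd j) (S.c_nonneg i j)
  have heq : S.residual i s w - S.residual i s w' =
      -(∑ j, S.c i j * (w j - w' j)) + -(S.e s * (S.Q i w - S.Q i w')) := by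
    unfold residual
    simp only [mul_sub, Finset.sum_sub_distrib]
    ring
  rw [heq]
  refine (abs_add_le _ _).trans ?_
  rw [abs_neg, abs_neg]
  unfold coupling
  linarith

/-- For w in the box each equation has a root in [m, M] by the intermediate value theorem, and the
vector of roots depends contractively on w in the sup norm. The frozen w keeps its own i-th entry,
so the equations decouple completely, and fixed points of the root map solve the coupled system. -/
theorem existsUnique_residual_eq_zero [Nonempty I] (hm : 0 ≤ m) (hmθ : m ≤ S.θ)
    (hmv : ∀ i, m ≤ S.v i) (hθM : S.θ ≤ M) (hM : ∀ i, S.F i ≤ S.slope i * (M - S.v i))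
    (hLip0 : 0 ≤ Lip)
    (hLip : ∀ x ∈ Icc 0 M, ∀ y ∈ Icc 0 M, |S.e x - S.e y| ≤ Lip * |x - y|) (hem : 0 < em)
    (hQL : ∀ w w' d, (∀ j, w j ∈ Icc 0 M) → (∀ j, w' j ∈ Icc 0 M) → (∀ j, |w j - w' j| ≤ d) →
      ∀ i, S.Q i w - S.Q i w' ≤ S.A i * (S.σ * (4 * M ^ 3 + M ^ 4 * Lip * em⁻¹) * d))
    (hsmall : ∀ i, S.coupling M Lip em i < S.growth M Lip i) :
    ∃! u : I → ℝ, (∀ i, u i ∈ Icc m M) ∧ ∀ i, S.residual i (u i) u = 0 := by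
  have hM0 : 0 ≤ M := S.θ_pos.le.trans hθM
  have hmM : m ≤ M := hmθ.trans hθM
  have hcoup (i) : 0 ≤ S.coupling M Lip em i := by
    have := S.A_nonneg i
    have := S.σ_pos
    have := Finset.sum_nonneg fun j (_ : j ∈ Finset.univ) => S.c_nonneg i j
    unfold coupling
    positivity
  have hgrow (i) : 0 < S.growth M Lip i := (hcoup i).trans_lt (hsmall i)
  -- The largest of the finitely many ratios coupling/growth is a uniform contraction factor.
  obtain ⟨κ, hκ0, hκ1, hκ⟩ : ∃ κ : ℝ, 0 ≤ κ ∧ κ < 1 ∧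
      ∀ i, S.coupling M Lip em i ≤ κ * S.growth M Lip i := by
    obtain ⟨j, -, hj⟩ := Finset.exists_max_image Finset.univ
      (fun i => S.coupling M Lip em i / S.growth M Lip i) Finset.univ_nonempty
    refine ⟨_, div_nonneg (hcoup j) (hgrow j).le, (div_lt_one (hgrow j)).2 (hsmall j), fun i => ?_⟩
    exact (div_le_iff₀ (hgrow i)).1 (hj i (Finset.mem_univ i))
  -- roots depend contractively on the remaining values
  have hcontr {w w' u u' : I → ℝ} (hw : ∀ j, w j ∈ Icc m M) (hw' : ∀ j, w' j ∈ Icc m M)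
      (hu : ∀ j, u j ∈ Icc m M) (hu' : ∀ j, u' j ∈ Icc m M) {d : ℝ} (hd : ∀ j, |w j - w' j| ≤ d)
      (h : ∀ i, S.residual i (u i) w = 0) (h' : ∀ i, S.residual i (u' i) w' = 0) (i : I) :
      |u i - u' i| ≤ κ * d := by
    wlog hle : u' i ≤ u i generalizing w w' u u'
    · rw [abs_sub_comm]
      exact this hw' hw hu' hu (fun j => by rw [abs_sub_comm]; exact hd j) h' h
        (le_of_not_ge hle)
    have hd0 : 0 ≤ d := (abs_nonneg _).trans (hd i)
    -- Both estimates concern the mixed residual at `u i` with frozen values w': it is at least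
    -- growth * (u i - u' i) and at most coupling * d.
    have h1 := S.growth_mul_le hθM hm hLip0 hLip hw' (hm.trans (hu' i).1) hle (hu i).2 i
    have h2 := S.abs_residual_sub_le hm hQL hw hw' hd (hm.trans (hu i).1) i
    rw [h i, zero_sub, abs_neg] at h2
    rw [h' i, sub_zero] at h1
    have h3 := mul_le_mul_of_nonneg_right (hκ i) hd0
    rw [abs_of_nonneg (sub_nonneg.2 hle)]
    have h4 : S.growth M Lip i * (u i - u' i) ≤ S.growth M Lip i * (κ * d) := by
      linarith [le_abs_self (S.residual i (u i) w')]
    exact le_of_mul_le_mul_left h4 (hgrow i)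
  have hecont : ContinuousOn S.e (Icc 0 M) := by
    have : LipschitzOnWith ⟨Lip, hLip0⟩ S.e (Icc 0 M) :=
      LipschitzOnWith.of_dist_le_mul fun x hx y hy => by
        rw [Real.dist_eq, Real.dist_eq]; exact hLip x hx y hy
    exact this.continuousOn
  have hroot (w : I → ℝ) (hw : ∀ j, w j ∈ Icc m M) (i : I) :
      ∃ s ∈ Icc m M, S.residual i s w = 0 := by
    have hcont : ContinuousOn (fun s => S.residual i s w) (Icc m M) := by
      have h1 := (S.W_cont i).mono (show Icc m M ⊆ Ici 0 from fun x hx => hm.trans hx.1)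
      have h2 := hecont.mono (show Icc m M ⊆ Icc 0 M from Icc_subset_Icc_left hm)
      unfold residual
      fun_prop
    -- The signs at the two ends of [m, M] come from the same heat balance as the a priori bounds.
    have hlow : S.residual i m w ≤ 0 := by
      have hQ := S.le_Q w m hm (fun j => (hw j).1) hmθ i
      have hW := S.W_growth i m (S.v i) hm (hmv i)
      rw [S.W_v] at hW
      have hW' : 0 ≤ S.slope i * (S.v i - m) :=
        mul_nonneg (S.slope_pos i).le (sub_nonneg.2 (hmv i))
      have hc : 0 ≤ ∑ k, S.c i k * (w k - m) := Finset.sum_nonneg fun k _ =>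
        mul_nonneg (S.c_nonneg i k) (sub_nonneg.2 (hw k).1)
      have he := (S.e_pos m hm).le
      have hfr : S.σ * S.e m * (m ^ 4 - S.θ ^ 4) * S.Fr i ≤ 0 :=
        mul_nonpos_of_nonpos_of_nonneg (mul_nonpos_of_nonneg_of_nonpos
          (mul_nonneg S.σ_pos.le he) (sub_nonpos.2 (pow_le_pow_left₀ hm hmθ 4))) (S.Fr_nonneg i)
      have hQ' := mul_le_mul_of_nonneg_left hQ he
      unfold residual
      linarith [S.F_nonneg i]
    have hup : 0 ≤ S.residual i M w := by
      have hvM : S.v i ≤ M := by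
        by_contra! hv
        have := mul_neg_of_pos_of_neg (S.slope_pos i) (sub_neg.2 hv)
        linarith [S.F_nonneg i, hM i]
      have hQ := S.Q_le w M (fun j => hm.trans (hw j).1) (fun j => (hw j).2) hθM i
      have hW := S.W_growth i (S.v i) M (S.v_nonneg i) hvM
      rw [S.W_v, sub_zero] at hW
      have hc : ∑ k, S.c i k * (w k - M) ≤ 0 := Finset.sum_nonpos fun k _ =>
        mul_nonpos_of_nonneg_of_nonpos (S.c_nonneg i k) (sub_nonpos.2 (hw k).2)
      have he := (S.e_pos M hM0).le
      have hfr : 0 ≤ S.σ * S.e M * (M ^ 4 - S.θ ^ 4) * S.Fr i :=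
        mul_nonneg (mul_nonneg (mul_nonneg S.σ_pos.le he)
          (sub_nonneg.2 (pow_le_pow_left₀ S.θ_pos.le hθM 4))) (S.Fr_nonneg i)
      have hQ' := mul_le_mul_of_nonneg_left hQ he
      unfold residual
      linarith [hM i]
    exact intermediate_value_Icc hmM hcont ⟨hlow, hup⟩
  choose T hT hT0 using hroot
  lift κ to NNReal using hκ0
  set Box : Set (I → ℝ) := Icc (fun _ => m) (fun _ => M) with hBox
  have hmem {w : I → ℝ} : w ∈ Box ↔ ∀ j, w j ∈ Icc m M :=
    ⟨fun h j => ⟨h.1 j, h.2 j⟩, fun h => ⟨fun j => (h j).1, fun j => (h j).2⟩⟩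
  let f : Box → Box := fun w => ⟨fun i => T w.1 (hmem.1 w.2) i, hmem.2 fun i => hT _ _ i⟩
  have hf : ContractingWith κ f := by
    refine ⟨by exact_mod_cast hκ1, LipschitzWith.of_dist_le_mul fun w w' => ?_⟩
    refine (dist_pi_le_iff (mul_nonneg κ.2 dist_nonneg)).2 fun i => ?_
    rw [Real.dist_eq]
    exact hcontr (hmem.1 w.2) (hmem.1 w'.2) (fun j => hT _ _ j) (fun j => hT _ _ j)
      (fun j => by rw [← Real.dist_eq]; exact dist_le_pi_dist w.1 w'.1 j)
      (fun j => hT0 _ _ j) (fun j => hT0 _ _ j) i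
  have : Nonempty Box := ⟨⟨fun _ => m, hmem.2 fun _ => ⟨le_rfl, hmM⟩⟩⟩
  have : CompleteSpace Box := (isClosed_Icc).completeSpace_coe
  set z := hf.fixedPoint f with hz
  have hzfix : f z = z := hf.fixedPoint_isFixedPt
  refine ⟨z.1, ⟨hmem.1 z.2, fun i => ?_⟩, fun u hu => ?_⟩
  · have h1 : T z.1 (hmem.1 z.2) i = z.1 i := congrFun (congrArg Subtype.val hzfix) i
    have h2 := hT0 z.1 (hmem.1 z.2) i
    rwa [h1] at h2
  · have hzr (i) : S.residual i (z.1 i) z.1 = 0 := by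
      have h1 : T z.1 (hmem.1 z.2) i = z.1 i := congrFun (congrArg Subtype.val hzfix) i
      have h2 := hT0 z.1 (hmem.1 z.2) i
      rwa [h1] at h2
    -- A solution is a vector of roots for itself, so the contraction estimate applies directly to u
    -- and z. With d their sup distance it gives d ≤ κd, hence d = 0.
    obtain ⟨j, -, hj⟩ := Finset.exists_max_image Finset.univ (fun i => |u i - z.1 i|)
      Finset.univ_nonempty
    have h1 := hcontr hu.1 (hmem.1 z.2) hu.1 (hmem.1 z.2)
      (fun i => hj i (Finset.mem_univ i)) hu.2 hzr j
    have h2 : |u j - z.1 j| ≤ 0 := by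
      by_contra! hpos
      nlinarith
    ext i
    exact sub_eq_zero.1 (abs_nonpos_iff.1 ((hj i (Finset.mem_univ i)).trans h2))

end NodalSystem

/-! ### Planes in space -/

/-- The Euclidean plane. -/
abbrev E2 : Type := EuclideanSpace ℝ (Fin 2)

/-- The plane with normal `ν` at signed distance `c` from the origin. -/
def plane (ν : E3) (c : ℝ) : Set E3 := {y | inner ℝ ν y = c}

theorem isClosed_plane (ν : E3) (c : ℝ) : IsClosed (plane ν c) :=
  isClosed_eq (by fun_prop) continuous_const

theorem exists_frame {ν : E3} (hν : ‖ν‖ = 1) :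
    ∃ φ : E2 →ₗᵢ[ℝ] E3, ∀ y, y ∈ range φ ↔ inner ℝ ν y = 0 := by
  have hν0 : ν ≠ 0 := by rintro rfl; simp at hν
  have : Fact (Module.finrank ℝ E3 = 2 + 1) := ⟨by simp⟩
  have hfin : Module.finrank ℝ (ℝ ∙ ν)ᗮ = 2 := Submodule.finrank_orthogonal_span_singleton hν0
  let e := ((stdOrthonormalBasis ℝ (ℝ ∙ ν)ᗮ).reindex (finCongr hfin)).repr.symm
  refine ⟨(ℝ ∙ ν)ᗮ.subtypeₗᵢ.comp e.toLinearIsometry, fun y => ?_⟩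
  rw [← Submodule.mem_orthogonal_singleton_iff_inner_right]
  constructor
  · rintro ⟨s, rfl⟩
    exact (e s).2
  · intro hy
    exact ⟨e.symm ⟨y, hy⟩, by simp⟩

section Frame

variable {ν : E3} (hν : ‖ν‖ = 1) {φ : E2 →ₗᵢ[ℝ] E3} (hφ : ∀ y, y ∈ range φ ↔ inner ℝ ν y = 0)

include hφ

theorem inner_frame (s : E2) : inner ℝ ν (φ s) = 0 := (hφ _).1 ⟨s, rfl⟩

include hν

theorem inner_frame_add (s : E2) (c : ℝ) : inner ℝ ν (φ s + c • ν) = c := by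
  rw [inner_add_right, inner_frame hφ, inner_smul_right, real_inner_self_eq_norm_sq, hν]
  ring

theorem range_frame_add (c : ℝ) : range (fun s => φ s + c • ν) = plane ν c := by
  ext y
  constructor
  · rintro ⟨s, rfl⟩
    exact inner_frame_add hν hφ s c
  · intro hy
    obtain ⟨s, hs⟩ := (hφ (y - c • ν)).2 (by
      rw [inner_sub_right, inner_smul_right, real_inner_self_eq_norm_sq, hν, show inner ℝ ν y = c from hy]
      ring)
    exact ⟨s, by simp [hs]⟩

/-- An isometric chart carries planar Lebesgue measure to surface measure on the plane, so surface
integrals become integrals over `E2`. -/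
theorem map_frame (c : ℝ) :
    (volume : Measure E2).map (fun s => φ s + c • ν) = (μHE[2] : Measure E3).restrict (plane ν c) := by
  have hiso : Isometry (fun s => φ s + c • ν) :=
    (IsometryEquiv.addRight (c • ν)).isometry.comp φ.isometry
  rw [← EuclideanSpace.euclideanHausdorffMeasure_eq_volume 2, hiso.map_euclideanHausdorffMeasure,
    range_frame_add hν hφ]

/-- Since φ s is orthogonal to ν, the map is an isometry for the Euclidean product norm, hence
volume preserving. This is what permits slicing space parallel to a plane. -/
theorem measurePreserving_frame :
    MeasurePreserving (fun p : E2 × ℝ => φ p.1 + p.2 • ν) volume volume := by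
  let L : WithLp 2 (E2 × ℝ) →ₗᵢ[ℝ] E3 :=
    { toLinearMap := (φ.toLinearMap.coprod (LinearMap.toSpanSingleton ℝ E3 ν)).comp
        (WithLp.linearEquiv 2 ℝ (E2 × ℝ)).toLinearMap
      norm_map' := fun p => by
        have h0 : inner ℝ (φ p.fst) (p.snd • ν) = 0 := by
          rw [inner_smul_right, real_inner_comm, inner_frame hφ, mul_zero]
        have h1 : ‖φ p.fst + p.snd • ν‖ ^ 2 = ‖p‖ ^ 2 := by
          rw [pow_two, norm_add_sq_eq_norm_sq_add_norm_sq_of_inner_eq_zero _ _ h0,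
            WithLp.prod_norm_sq_eq_of_L2, φ.norm_map, norm_smul, hν]
          ring
        have := (sq_eq_sq₀ (norm_nonneg _) (norm_nonneg _)).1 h1
        simpa using this }
  have hfr : Module.finrank ℝ (WithLp 2 (E2 × ℝ)) = Module.finrank ℝ E3 := by
    rw [(WithLp.linearEquiv 2 ℝ (E2 × ℝ)).finrank_eq]
    simp
  have h := (L.toLinearIsometryEquiv hfr).measurePreserving.comp
    (WithLp.volume_preserving_toLp E2 ℝ)
  exact h

end Frame

theorem volume_hyperplane {V : Type*} [NormedAddCommGroup V] [InnerProductSpace ℝ V]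
    [FiniteDimensional ℝ V] [MeasurableSpace V] [BorelSpace V] {w : V} (hw : w ≠ 0) (c : ℝ) :
    volume {y : V | inner ℝ w y = c} = 0 := by
  have hne : inner ℝ w w ≠ 0 := inner_self_ne_zero.2 hw
  set p : V := (c / inner ℝ w w) • w with hp
  have hpw : inner ℝ w p = c := by rw [hp, inner_smul_right, div_mul_cancel₀ _ hne]
  have hset : {y : V | inner ℝ w y = c} = AffineSubspace.mk' p (ℝ ∙ w)ᗮ := by
    ext y
    rw [SetLike.mem_coe, AffineSubspace.mem_mk', Submodule.mem_orthogonal_singleton_iff_inner_right,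
      vsub_eq_sub, inner_sub_right, hpw, sub_eq_zero, mem_ofPred_eq]
  rw [hset]
  refine Measure.addHaar_affineSubspace _ _ fun htop => ?_
  have : p + w ∈ (AffineSubspace.mk' p (ℝ ∙ w)ᗮ : Set V) := by rw [htop]; trivial
  rw [← hset, mem_ofPred_eq, inner_add_right, hpw] at this
  exact hne (by linarith)

theorem volume_plane {ν : E3} (hν : ‖ν‖ = 1) (c : ℝ) : volume (plane ν c) = 0 :=
  volume_hyperplane (by rintro rfl; simp at hν) c

theorem area_plane_inter_plane {ν ν' : E3} (hν : ‖ν‖ = 1) (hν' : ‖ν'‖ = 1) {c c' : ℝ}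
    (hne : plane ν c ≠ plane ν' c') : (μHE[2] : Measure E3) (plane ν c ∩ plane ν' c') = 0 := by
  obtain ⟨φ, hφ⟩ := exists_frame hν
  have hm : Measurable fun s => φ s + c • ν := by fun_prop
  rw [inter_comm, ← Measure.restrict_apply (isClosed_plane _ _).measurableSet, ← map_frame hν hφ,
    Measure.map_apply hm (isClosed_plane _ _).measurableSet]
  -- In the coordinates of the first plane, w is the tangential part of ν'. If w ≠ 0 the second
  -- plane cuts out a null line; if w = 0 the planes are parallel.
  set w := φ.toContinuousLinearMap.adjoint ν' with hw
  have hws (s : E2) : inner ℝ w s = inner ℝ ν' (φ s) := by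
    rw [hw, ContinuousLinearMap.adjoint_inner_left]; rfl
  have hset : (fun s => φ s + c • ν) ⁻¹' plane ν' c' =
      {s : E2 | inner ℝ w s = c' - c * inner ℝ ν' ν} := by
    ext s
    simp only [plane, mem_preimage, mem_ofPred_eq, inner_add_right, inner_smul_right, hws,
      eq_sub_iff_add_eq]
  rw [hset]
  by_cases hw0 : w = 0
  · -- the planes are parallel, hence disjoint
    convert measure_empty (μ := (volume : Measure E2))
    rw [eq_empty_iff_forall_notMem]
    intro s hs
    rw [mem_ofPred_eq, hw0, inner_zero_left] at hs
    apply hne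
    -- `ν'` is orthogonal to the range of the frame, so it is a multiple of `ν`
    have hpar : ν' = (inner ℝ ν ν' : ℝ) • ν := by
      have hz : ν' - (inner ℝ ν ν' : ℝ) • ν ∈ range φ := (hφ _).2 (by
        rw [inner_sub_right, inner_smul_right, real_inner_self_eq_norm_sq, hν]; ring)
      obtain ⟨t, ht⟩ := hz
      have h1 : inner ℝ ν' (φ t) = 0 := by rw [← hws, hw0, inner_zero_left]
      have h2 : inner ℝ (φ t) (φ t) = 0 := by
        nth_rewrite 1 [ht]
        rw [inner_sub_left, inner_smul_left, h1, inner_frame hφ]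
        simp
      have h3 := inner_self_eq_zero.1 h2
      rw [h3] at ht
      exact sub_eq_zero.1 ht.symm
    set k : ℝ := inner ℝ ν ν' with hk
    have hk2 : k ≠ 0 := by
      intro h0
      rw [h0, zero_smul] at hpar
      rw [hpar, norm_zero] at hν'
      exact zero_ne_one hν'
    rw [real_inner_comm, ← hk] at hs
    ext y
    simp only [plane, mem_ofPred_eq]
    rw [hpar, inner_smul_left]
    simp only [conj_trivial]
    constructor
    · intro h; rw [h]; linarith
    · intro h
      have : k * (inner ℝ ν y - c) = 0 := by linarith
      exact sub_eq_zero.1 ((mul_eq_zero.1 this).resolve_left hk2)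
  · exact volume_hyperplane hw0 _

theorem area_inter_plane_lt_top {ν : E3} (hν : ‖ν‖ = 1) (c : ℝ) {A : Set E3}
    (hA : Bornology.IsBounded A) : (μHE[2] : Measure E3) (A ∩ plane ν c) < ∞ := by
  obtain ⟨φ, hφ⟩ := exists_frame hν
  obtain ⟨r, hr⟩ := hA.subset_closedBall 0
  refine (measure_mono (inter_subset_inter_left _ hr)).trans_lt ?_
  have hm : Measurable fun s => φ s + c • ν := by fun_prop
  rw [← Measure.restrict_apply Metric.isClosed_closedBall.measurableSet, ← map_frame hν hφ,
    Measure.map_apply hm Metric.isClosed_closedBall.measurableSet]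
  refine (Bornology.IsBounded.subset (Metric.isBounded_closedBall (x := (0 : E2))
    (r := r + ‖c • ν‖)) fun s hs => ?_).measure_lt_top
  rw [mem_preimage, mem_closedBall_zero_iff] at hs
  rw [mem_closedBall_zero_iff, ← φ.norm_map]
  calc ‖φ s‖ = ‖(φ s + c • ν) - c • ν‖ := by rw [add_sub_cancel_right]
    _ ≤ ‖φ s + c • ν‖ + ‖c • ν‖ := norm_sub_le _ _
    _ ≤ _ := by linarith

/-! ### Sets contained in finitely many planes -/

/-- `K` is contained in a finite union of planes. -/
def CoveredByPlanes (K : Set E3) : Prop :=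
  ∃ P : Finset (E3 × ℝ), (∀ p ∈ P, ‖p.1‖ = 1) ∧ ∀ y ∈ K, ∃ p ∈ P, y ∈ plane p.1 p.2

namespace CoveredByPlanes

variable {K L : Set E3}

theorem mono (hK : CoveredByPlanes K) (h : L ⊆ K) : CoveredByPlanes L :=
  let ⟨P, hP, hc⟩ := hK
  ⟨P, hP, fun y hy => hc y (h hy)⟩

theorem iUnion {ι : Type*} [Finite ι] {K : ι → Set E3} (h : ∀ i, CoveredByPlanes (K i)) :
    CoveredByPlanes (⋃ i, K i) := by
  classical
  have := Fintype.ofFinite ι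
  choose P hP hc using h
  refine ⟨Finset.univ.biUnion P, fun p hp => ?_, fun y hy => ?_⟩
  · obtain ⟨i, -, hi⟩ := Finset.mem_biUnion.1 hp
    exact hP i p hi
  · obtain ⟨i, hi⟩ := mem_iUnion.1 hy
    obtain ⟨p, hp, hyp⟩ := hc i y hi
    exact ⟨p, Finset.mem_biUnion.2 ⟨i, Finset.mem_univ i, hp⟩, hyp⟩

theorem union (hK : CoveredByPlanes K) (hL : CoveredByPlanes L) : CoveredByPlanes (K ∪ L) := by
  rw [union_eq_iUnion]
  exact iUnion fun b => by cases b <;> assumption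

theorem volume_eq_zero (hK : CoveredByPlanes K) : volume K = 0 := by
  obtain ⟨P, hP, hc⟩ := hK
  refine measure_mono_null (t := ⋃ p ∈ P, plane p.1 p.2) (fun y hy => by simpa using hc y hy) ?_
  exact (measure_biUnion_null_iff P.countable_toSet).2 fun p hp => volume_plane (hP p hp) _

theorem area_lt_top (hK : CoveredByPlanes K) (hb : Bornology.IsBounded K) :
    (μHE[2] : Measure E3) K < ∞ := by
  obtain ⟨P, hP, hc⟩ := hK
  refine (measure_mono (t := ⋃ p ∈ P, K ∩ plane p.1 p.2) (fun y hy => ?_)).trans_lt ?_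
  · obtain ⟨p, hp, hyp⟩ := hc y hy
    exact mem_biUnion hp ⟨hy, hyp⟩
  · exact (measure_biUnion_finset_le _ _).trans_lt
      (ENNReal.sum_lt_top.2 fun p hp => area_inter_plane_lt_top (hP p hp) _ hb)

end CoveredByPlanes

/-- Near `p`, the set `K` is contained in a plane with unit normal `ν`. -/
def IsFlatAt (K : Set E3) (p ν : E3) (r : ℝ) : Prop :=
  ∀ y ∈ Metric.ball p r, y ∈ K → inner ℝ ν (y - p) = 0

/-- Off the null set where two distinct planes of the family cross, all planes through p coincide.
The remaining planes stay at positive distance from p, so K is flat near p. -/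
theorem ae_isFlatAt_of_mem_plane {K : Set E3} {P : Finset (E3 × ℝ)} (hP : ∀ p ∈ P, ‖p.1‖ = 1)
    (hc : ∀ y ∈ K, ∃ p ∈ P, y ∈ plane p.1 p.2) :
    ∀ᵐ p ∂(μHE[2] : Measure E3), ∃ r > 0, ∀ a ∈ P, p ∈ plane a.1 a.2 → IsFlatAt K p a.1 r := by
  classical
  have hnull : (μHE[2] : Measure E3) (⋃ a ∈ P, ⋃ b ∈ P.filter fun b => plane a.1 a.2 ≠ plane b.1 b.2,
      plane a.1 a.2 ∩ plane b.1 b.2) = 0 := by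
    refine (measure_biUnion_null_iff P.countable_toSet).2 fun a ha => ?_
    refine (measure_biUnion_null_iff (Finset.countable_toSet _)).2 fun b hb => ?_
    obtain ⟨hb, hne⟩ := Finset.mem_filter.1 hb
    exact area_plane_inter_plane (hP a ha) (hP b hb) hne
  refine (measure_eq_zero_iff_ae_notMem.1 hnull).mono fun p hp => ?_
  have hopen : IsOpen (⋃ b ∈ P.filter (fun b => p ∉ plane b.1 b.2), plane b.1 b.2)ᶜ :=
    (isClosed_biUnion_finset fun p _ => isClosed_plane _ _).isOpen_compl
  obtain ⟨r, hr, hball⟩ := Metric.isOpen_iff.1 hopen p (by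
    simp only [mem_compl_iff, mem_iUnion, not_exists]
    exact fun b hb hpb => (Finset.mem_filter.1 hb).2 hpb)
  refine ⟨r, hr, fun a ha hpa y hy hyK => ?_⟩
  obtain ⟨b, hb, hyb⟩ := hc y hyK
  have hpb : p ∈ plane b.1 b.2 := by
    by_contra hpb
    exact hball hy (mem_biUnion (Finset.mem_filter.2 ⟨hb, hpb⟩) hyb)
  have hab : plane a.1 a.2 = plane b.1 b.2 := by
    by_contra hne
    exact hp (mem_biUnion ha (mem_biUnion (Finset.mem_filter.2 ⟨hb, hne⟩) ⟨hpa, hpb⟩))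
  rw [← hab] at hyb
  rw [inner_sub_right, show inner ℝ a.1 y = a.2 from hyb, show inner ℝ a.1 p = a.2 from hpa, sub_self]

theorem CoveredByPlanes.ae_isFlatAt {K : Set E3} (hK : CoveredByPlanes K) :
    ∀ᵐ p ∂(μHE[2] : Measure E3), p ∈ K → ∃ ν, ‖ν‖ = 1 ∧ ∃ r > 0, IsFlatAt K p ν r := by
  obtain ⟨P, hP, hc⟩ := hK
  filter_upwards [ae_isFlatAt_of_mem_plane hP hc] with p ⟨r, hr, h⟩ hpK
  obtain ⟨a, ha, hpa⟩ := hc p hpK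
  exact ⟨a.1, hP a ha, r, hr, h a ha hpa⟩

/-! ### Frontiers of polyhedral sets -/

/-- With nonempty interior this is Hahn–Banach separation, extended to C by closure. A degenerate C
spans a proper affine subspace, and a vector orthogonal to it is constant on C. -/
theorem exists_supporting_normal {C : Set E3} (hC : Convex ℝ C) (hcl : IsClosed C) {y : E3}
    (hy : y ∈ frontier C) : ∃ ν : E3, ‖ν‖ = 1 ∧ ∀ x ∈ C, inner ℝ ν x ≤ inner ℝ ν y := by
  suffices ∃ w : E3, w ≠ 0 ∧ ∀ x ∈ C, inner ℝ w x ≤ inner ℝ w y by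
    obtain ⟨w, hw, h⟩ := this
    refine ⟨‖w‖⁻¹ • w, norm_smul_inv_norm hw, fun x hx => ?_⟩
    rw [inner_smul_left, inner_smul_left]
    exact mul_le_mul_of_nonneg_left (h x hx) (by simp)
  have hyC : y ∈ C := hcl.frontier_subset hy
  by_cases hint : (interior C).Nonempty
  · obtain ⟨f, hf⟩ := geometric_hahn_banach_open_point hC.interior isOpen_interior hy.2
    obtain ⟨w, rfl⟩ := (InnerProductSpace.toDual ℝ E3).surjective f
    simp only [InnerProductSpace.toDual_apply_apply] at hf
    refine ⟨w, ?_, fun x hx => ?_⟩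
    · rintro rfl
      obtain ⟨z, hz⟩ := hint
      simpa using hf z hz
    · have hx' : x ∈ closure (interior C) := by
        rw [hC.closure_interior_eq_closure_of_nonempty_interior hint]
        exact subset_closure hx
      exact closure_minimal (t := {x | inner ℝ w x ≤ inner ℝ w y}) (fun z hz => (hf z hz).le)
        (isClosed_le (by fun_prop) continuous_const) hx'
  · have hspan : affineSpan ℝ C ≠ ⊤ := fun h => hint (hC.interior_nonempty_iff_affineSpan_eq_top.2 h)
    have hdir : (affineSpan ℝ C).direction ≠ ⊤ := by
      rwa [Ne, AffineSubspace.direction_eq_top_iff_of_nonempty ⟨y, subset_affineSpan ℝ C hyC⟩]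
    have hbot : (affineSpan ℝ C).directionᗮ ≠ ⊥ := by
      rwa [Ne, Submodule.orthogonal_eq_bot_iff]
    obtain ⟨w, hw, hw0⟩ := Submodule.exists_mem_ne_zero_of_ne_bot hbot
    refine ⟨w, hw0, fun x hx => ?_⟩
    have h1 : x - y ∈ (affineSpan ℝ C).direction :=
      AffineSubspace.vsub_mem_direction (subset_affineSpan ℝ C hx) (subset_affineSpan ℝ C hyC)
    have h2 := Submodule.inner_right_of_mem_orthogonal h1 hw
    rw [real_inner_comm, inner_sub_right] at h2
    linarith

/-- The weighted sum of the nonnegative gaps ν·y - ν·x vanishes, so every vertex off the face has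
weight zero. -/
theorem mem_convexHull_face {S : Finset E3} {ν y : E3} (hy : y ∈ convexHull ℝ (S : Set E3))
    (hν : ∀ x ∈ S, inner ℝ ν x ≤ inner ℝ ν y) :
    y ∈ convexHull ℝ ((S.filter fun x => inner ℝ ν x = inner ℝ ν y : Finset E3) : Set E3) := by
  obtain ⟨w, hw0, hw1, hwy⟩ := Finset.mem_convexHull'.1 hy
  have hsum : ∑ x ∈ S, w x * (inner ℝ ν y - inner ℝ ν x) = 0 := by
    have h1 : inner ℝ ν y = ∑ x ∈ S, w x * inner ℝ ν x := by
      nth_rewrite 1 [← hwy]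
      rw [inner_sum]
      exact Finset.sum_congr rfl fun x _ => inner_smul_right _ _ _
    simp only [mul_sub, Finset.sum_sub_distrib]
    rw [← Finset.sum_mul, hw1, one_mul, ← h1, sub_self]
  have hzero := (Finset.sum_eq_zero_iff_of_nonneg fun x hx =>
    mul_nonneg (hw0 x hx) (sub_nonneg.2 (hν x hx))).1 hsum
  have hw' : ∀ x ∈ S, x ∉ S.filter (fun x => inner ℝ ν x = inner ℝ ν y) → w x = 0 := by
    intro x hx hxf
    refine (mul_eq_zero.1 (hzero x hx)).resolve_right fun h => hxf ?_
    exact Finset.mem_filter.2 ⟨hx, (sub_eq_zero.1 h).symm⟩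
  refine Finset.mem_convexHull'.2 ⟨w, fun x hx => hw0 x (Finset.mem_filter.1 hx).1, ?_, ?_⟩
  · rw [Finset.sum_subset (Finset.filter_subset _ _) hw', hw1]
  · rw [Finset.sum_subset (Finset.filter_subset _ _) fun x hx hxf => by rw [hw' x hx hxf, zero_smul],
      hwy]

theorem isClosed_convexHull_finset (S : Finset E3) : IsClosed (convexHull ℝ (S : Set E3)) :=
  (S.finite_toSet.isCompact_convexHull ℝ).isClosed

/-- A frontier point lies in the hull of those vertices that sit on its supporting plane. There are
finitely many vertex subsets, so one plane per coplanar subset suffices. -/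
theorem coveredByPlanes_frontier_convexHull (S : Finset E3) :
    CoveredByPlanes (frontier (convexHull ℝ (S : Set E3))) := by
  classical
  let good : Finset E3 → Prop := fun T => ∃ p : E3 × ℝ, ‖p.1‖ = 1 ∧ (T : Set E3) ⊆ plane p.1 p.2
  let pick : Finset E3 → E3 × ℝ := fun T => if h : good T then h.choose else (0, 0)
  refine ⟨(S.powerset.filter good).image pick, fun p hp => ?_, fun y hy => ?_⟩
  · obtain ⟨T, hT, rfl⟩ := Finset.mem_image.1 hp
    have hT := (Finset.mem_filter.1 hT).2
    simp only [pick, dif_pos hT]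
    exact hT.choose_spec.1
  · have hcl := isClosed_convexHull_finset S
    obtain ⟨ν, hν, hsup⟩ := exists_supporting_normal (convex_convexHull ℝ _) hcl hy
    set T := S.filter fun x => inner ℝ ν x = inner ℝ ν y with hTdef
    have hyT : y ∈ convexHull ℝ (T : Set E3) := mem_convexHull_face (hcl.frontier_subset hy)
      fun x hx => hsup x (subset_convexHull ℝ _ hx)
    have hT : good T := ⟨(ν, inner ℝ ν y), hν, fun x hx => (Finset.mem_filter.1 hx).2⟩
    refine ⟨pick T, Finset.mem_image_of_mem _ (Finset.mem_filter.2
      ⟨Finset.mem_powerset.2 (Finset.filter_subset _ _), hT⟩), ?_⟩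
    simp only [pick, dif_pos hT]
    -- The plane chosen for T need not be the supporting plane at y, but it contains T and hence the
    -- hull of T.
    refine convexHull_min hT.choose_spec.2 ?_ hyT
    exact convex_hyperplane (f := fun y => inner ℝ hT.choose.1 y)
      ⟨fun a b => inner_add_right _ _ _, fun a b => inner_smul_right _ _ _⟩ _

theorem frontier_biUnion_finset_subset {ι X : Type*} [TopologicalSpace X] (F : Finset ι)
    (A : ι → Set X) : frontier (⋃ i ∈ F, A i) ⊆ ⋃ i ∈ F, frontier (A i) := by
  intro y hy
  have h1 := frontier_subset_closure hy
  rw [Finset.closure_biUnion] at h1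
  obtain ⟨i, hi, hyi⟩ := mem_iUnion₂.1 h1
  refine mem_biUnion hi ⟨hyi, fun hint => hy.2 ?_⟩
  exact interior_mono (subset_biUnion_of_mem (u := A) hi) hint

theorem IsPolytopeUnion.coveredByPlanes_frontier {A : Set E3} (hA : IsPolytopeUnion A) :
    CoveredByPlanes (frontier A) := by
  obtain ⟨F, rfl⟩ := hA
  refine CoveredByPlanes.mono ?_ (frontier_biUnion_finset_subset F _)
  have : (⋃ S ∈ F, frontier (convexHull ℝ (S : Set E3))) =
      ⋃ S : F, frontier (convexHull ℝ ((S : Finset E3) : Set E3)) := by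
    rw [iUnion_subtype]
  rw [this]
  exact .iUnion fun S => coveredByPlanes_frontier_convexHull _

/-- Regularity of A places its frontier inside the frontier of its closure, which is a polytope
union. -/
theorem IsPolyhedralOpen.coveredByPlanes_frontier {A : Set E3} (hA : IsPolyhedralOpen A) :
    CoveredByPlanes (frontier A) := by
  refine hA.2.coveredByPlanes_frontier.mono fun y hy => ⟨?_, ?_⟩
  · rw [closure_closure]; exact hy.1
  · rw [← hA.1]
    rw [hA.1, isOpen_interior.frontier_eq, ← hA.1] at hy
    exact hy.2

theorem exists_finset_convexHull_eq {A : Set E3} (hA : IsPolytopeUnion A) :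
    ∃ S : Finset E3, convexHull ℝ A = convexHull ℝ (S : Set E3) := by
  classical
  obtain ⟨F, rfl⟩ := hA
  refine ⟨F.biUnion id, subset_antisymm ?_ ?_⟩
  · refine convexHull_min (iUnion₂_subset fun S hS => convexHull_mono ?_) (convex_convexHull ℝ _)
    exact fun x hx => Finset.mem_biUnion.2 ⟨S, hS, hx⟩
  · refine convexHull_mono fun x hx => ?_
    obtain ⟨S, hS, hxS⟩ := Finset.mem_biUnion.1 hx
    exact mem_biUnion hS (subset_convexHull ℝ _ hxS)

/-! ### Local half spaces -/

/-- In the ball of radius `r` around `p`, the set `A` is the half space with outer normal `ν`. -/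
def IsHalfAt (A : Set E3) (p ν : E3) (r : ℝ) : Prop :=
  ∀ y ∈ Metric.ball p r, y ∈ A ↔ inner ℝ ν (y - p) < 0

theorem IsFlatAt.mono {K L : Set E3} {p ν : E3} {r : ℝ} (h : IsFlatAt K p ν r) (hLK : L ⊆ K) :
    IsFlatAt L p ν r := fun y hy hyL => h y hy (hLK hyL)

theorem IsFlatAt.neg {K : Set E3} {p ν : E3} {r : ℝ} (h : IsFlatAt K p ν r) :
    IsFlatAt K p (-ν) r := fun y hy hyK => by rw [inner_neg_left, h y hy hyK, neg_zero]

/-- Points of an open set can be pushed off a plane to either side. -/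
theorem exists_mem_inner_lt {U : Set E3} (hU : IsOpen U) {ν : E3} (hν : ‖ν‖ = 1) {p y : E3}
    (hy : y ∈ U) : ∃ z ∈ U, inner ℝ ν (z - p) < inner ℝ ν (y - p) := by
  obtain ⟨ε, hε, hball⟩ := Metric.isOpen_iff.1 hU y hy
  refine ⟨y - (ε / 2) • ν, hball ?_, ?_⟩
  · rw [mem_ball_iff_norm, sub_sub_cancel_left, norm_neg, norm_smul, hν, mul_one, Real.norm_eq_abs,
      abs_of_pos (by positivity)]
    linarith
  · rw [sub_right_comm, inner_sub_right _ (y - p), inner_smul_right, real_inner_self_eq_norm_sq, hν]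
    linarith

theorem convex_halfBall (p ν : E3) (r : ℝ) :
    Convex ℝ (Metric.ball p r ∩ {y | inner ℝ ν (y - p) < 0}) := by
  refine (convex_ball p r).inter ?_
  have : {y | inner ℝ ν (y - p) < 0} = {y | inner ℝ ν y < inner ℝ ν p} := by
    ext y; simp [inner_sub_right]
  rw [this]
  exact convex_halfSpace_lt (f := fun y => inner ℝ ν y)
    ⟨fun a b => inner_add_right _ _ _, fun a b => inner_smul_right _ _ _⟩ _

theorem isOpen_halfBall (p ν : E3) (r : ℝ) :
    IsOpen (Metric.ball p r ∩ {y | inner ℝ ν (y - p) < 0}) :=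
  Metric.isOpen_ball.inter (isOpen_lt (by fun_prop) continuous_const)

theorem subset_or_disjoint_of_disjoint_frontier {X : Type*} [TopologicalSpace X] {s A : Set X}
    (hs : IsPreconnected s) (h : Disjoint s (frontier A)) : s ⊆ interior A ∨ Disjoint s A := by
  have hsub : s ⊆ interior A ∪ (closure A)ᶜ := fun y hy => by
    by_cases hyA : y ∈ closure A
    · exact Or.inl (by_contra fun hi => h.le_bot ⟨hy, hyA, hi⟩)
    · exact Or.inr hyA
  have hdisj : Disjoint (interior A) (closure A)ᶜ :=
    disjoint_compl_right_iff_subset.2 (interior_subset.trans subset_closure)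
  refine (hs.subset_or_subset isOpen_interior isClosed_closure.isOpen_compl hdisj hsub).imp_right
    fun h' => ?_
  exact disjoint_left.2 fun y hy hyA => h' hy (subset_closure hyA)

theorem mem_closure_halfBall {p ν y : E3} {r : ℝ} (hν : ‖ν‖ = 1) (hy : y ∈ Metric.ball p r)
    (h : inner ℝ ν (y - p) ≤ 0) :
    y ∈ closure (Metric.ball p r ∩ {y | inner ℝ ν (y - p) < 0}) := by
  rw [mem_closure_iff]
  intro U hU hyU
  obtain ⟨z, hz, hlt⟩ := exists_mem_inner_lt (hU.inter Metric.isOpen_ball) hν (p := p) ⟨hyU, hy⟩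
  exact ⟨z, hz.1, hz.2, hlt.trans_le h⟩

/-- Each open half ball is connected and misses the frontier, so it lies inside A or outside A. Both
inside would put p in `interior (closure A)`, which is A; this is where slits are excluded. Both
outside would confine the open set A to a plane near p. -/
theorem IsFlatAt.isHalfAt_or {A : Set E3} (hA : A = interior (closure A)) {p ν : E3} {r : ℝ}
    (hν : ‖ν‖ = 1) (hr : 0 < r) (hp : p ∈ frontier A) (h : IsFlatAt (frontier A) p ν r) :
    IsHalfAt A p ν r ∨ IsHalfAt A p (-ν) r := by
  have hAo : IsOpen A := hA ▸ isOpen_interior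
  have key {ν : E3} (h : IsFlatAt (frontier A) p ν r) :
      Metric.ball p r ∩ {y | inner ℝ ν (y - p) < 0} ⊆ A ∨
        Disjoint (Metric.ball p r ∩ {y | inner ℝ ν (y - p) < 0}) A := by
    rw [← hAo.interior_eq]
    nth_rewrite 2 [hAo.interior_eq]
    refine subset_or_disjoint_of_disjoint_frontier (convex_halfBall p ν r).isPreconnected ?_
    exact disjoint_left.2 fun y hy hyA => hy.2.ne (h y hy.1 hyA)
  have hν' : ‖-ν‖ = 1 := by rwa [norm_neg]
  -- a half ball inside `A` opposite to a half ball outside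
  have one {ν : E3} (hν : ‖ν‖ = 1) (h1 : Metric.ball p r ∩ {y | inner ℝ ν (y - p) < 0} ⊆ A)
      (h2 : Disjoint (Metric.ball p r ∩ {y | inner ℝ (-ν) (y - p) < 0}) A) : IsHalfAt A p ν r := by
    intro y hy
    refine ⟨fun hyA => ?_, fun hlt => h1 ⟨hy, hlt⟩⟩
    by_contra! hge
    obtain ⟨z, hz, hlt⟩ := exists_mem_inner_lt (hAo.inter Metric.isOpen_ball)
      (show ‖-ν‖ = 1 by rwa [norm_neg]) (p := p) ⟨hyA, hy⟩
    refine h2.le_bot ⟨⟨hz.2, hlt.trans_le ?_⟩, hz.1⟩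
    rw [inner_neg_left]; linarith
  rcases key h with h1 | h1 <;> rcases key h.neg with h2 | h2
  · exfalso
    have hball : Metric.ball p r ⊆ closure A := by
      intro y hy
      rcases le_total (inner ℝ ν (y - p)) 0 with hle | hle
      · exact closure_mono h1 (mem_closure_halfBall hν hy hle)
      · exact closure_mono h2 (mem_closure_halfBall hν' hy (by rw [inner_neg_left]; linarith))
    have : p ∈ A := by
      rw [hA]
      exact mem_interior.2 ⟨_, hball, Metric.isOpen_ball, Metric.mem_ball_self hr⟩
    rw [hAo.frontier_eq] at hp
    exact hp.2 this
  · exact Or.inl (one hν h1 h2)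
  · exact Or.inr (one hν' h2 (by rwa [neg_neg]))
  · exfalso
    obtain ⟨y, hy, hyA⟩ := mem_closure_iff.1 hp.1 _ Metric.isOpen_ball (Metric.mem_ball_self hr)
    have hO := hAo.inter (Metric.isOpen_ball (x := p) (ε := r))
    rcases le_total (inner ℝ ν (y - p)) 0 with hle | hle
    · obtain ⟨z, hz, hlt⟩ := exists_mem_inner_lt hO hν (p := p) ⟨hyA, hy⟩
      exact h1.le_bot ⟨⟨hz.2, hlt.trans_le hle⟩, hz.1⟩
    · obtain ⟨z, hz, hlt⟩ := exists_mem_inner_lt hO hν' (p := p) ⟨hyA, hy⟩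
      exact h2.le_bot ⟨⟨hz.2, hlt.trans_le (by rw [inner_neg_left]; linarith)⟩, hz.1⟩

theorem IsHalfAt.mem_closure {A : Set E3} {p ν y : E3} {r : ℝ} (h : IsHalfAt A p ν r)
    (hν : ‖ν‖ = 1) (hy : y ∈ Metric.ball p r) (hle : inner ℝ ν (y - p) ≤ 0) : y ∈ closure A :=
  closure_mono (fun _ hz => (h _ hz.1).2 hz.2) (mem_closure_halfBall hν hy hle)

theorem IsHalfAt.inner_le {A : Set E3} {p ν y : E3} {r : ℝ} (h : IsHalfAt A p ν r)
    (hy : y ∈ Metric.ball p r) (hyA : y ∈ closure A) : inner ℝ ν (y - p) ≤ 0 := by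
  by_contra! hlt
  have hO : IsOpen (Metric.ball p r ∩ {z | 0 < inner ℝ ν (z - p)}) :=
    Metric.isOpen_ball.inter (isOpen_lt continuous_const (by fun_prop))
  obtain ⟨z, hz, hzA⟩ := mem_closure_iff.1 hyA _ hO ⟨hy, hlt⟩
  exact lt_asymm ((h z hz.1).1 hzA) hz.2

theorem IsHalfAt.exists_mem_ball {A : Set E3} {p ν : E3} {r : ℝ} (h : IsHalfAt A p ν r)
    (hν : ‖ν‖ = 1) (hr : 0 < r) : ∃ y ∈ Metric.ball p r, y ∈ A := by
  obtain ⟨z, hz, hlt⟩ := exists_mem_inner_lt (Metric.isOpen_ball (x := p) (ε := r)) hν (p := p)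
    (Metric.mem_ball_self hr)
  exact ⟨z, hz, (h z hz).2 (by simpa using hlt)⟩

theorem not_isHalfAt_of_disjoint {A B : Set E3} (hAB : Disjoint A B) {p ν : E3} {r : ℝ}
    (hν : ‖ν‖ = 1) (hr : 0 < r) (hA : IsHalfAt A p ν r) : ¬ IsHalfAt B p ν r := fun hB => by
  obtain ⟨y, hy, hyA⟩ := hA.exists_mem_ball hν hr
  exact disjoint_left.1 hAB hyA ((hB y hy).2 ((hA y hy).1 hyA))

theorem IsHalfAt.ball_subset {A B : Set E3} {p ν : E3} {r : ℝ} (hν : ‖ν‖ = 1)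
    (hA : IsHalfAt A p ν r) (hB : IsHalfAt B p (-ν) r) :
    Metric.ball p r ⊆ closure A ∪ closure B := fun y hy => by
  rcases le_total (inner ℝ ν (y - p)) 0 with hle | hle
  · exact Or.inl (hA.mem_closure hν hy hle)
  · exact Or.inr (hB.mem_closure (by rwa [norm_neg]) hy (by rw [inner_neg_left]; linarith))

/-- Two disjoint regular open sets fill a neighbourhood of a common flat boundary point. -/
theorem ball_subset_of_isFlatAt {A B : Set E3} (hA : A = interior (closure A))
    (hB : B = interior (closure B)) (hAB : Disjoint A B) {p ν : E3} {r : ℝ} (hν : ‖ν‖ = 1)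
    (hr : 0 < r) (hpA : p ∈ frontier A) (hpB : p ∈ frontier B)
    (hfA : IsFlatAt (frontier A) p ν r) (hfB : IsFlatAt (frontier B) p ν r) :
    Metric.ball p r ⊆ closure A ∪ closure B := by
  have hν' : ‖-ν‖ = 1 := by rwa [norm_neg]
  rcases hfA.isHalfAt_or hA hν hr hpA with h1 | h1 <;>
    rcases hfB.isHalfAt_or hB hν hr hpB with h2 | h2
  · exact absurd h2 (not_isHalfAt_of_disjoint hAB hν hr h1)
  · exact h1.ball_subset hν h2
  · exact h1.ball_subset hν' (by rwa [neg_neg])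
  · exact absurd h2 (not_isHalfAt_of_disjoint hAB hν' hr h1)

/-! ### Outer normals -/

section OuterNormal

variable {A : Set E3} {x n n' : E3}

theorem HasOuterNormal.mem_frontier (h : HasOuterNormal A x n) : x ∈ frontier A := by
  obtain ⟨hn, r, hr, hA⟩ := h
  have hA : IsHalfAt A x n r := hA
  refine ⟨hA.mem_closure hn (Metric.mem_ball_self hr) (by simp), fun hx => ?_⟩
  simpa using (hA x (Metric.mem_ball_self hr)).1 (interior_subset hx)

theorem HasOuterNormal.eventually_mem_iff (h : HasOuterNormal A x n) (w : E3) :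
    ∃ δ > (0 : ℝ), ∀ t : ℝ, 0 < t → t < δ → (x + t • w ∈ A ↔ inner ℝ n w < 0) := by
  obtain ⟨hn, r, hr, hA⟩ := h
  refine ⟨r / (‖w‖ + 1), by positivity, fun t ht htδ => ?_⟩
  rw [hA _ (by
    rw [mem_ball_iff_norm, add_sub_cancel_left, norm_smul, Real.norm_eq_abs, abs_of_pos ht]
    rw [lt_div_iff₀ (by positivity)] at htδ
    nlinarith), add_sub_cancel_left, inner_smul_right]
  constructor
  · intro h; by_contra! h'; nlinarith [mul_nonneg ht.le h']
  · intro h; exact mul_neg_of_pos_of_neg ht h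

/-- The inward directions determine an open half space, and the half space determines its unit
normal. -/
theorem HasOuterNormal.unique (h : HasOuterNormal A x n) (h' : HasOuterNormal A x n') :
    n = n' := by
  have key (w : E3) : inner ℝ n w < 0 ↔ inner ℝ n' w < 0 := by
    obtain ⟨δ, hδ, h1⟩ := h.eventually_mem_iff w
    obtain ⟨δ', hδ', h2⟩ := h'.eventually_mem_iff w
    have hm : 0 < min δ δ' := lt_min hδ hδ'
    rw [← h1 (min δ δ' / 2) (by linarith) (by linarith [min_le_left δ δ']),
      h2 (min δ δ' / 2) (by linarith) (by linarith [min_le_right δ δ'])]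
  have hn : inner ℝ n n = 1 := by rw [real_inner_self_eq_norm_sq, h.1]; norm_num
  have hn' : inner ℝ n' n' = 1 := by rw [real_inner_self_eq_norm_sq, h'.1]; norm_num
  set k : ℝ := inner ℝ n n' with hk
  have hk' : inner ℝ n' n = k := real_inner_comm _ _
  have h1 : 0 < k := by
    have := (key (-n')).2 (by rw [inner_neg_right, hn']; norm_num)
    rw [inner_neg_right] at this
    linarith
  have h2 : 1 ≤ k * k := by
    -- This test vector is orthogonal to n, so it is not an inward direction for n' either; that
    -- says k² ≥ 1. With 0 < k ≤ 1 the two unit vectors agree.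
    have := (key (k • n - n')).not.1 (by
      rw [inner_sub_right, inner_smul_right, hn]; simp [← hk])
    rw [inner_sub_right, inner_smul_right, hk', hn'] at this
    linarith
  have h3 : k ≤ 1 := by
    have := real_inner_le_norm n n'
    rwa [h.1, h'.1, mul_one] at this
  exact (inner_eq_one_iff_of_norm_eq_one (𝕜 := ℝ) h.1 h'.1).1 (by nlinarith)

theorem HasOuterNormal.outerNormal_eq (h : HasOuterNormal A x n) : outerNormal A x = n := by
  have hex : ∃ n, HasOuterNormal A x n := ⟨n, h⟩
  rw [outerNormal, dif_pos hex]
  exact hex.choose_spec.unique h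

theorem outerNormal_eq_zero (h : ¬ ∃ n, HasOuterNormal A x n) : outerNormal A x = 0 := dif_neg h

theorem HasOuterNormal.eventually_hasOuterNormal (h : HasOuterNormal A x n) :
    ∃ r > 0, ∀ y ∈ Metric.ball x r, y ∈ frontier A → HasOuterNormal A y n := by
  obtain ⟨hn, r, hr, hA⟩ := h
  have hA : IsHalfAt A x n r := hA
  refine ⟨r, hr, fun y hy hyA => ⟨hn, r - dist y x, sub_pos.2 hy, fun z hz => ?_⟩⟩
  have hle := hA.inner_le hy hyA.1
  have hge : 0 ≤ inner ℝ n (y - x) := by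
    by_contra! hlt
    refine hyA.2 (mem_interior.2 ⟨_, fun z hz => (hA z hz.1).2 hz.2, isOpen_halfBall x n r, hy, hlt⟩)
  have h0 : inner ℝ n (y - x) = 0 := le_antisymm hle hge
  rw [hA z (by
    rw [Metric.mem_ball] at hz ⊢
    linarith [dist_triangle z y x])]
  rw [show z - x = (z - y) + (y - x) by abel, inner_add_right, h0, add_zero]

/-- Where the normal exists it is locally constant along the frontier, and the set of such points is
the frontier intersected with an open set. Elsewhere the field is zero. -/
theorem measurable_outerNormal (A : Set E3) : Measurable (outerNormal A) := by
  set s : Set E3 := {x | ∃ n, HasOuterNormal A x n} with hs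
  have hloc (x : E3) (hx : x ∈ s) : ∃ r > 0, ∀ y ∈ Metric.ball x r, y ∈ frontier A →
      HasOuterNormal A y (outerNormal A x) := by
    obtain ⟨n, hn⟩ := hx
    rw [hn.outerNormal_eq]
    exact hn.eventually_hasOuterNormal
  choose! r hr hball using hloc
  have hsm : MeasurableSet s := by
    have : s = frontier A ∩ ⋃ x ∈ s, Metric.ball x (r x) := by
      ext y
      constructor
      · intro hy
        obtain ⟨n, hn⟩ := hy
        exact ⟨hn.mem_frontier, mem_biUnion (show y ∈ s from ⟨n, hn⟩)
          (Metric.mem_ball_self (hr y ⟨n, hn⟩))⟩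
      · rintro ⟨hy, hyU⟩
        obtain ⟨x, hx, hyx⟩ := mem_iUnion₂.1 hyU
        exact ⟨_, hball x hx y hyx hy⟩
    rw [this]
    exact isClosed_frontier.measurableSet.inter
      (isOpen_biUnion fun _ _ => Metric.isOpen_ball).measurableSet
  refine measurable_of_restrict_of_restrict_compl hsm ?_ ?_
  · have hlc : IsLocallyConstant (s.domRestrict (outerNormal A)) := by
      rw [IsLocallyConstant.iff_eventually_eq]
      intro x
      have : Subtype.val ⁻¹' (Metric.ball x.1 (r x.1)) ∈ nhds x :=
        continuous_subtype_val.continuousAt (Metric.ball_mem_nhds _ (hr x.1 x.2))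
      filter_upwards [this] with y hy
      obtain ⟨m, hm⟩ := y.2
      exact (hball x.1 x.2 y.1 hy hm.mem_frontier).outerNormal_eq
    exact hlc.continuous.measurable
  · have : sᶜ.domRestrict (outerNormal A) = fun _ => 0 := by
      ext1 x
      exact outerNormal_eq_zero x.2
    rw [this]
    exact measurable_const

end OuterNormal

/-! ### The radiation kernel -/

section Kernel

variable {R : Set E3}

theorem openSegment_subset_iff {x y : E3} :
    openSegment ℝ x y ⊆ R ↔ ∀ t ∈ Ioo (0 : ℝ) 1, x + t • (y - x) ∈ R := by
  rw [openSegment_eq_image']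
  exact image_subset_iff

/-- The open segment is exhausted by compact subsegments. That a given compact subsegment stays in
the open set R is an open condition on its end points, by compactness, so visibility is a countable
intersection of open conditions. -/
theorem measurableSet_visible (hR : IsOpen R) :
    MeasurableSet {p : E3 × E3 | openSegment ℝ p.1 p.2 ⊆ R} := by
  have : {p : E3 × E3 | openSegment ℝ p.1 p.2 ⊆ R} =
      ⋂ n : ℕ, {p : E3 × E3 | ∀ t ∈ Icc (1 / ((n : ℝ) + 1)) (1 - 1 / ((n : ℝ) + 1)),
        p.1 + t • (p.2 - p.1) ∈ R} := by
    ext p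
    simp only [mem_ofPred_eq, mem_iInter, openSegment_subset_iff]
    constructor
    · intro h n t ht
      have hn : (0 : ℝ) < 1 / ((n : ℝ) + 1) := by positivity
      exact h t ⟨hn.trans_le ht.1, by linarith [ht.2]⟩
    · intro h t ht
      obtain ⟨n, hn⟩ := exists_nat_one_div_lt (lt_min ht.1 (sub_pos.2 ht.2))
      exact h n t ⟨(hn.trans_le (min_le_left _ _)).le,
        by linarith [hn.trans_le (min_le_right t (1 - t))]⟩
  rw [this]
  refine MeasurableSet.iInter fun n => IsOpen.measurableSet ?_
  rw [isOpen_iff_mem_nhds]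
  intro p hp
  refine isCompact_Icc.eventually_forall_of_forall_eventually
    (P := fun (p : E3 × E3) (t : ℝ) => p.1 + t • (p.2 - p.1) ∈ R) fun t ht => ?_
  have hc : Continuous fun z : (E3 × E3) × ℝ => z.1.1 + z.2 • (z.1.2 - z.1.1) := by fun_prop
  exact hc.continuousAt.eventually (hR.mem_nhds (hp t ht))

/-- The radiation kernel of the open set `R` with inner normals. -/
noncomputable def kernel (R : Set E3) (x y : E3) : ℝ :=
  visibility R x y * viewFactor (fun z => -outerNormal R z) x y

theorem measurable_kernel (hR : IsOpen R) : Measurable fun p : E3 × E3 => kernel R p.1 p.2 := by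
  have h1 : Measurable fun p : E3 × E3 => visibility R p.1 p.2 :=
    Measurable.ite (measurableSet_visible hR) measurable_const measurable_const
  have h2 : Measurable fun p : E3 × E3 => outerNormal R p.1 :=
    (measurable_outerNormal R).comp measurable_fst
  have h3 : Measurable fun p : E3 × E3 => outerNormal R p.2 :=
    (measurable_outerNormal R).comp measurable_snd
  unfold kernel viewFactor
  fun_prop

/-- A segment that starts into R has an inward direction. At points without a normal the default
value zero makes the claim trivial. -/
theorem inner_neg_outerNormal_nonneg {x w : E3} (h : ∀ t ∈ Ioo (0 : ℝ) 1, x + t • w ∈ R) :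
    0 ≤ inner ℝ (-outerNormal R x) w := by
  by_cases hx : ∃ n, HasOuterNormal R x n
  · obtain ⟨n, hn⟩ := hx
    rw [hn.outerNormal_eq]
    obtain ⟨δ, hδ, hiff⟩ := hn.eventually_mem_iff w
    have hm : 0 < min δ 1 := lt_min hδ one_pos
    have := (hiff (min δ 1 / 2) (by linarith) (by linarith [min_le_left δ 1])).1
      (h _ ⟨by linarith, by linarith [min_le_right δ 1]⟩)
    rw [inner_neg_left]
    linarith
  · rw [outerNormal_eq_zero hx]; simp

theorem kernel_nonneg (R : Set E3) (x y : E3) : 0 ≤ kernel R x y := by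
  unfold kernel visibility
  split_ifs with h
  swap
  · simp
  rw [openSegment_subset_iff] at h
  have h1 : 0 ≤ inner ℝ (-outerNormal R x) (y - x) := inner_neg_outerNormal_nonneg h
  have h2 : 0 ≤ inner ℝ (-outerNormal R y) (x - y) := inner_neg_outerNormal_nonneg fun t ht => by
    convert h (1 - t) ⟨by linarith [ht.2], by linarith [ht.1]⟩ using 1
    module
  rw [one_mul, viewFactor]
  positivity

end Kernel

/-! ### Integration over cones -/

theorem lintegral_eq_mul_lintegral_smul {V : Type*} [NormedAddCommGroup V] [InnerProductSpace ℝ V]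
    [FiniteDimensional ℝ V] [MeasurableSpace V] [BorelSpace V] {F : V → ℝ≥0∞} (hF : Measurable F)
    {a : ℝ} (ha : 0 < a) :
    ∫⁻ s, F s = ENNReal.ofReal (a ^ Module.finrank ℝ V) * ∫⁻ s, F (a • s) := by
  rw [← lintegral_map (μ := volume) hF (measurable_const_smul a), Measure.map_addHaar_smul _ ha.ne',
    lintegral_smul_measure, smul_eq_mul, ← mul_assoc, ← ENNReal.ofReal_mul (by positivity),
    abs_of_pos (by positivity), mul_inv_cancel₀ (by positivity), ENNReal.ofReal_one, one_mul]

section Cone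

variable {ν : E3} (hν : ‖ν‖ = 1) {φ : E2 →ₗᵢ[ℝ] E3} (hφ : ∀ y, y ∈ range φ ↔ inner ℝ ν y = 0)

include hν hφ

theorem lintegral_frame (x : E3) {G : E3 → ℝ≥0∞} (hG : Measurable G) :
    ∫⁻ z, G z = ∫⁻ r : ℝ, ∫⁻ s : E2, G (x + (φ s + r • ν)) := by
  have hG' : Measurable fun z => G (x + z) := by fun_prop
  rw [← lintegral_add_left_eq_self G x, ← (measurePreserving_frame hν hφ).lintegral_comp hG',
    Measure.volume_eq_prod, lintegral_prod_symm' _ (by fun_prop)]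

theorem lintegral_plane_frame (x : E3) (d : ℝ) {F : E3 → ℝ≥0∞} (hF : Measurable F) :
    ∫⁻ y in plane ν (inner ℝ ν x + d), F y ∂(μHE[2] : Measure E3) =
      ∫⁻ s : E2, F (x + (φ s + d • ν)) := by
  -- The coordinates of the tangential part of x; translating by them moves the origin of the chart
  -- below x.
  obtain ⟨s₀, hs₀⟩ := (hφ (x - (inner ℝ ν x : ℝ) • ν)).2 (by
    rw [inner_sub_right, inner_smul_right, real_inner_self_eq_norm_sq, hν]; ring)
  rw [← map_frame hν hφ, lintegral_map hF (by fun_prop),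
    ← lintegral_add_left_eq_self (fun s => F (φ s + (inner ℝ ν x + d) • ν)) s₀]
  congr with s
  rw [map_add, hs₀]
  congr 1
  module

end Cone

/-- Integration over the cone with apex `x` over a subset `A` of a plane. -/
theorem setLIntegral_cone {ν : E3} (hν : ‖ν‖ = 1) (x : E3) {d : ℝ} (hd : 0 < d) {A : Set E3}
    (hA : MeasurableSet A) (hAp : A ⊆ plane ν (inner ℝ ν x + d)) {G : E3 → ℝ≥0∞}
    (hG : Measurable G) :
    MeasurableSet {z | ∃ t > (0 : ℝ), x + t • (z - x) ∈ A} ∧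
    ∫⁻ z in {z | ∃ t > (0 : ℝ), x + t • (z - x) ∈ A}, G z =
      ∫⁻ y in A, (∫⁻ t in Ioi (0 : ℝ), ENNReal.ofReal (t ^ 2 * d) * G (x + t • (y - x)))
        ∂(μHE[2] : Measure E3) := by
  obtain ⟨φ, hφ⟩ := exists_frame hν
  have hdne := hd.ne'
  -- The ray through z can meet the plane only at the parameter d / ν·(z - x), so membership in the
  -- cone is a measurable condition.
  have hset : {z | ∃ t > (0 : ℝ), x + t • (z - x) ∈ A} =
      {z | 0 < inner ℝ ν (z - x)} ∩ (fun z => x + (d / inner ℝ ν (z - x)) • (z - x)) ⁻¹' A := by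
    ext z
    constructor
    · rintro ⟨t, ht, hz⟩
      have h1 := hAp hz
      rw [plane, mem_ofPred_eq, inner_add_right, inner_smul_right] at h1
      have h2 : t * inner ℝ ν (z - x) = d := by linarith
      have h3 : 0 < inner ℝ ν (z - x) := by
        by_contra! h; nlinarith [mul_nonpos_of_nonneg_of_nonpos ht.le h]
      refine ⟨h3, ?_⟩
      rwa [mem_preimage, ← h2, mul_div_cancel_right₀ _ h3.ne']
    · rintro ⟨h3, hz⟩
      exact ⟨_, div_pos hd h3, hz⟩
  have hCm : MeasurableSet {z | ∃ t > (0 : ℝ), x + t • (z - x) ∈ A} := by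
    rw [hset]
    refine (isOpen_lt continuous_const (by fun_prop)).measurableSet.inter (hA.preimage ?_)
    fun_prop
  refine ⟨hCm, ?_⟩
  have hGA : Measurable (A.indicator (fun _ => (1 : ℝ≥0∞))) := measurable_const.indicator hA
  -- the integrand in the coordinates `(r, s)`
  have hind (r : ℝ) (s : E2) : {z | ∃ t > (0 : ℝ), x + t • (z - x) ∈ A}.indicator G
      (x + (φ s + r • ν)) = (Ioi (0 : ℝ)).indicator (fun r =>
        A.indicator (fun _ => (1 : ℝ≥0∞)) (x + (d / r) • (φ s + r • ν)) * G (x + (φ s + r • ν))) r := by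
    have hin : inner ℝ ν (x + (φ s + r • ν) - x) = r := by
      rw [add_sub_cancel_left]; exact inner_frame_add hν hφ s r
    rw [hset]
    by_cases hr : 0 < r
    · rw [indicator_of_mem (show r ∈ Ioi (0 : ℝ) from hr)]
      by_cases hz : x + (d / r) • (φ s + r • ν) ∈ A
      · rw [indicator_of_mem, indicator_of_mem hz, one_mul]
        refine ⟨by rwa [mem_ofPred_eq, hin], ?_⟩
        rwa [mem_preimage, hin, add_sub_cancel_left]
      · rw [indicator_of_notMem, indicator_of_notMem hz, zero_mul]
        rintro ⟨-, h⟩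
        rw [mem_preimage, hin, add_sub_cancel_left] at h
        exact hz h
    · rw [indicator_of_notMem (show r ∉ Ioi (0 : ℝ) from hr), indicator_of_notMem]
      rintro ⟨h, -⟩
      rw [mem_ofPred_eq, hin] at h
      exact hr h
  have hmeas1 : Measurable fun p : ℝ × E2 => A.indicator (fun _ => (1 : ℝ≥0∞))
      (x + (d / p.1) • (φ p.2 + p.1 • ν)) * G (x + (φ p.2 + p.1 • ν)) := by
    fun_prop
  have hinner : Measurable fun r : ℝ => (Ioi (0 : ℝ)).indicator (fun r => ∫⁻ s : E2,
      A.indicator (fun _ => (1 : ℝ≥0∞)) (x + (d / r) • (φ s + r • ν)) * G (x + (φ s + r • ν))) r :=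
    (hmeas1.lintegral_prod_right' (ν := (volume : Measure E2))).indicator measurableSet_Ioi
  have hmeas2 : Measurable fun p : ℝ × E2 => ENNReal.ofReal (p.1 ^ 2 * d) *
      (A.indicator (fun _ => (1 : ℝ≥0∞)) (x + (φ p.2 + d • ν)) * G (x + p.1 • (φ p.2 + d • ν))) := by
    fun_prop
  calc ∫⁻ z in {z | ∃ t > (0 : ℝ), x + t • (z - x) ∈ A}, G z
      = ∫⁻ r : ℝ, (Ioi (0 : ℝ)).indicator (fun r => ∫⁻ s : E2,
          A.indicator (fun _ => (1 : ℝ≥0∞)) (x + (d / r) • (φ s + r • ν)) * G (x + (φ s + r • ν))) r := by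
        rw [← lintegral_indicator hCm, lintegral_frame hν hφ x (hG.indicator hCm)]
        refine lintegral_congr fun r => ?_
        simp_rw [hind]
        by_cases hr : r ∈ Ioi (0 : ℝ)
        · simp_rw [indicator_of_mem hr]
        · simp_rw [indicator_of_notMem hr, lintegral_zero]
    -- Substituting r = d t and then rescaling each planar slice by t produces the Jacobian t² d,
    -- and the cone is parametrised by its base points and the ray parameter t.
    _ = ENNReal.ofReal d * ∫⁻ t : ℝ, (Ioi (0 : ℝ)).indicator (fun r => ∫⁻ s : E2,
          A.indicator (fun _ => (1 : ℝ≥0∞)) (x + (d / r) • (φ s + r • ν)) *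
            G (x + (φ s + r • ν))) (d • t) := by
        rw [lintegral_eq_mul_lintegral_smul hinner hd]
        simp
    _ = ENNReal.ofReal d * ∫⁻ t in Ioi (0 : ℝ), ENNReal.ofReal (t ^ 2) * ∫⁻ s : E2,
          A.indicator (fun _ => (1 : ℝ≥0∞)) (x + (φ s + d • ν)) * G (x + t • (φ s + d • ν)) := by
        congr 1
        rw [← lintegral_indicator measurableSet_Ioi]
        refine lintegral_congr fun t => ?_
        by_cases ht : 0 < t
        · have hdt : d • t ∈ Ioi (0 : ℝ) := mul_pos hd ht
          have hm1 : Measurable fun s : E2 => A.indicator (fun _ => (1 : ℝ≥0∞))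
              (x + (d / (d • t)) • (φ s + (d • t) • ν)) * G (x + (φ s + (d • t) • ν)) := by
            fun_prop
          rw [indicator_of_mem hdt, indicator_of_mem (show t ∈ Ioi (0 : ℝ) from ht),
            lintegral_eq_mul_lintegral_smul hm1 ht,
            finrank_euclideanSpace_fin]
          congr 1
          refine lintegral_congr fun s => ?_
          have e1 : φ (t • s) + (d • t) • ν = t • (φ s + d • ν) := by
            rw [map_smul, smul_eq_mul]; module
          have e2 : (d / (d • t)) • t • (φ s + d • ν) = φ s + d • ν := by
            rw [smul_smul, smul_eq_mul, show d / (d * t) * t = 1 by field_simp, one_smul]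
          rw [e1, e2]
        · have hdt : d • t ∉ Ioi (0 : ℝ) := fun h => ht (pos_of_mul_pos_right h hd.le)
          rw [indicator_of_notMem hdt, indicator_of_notMem (show t ∉ Ioi (0 : ℝ) from ht)]
    _ = ∫⁻ t in Ioi (0 : ℝ), ∫⁻ s : E2, ENNReal.ofReal (t ^ 2 * d) *
          (A.indicator (fun _ => (1 : ℝ≥0∞)) (x + (φ s + d • ν)) * G (x + t • (φ s + d • ν))) := by
        rw [← lintegral_const_mul' _ _ ENNReal.ofReal_ne_top]
        refine lintegral_congr fun t => ?_
        rw [lintegral_const_mul' _ _ ENNReal.ofReal_ne_top, ← mul_assoc, mul_comm (t ^ 2) d,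
          ENNReal.ofReal_mul hd.le]
    _ = ∫⁻ s : E2, ∫⁻ t in Ioi (0 : ℝ), ENNReal.ofReal (t ^ 2 * d) *
          (A.indicator (fun _ => (1 : ℝ≥0∞)) (x + (φ s + d • ν)) * G (x + t • (φ s + d • ν))) :=
        lintegral_lintegral_swap hmeas2.aemeasurable
    _ = ∫⁻ s : E2, A.indicator (fun y => ∫⁻ t in Ioi (0 : ℝ),
          ENNReal.ofReal (t ^ 2 * d) * G (x + t • (y - x))) (x + (φ s + d • ν)) := by
        refine lintegral_congr fun s => ?_
        by_cases hs : x + (φ s + d • ν) ∈ A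
        · simp [indicator_of_mem hs]
        · simp [indicator_of_notMem hs]
    _ = _ := by
        have hm : Measurable fun y : E3 => ∫⁻ t in Ioi (0 : ℝ),
            ENNReal.ofReal (t ^ 2 * d) * G (x + t • (y - x)) :=
          Measurable.lintegral_prod_right' (f := fun p : E3 × ℝ =>
            ENNReal.ofReal (p.2 ^ 2 * d) * G (x + p.2 • (p.1 - x))) (by fun_prop)
        rw [← lintegral_plane_frame hν hφ x d (hm.indicator hA), setLIntegral_indicator hA,
          inter_eq_left.2 hAp]

/-! ### The view factors of an enclosure sum up to one -/

theorem lintegral_Ioi_pow_mul_exp {q : ℕ} {b : ℝ} (hb : 0 < b) :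
    ∫⁻ t in Ioi (0 : ℝ), ENNReal.ofReal (t ^ q * Real.exp (-(b * t ^ 2))) =
      ENNReal.ofReal (b ^ (-((q : ℝ) + 1) / 2) * (1 / 2) * Real.Gamma (((q : ℝ) + 1) / 2)) := by
  have hq : (-1 : ℝ) < q := by have : (0 : ℝ) ≤ q := by positivity
                               linarith
  have hI := integrableOn_rpow_mul_exp_neg_mul_rpow (p := 2) (s := (q : ℝ)) hq two_pos hb
  rw [← integral_rpow_mul_exp_neg_mul_rpow two_pos hq hb,
    ofReal_integral_eq_lintegral_ofReal hI]
  · refine setLIntegral_congr_fun measurableSet_Ioi fun t _ => ?_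
    simp only [Real.rpow_natCast, Real.rpow_two, neg_mul]
  · filter_upwards [self_mem_ae_restrict measurableSet_Ioi] with t ht
    have : (0 : ℝ) < t := ht
    positivity

theorem lintegral_exp_neg_norm_sq_E2 :
    ∫⁻ s : E2, ENNReal.ofReal (Real.exp (-‖s‖ ^ 2)) = ENNReal.ofReal Real.pi := by
  have h := GaussianFourier.integral_rexp_neg_mul_sq_norm (V := E2) one_pos
  have hpi : ∫ s : E2, Real.exp (-‖s‖ ^ 2) = Real.pi := by simpa using h
  rw [← hpi, ofReal_integral_eq_lintegral_ofReal]
  -- A nonintegrable function would have integral zero by convention, but the integral is π.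
  · by_contra hn
    rw [integral_undef hn] at hpi
    exact Real.pi_pos.ne hpi
  · exact ae_of_all _ fun _ => (Real.exp_pos _).le

/-- A Gaussian weight on the half space with inner normal `n` at `x`, of total mass one. -/
noncomputable def halfGaussian (x n z : E3) : ℝ :=
  2 / Real.pi * (max (inner ℝ n (z - x)) 0 * Real.exp (-‖z - x‖ ^ 2))

theorem measurable_halfGaussian (x n : E3) : Measurable (halfGaussian x n) := by
  unfold halfGaussian
  fun_prop

/-- The tangential Gaussian contributes π and the normal integral of r exp(-r²) contributes 1/2,
which explains the constant 2/π. -/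
theorem lintegral_halfGaussian {n : E3} (hn : ‖n‖ = 1) (x : E3) :
    ∫⁻ z, ENNReal.ofReal (halfGaussian x n z) = 1 := by
  obtain ⟨φ, hφ⟩ := exists_frame hn
  rw [lintegral_frame hn hφ x (measurable_halfGaussian x n).ennreal_ofReal]
  have hpt (r : ℝ) (s : E2) : ENNReal.ofReal (halfGaussian x n (x + (φ s + r • n))) =
      ENNReal.ofReal (2 / Real.pi * (max r 0 * Real.exp (-r ^ 2))) *
        ENNReal.ofReal (Real.exp (-‖s‖ ^ 2)) := by
    have h0 : inner ℝ (φ s) (r • n) = 0 := by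
      rw [inner_smul_right, real_inner_comm, inner_frame hφ, mul_zero]
    have h1 : ‖φ s + r • n‖ ^ 2 = ‖s‖ ^ 2 + r ^ 2 := by
      rw [pow_two, norm_add_sq_eq_norm_sq_add_norm_sq_of_inner_eq_zero _ _ h0, φ.norm_map,
        norm_smul, hn, mul_one, Real.norm_eq_abs, abs_mul_abs_self]
      ring
    rw [halfGaussian, add_sub_cancel_left, inner_frame_add hn hφ, h1,
      ← ENNReal.ofReal_mul (by positivity), neg_add, Real.exp_add]
    congr 1
    ring
  simp_rw [hpt]
  have hin (r : ℝ) : ∫⁻ s : E2, ENNReal.ofReal (2 / Real.pi * (max r 0 * Real.exp (-r ^ 2))) *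
      ENNReal.ofReal (Real.exp (-‖s‖ ^ 2)) =
      (Ioi (0 : ℝ)).indicator
        (fun r => ENNReal.ofReal 2 * ENNReal.ofReal (r ^ 1 * Real.exp (-(1 * r ^ 2)))) r := by
    rw [lintegral_const_mul' _ _ ENNReal.ofReal_ne_top, lintegral_exp_neg_norm_sq_E2]
    by_cases hr : 0 < r
    · rw [indicator_of_mem (show r ∈ Ioi (0 : ℝ) from hr), max_eq_left hr.le,
        ← ENNReal.ofReal_mul (by positivity), ← ENNReal.ofReal_mul (by positivity)]
      congr 1
      have := Real.pi_ne_zero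
      field_simp
    · rw [indicator_of_notMem (show r ∉ Ioi (0 : ℝ) from hr), max_eq_right (not_lt.1 hr)]
      simp
  simp_rw [hin]
  rw [lintegral_indicator measurableSet_Ioi, lintegral_const_mul' _ _ ENNReal.ofReal_ne_top,
    lintegral_Ioi_pow_mul_exp one_pos, ← ENNReal.ofReal_mul (by positivity)]
  norm_num

/-- The Jacobian t² d and the linear factor of the weight combine to t³, and ∫ t³ exp(-b²t²) dt =
1/(2b⁴) with b = ‖y - x‖. The weight was chosen so that exactly the fourth power in the radiation
kernel appears. -/
theorem lintegral_ray_halfGaussian {x n y : E3} (hy : y ≠ x) {d : ℝ} (hd : 0 < d) :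
    ∫⁻ t in Ioi (0 : ℝ), ENNReal.ofReal (t ^ 2 * d) *
        ENNReal.ofReal (halfGaussian x n (x + t • (y - x))) =
      ENNReal.ofReal (d * max (inner ℝ n (y - x)) 0 / (Real.pi * ‖y - x‖ ^ 4)) := by
  have hb : 0 < ‖y - x‖ := norm_pos_iff.2 (sub_ne_zero.2 hy)
  have hpt : ∀ t ∈ Ioi (0 : ℝ), ENNReal.ofReal (t ^ 2 * d) *
      ENNReal.ofReal (halfGaussian x n (x + t • (y - x))) =
      ENNReal.ofReal (2 / Real.pi * d * max (inner ℝ n (y - x)) 0) *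
        ENNReal.ofReal (t ^ 3 * Real.exp (-(‖y - x‖ ^ 2 * t ^ 2))) := by
    intro t ht
    have ht : 0 < t := ht
    have hm : max (t * inner ℝ n (y - x)) 0 = t * max (inner ℝ n (y - x)) 0 := by
      rw [mul_max_of_nonneg _ _ ht.le, mul_zero]
    rw [← ENNReal.ofReal_mul (by positivity), ← ENNReal.ofReal_mul (by positivity), halfGaussian,
      add_sub_cancel_left, inner_smul_right, norm_smul, Real.norm_eq_abs, abs_of_pos ht, hm,
      mul_pow, mul_comm (t ^ 2) (‖y - x‖ ^ 2)]
    congr 1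
    ring
  rw [setLIntegral_congr_fun measurableSet_Ioi hpt, lintegral_const_mul' _ _ ENNReal.ofReal_ne_top,
    lintegral_Ioi_pow_mul_exp (by positivity), ← ENNReal.ofReal_mul (by positivity)]
  congr 1
  have h1 : (-(((3 : ℕ) : ℝ) + 1) / 2) = -((2 : ℕ) : ℝ) := by norm_num
  have h2 : ((((3 : ℕ) : ℝ) + 1) / 2) = 2 := by norm_num
  rw [h1, h2, Real.Gamma_two, Real.rpow_neg (by positivity), Real.rpow_natCast]
  have := Real.pi_ne_zero
  field_simp

section Enclosure

variable {R : Set E3}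

/-- A ray entering a bounded open set leaves it at a visible boundary point. -/
theorem exists_exit {x n w : E3} (hR : IsOpen R) (hb : Bornology.IsBounded R)
    (hn : HasOuterNormal R x n) (hw : inner ℝ n w < 0) :
    ∃ s > (0 : ℝ), x + s • w ∈ frontier R ∧ openSegment ℝ x (x + s • w) ⊆ R := by
  obtain ⟨δ, hδ, hiff⟩ := hn.eventually_mem_iff w
  have hw0 : w ≠ 0 := by rintro rfl; simp at hw
  set T : Set ℝ := {t | 0 < t ∧ x + t • w ∉ R} with hT
  have hTδ : ∀ t ∈ T, δ ≤ t := fun t ht => by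
    by_contra! hlt
    exact ht.2 ((hiff t ht.1 hlt).2 hw)
  have hTne : T.Nonempty := by
    obtain ⟨r, hr⟩ := hb.subset_closedBall x
    have hpos : 0 < ‖w‖ := norm_pos_iff.2 hw0
    refine ⟨(|r| + 1) / ‖w‖, by positivity, fun hmem => ?_⟩
    have := hr hmem
    rw [mem_closedBall_iff_norm, add_sub_cancel_left, norm_smul, Real.norm_eq_abs,
      abs_of_pos (by positivity), div_mul_cancel₀ _ hpos.ne'] at this
    linarith [le_abs_self r]
  have hTbdd : BddBelow T := ⟨δ, hTδ⟩
  have hδs : δ ≤ sInf T := le_csInf hTne hTδ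
  have hs0 : 0 < sInf T := hδ.trans_le hδs
  have hcont : Continuous fun t : ℝ => x + t • w := by fun_prop
  have hnot : x + sInf T • w ∉ R := by
    have h1 : sInf T ∈ closure T := csInf_mem_closure hTne hTbdd
    exact closure_minimal (t := (fun t : ℝ => x + t • w) ⁻¹' Rᶜ) (fun t ht => ht.2)
      (hR.isClosed_compl.preimage hcont) h1
  have hin : ∀ t, 0 < t → t < sInf T → x + t • w ∈ R := fun t ht hlt => by
    by_contra h
    exact (csInf_le hTbdd ⟨ht, h⟩).not_gt hlt
  refine ⟨sInf T, hs0, ?_, ?_⟩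
  · rw [hR.frontier_eq]
    refine ⟨?_, hnot⟩
    have h1 : sInf T ∈ closure (Ioo 0 (sInf T)) := by
      rw [closure_Ioo hs0.ne]; exact right_mem_Icc.2 hs0.le
    exact map_mem_closure (f := fun t : ℝ => x + t • w) hcont h1 fun t ht => hin t ht.1 ht.2
  · rw [openSegment_subset_iff]
    intro t ht
    rw [add_sub_cancel_left, smul_smul]
    exact hin _ (mul_pos ht.1 hs0) (mul_lt_of_lt_one_left hs0 ht.2)

/-- The orientation of the normal at y does not matter: visibility makes the factor at y
nonnegative, so if the outer normal is -ν then d = 0. -/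
theorem kernel_eq_of_flat {x y n ν : E3} {d : ℝ} (hx : HasOuterNormal R x n)
    (hy : HasOuterNormal R y ν ∨ HasOuterNormal R y (-ν)) (hd : inner ℝ ν (y - x) = d)
    (hd0 : 0 ≤ d) (hvis : openSegment ℝ x y ⊆ R) :
    kernel R x y = d * max (inner ℝ (-n) (y - x)) 0 / (Real.pi * ‖y - x‖ ^ 4) := by
  have hvis' := openSegment_subset_iff.1 hvis
  have h1 : 0 ≤ inner ℝ (-n) (y - x) := by
    have := inner_neg_outerNormal_nonneg hvis'
    rwa [hx.outerNormal_eq] at this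
  have h2 : 0 ≤ inner ℝ (-outerNormal R y) (x - y) := inner_neg_outerNormal_nonneg fun t ht => by
    convert hvis' (1 - t) ⟨by linarith [ht.2], by linarith [ht.1]⟩ using 1
    module
  have h3 : inner ℝ (-outerNormal R y) (x - y) = d := by
    have hd' : inner ℝ ν (x - y) = -d := by rw [← hd, ← inner_neg_right, neg_sub]
    rcases hy with hy | hy
    · rw [hy.outerNormal_eq, inner_neg_left, hd', neg_neg]
    · rw [hy.outerNormal_eq, neg_neg, hd'] at h2 ⊢
      linarith
  rw [kernel, visibility, if_pos hvis, one_mul, viewFactor, h3, hx.outerNormal_eq, max_eq_left h1,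
    real_inner_self_eq_norm_sq]
  congr 2
  ring

/-- The part of the cone identity coming from a single plane. -/
theorem lintegral_kernel_plane {x n ν : E3} (hx : HasOuterNormal R x n)
    (hν : ‖ν‖ = 1) {c : ℝ} {A : Set E3} (hA : MeasurableSet A) (hAp : A ⊆ plane ν c)
    (hvis : ∀ y ∈ A, openSegment ℝ x y ⊆ R)
    (hnormal : ∀ᵐ y ∂(μHE[2] : Measure E3), y ∈ A →
      HasOuterNormal R y ν ∨ HasOuterNormal R y (-ν)) :
    NullMeasurableSet {z | ∃ t > (0 : ℝ), x + t • (z - x) ∈ A} ∧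
    ∫⁻ y in A, ENNReal.ofReal (kernel R x y) ∂(μHE[2] : Measure E3) =
      ∫⁻ z in {z | ∃ t > (0 : ℝ), x + t • (z - x) ∈ A}, ENNReal.ofReal (halfGaussian x (-n) z) := by
  -- The normal of the plane is oriented away from x.
  wlog hle : inner ℝ ν x ≤ c generalizing ν c
  · refine this (ν := -ν) (c := -c) (by rwa [norm_neg]) (fun y hy => ?_) ?_ ?_
    · rw [plane, mem_ofPred_eq, inner_neg_left, show inner ℝ ν y = c from hAp hy]
    · filter_upwards [hnormal] with y hy hyA
      rw [neg_neg]
      exact (hy hyA).symm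
    · rw [inner_neg_left]; linarith
  have hker {d : ℝ} (hd : d = c - inner ℝ ν x) : ∀ᵐ y ∂(μHE[2] : Measure E3), y ∈ A →
      kernel R x y = d * max (inner ℝ (-n) (y - x)) 0 / (Real.pi * ‖y - x‖ ^ 4) := by
    filter_upwards [hnormal] with y hy hyA
    refine kernel_eq_of_flat hx (hy hyA) ?_ (by rw [hd]; linarith) (hvis y hyA)
    rw [inner_sub_right, hd, show inner ℝ ν y = c from hAp hyA]
  rcases hle.eq_or_lt with heq | hlt
  -- If x lies on the plane, the cone is contained in the plane and has volume zero, and the kernel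
  -- vanishes because d = 0.
  · have hnull : volume {z | ∃ t > (0 : ℝ), x + t • (z - x) ∈ A} = 0 := by
      refine measure_mono_null (fun z hz => ?_) (volume_plane hν c)
      obtain ⟨t, ht, hz⟩ := hz
      have h1 : inner ℝ ν (x + t • (z - x)) = c := hAp hz
      rw [inner_add_right, inner_smul_right, inner_sub_right, heq] at h1
      have h2 : t * (inner ℝ ν z - c) = 0 := by linarith
      exact sub_eq_zero.1 ((mul_eq_zero.1 h2).resolve_left ht.ne')
    refine ⟨NullMeasurableSet.of_null hnull, ?_⟩
    rw [setLIntegral_measure_zero _ _ hnull,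
      setLIntegral_congr_fun_ae (g := fun _ => 0) hA ?_, lintegral_zero]
    filter_upwards [hker (d := 0) (by linarith)] with y hy hyA
    rw [hy hyA]
    simp
  · have hd : 0 < c - inner ℝ ν x := sub_pos.2 hlt
    obtain ⟨h1, h2⟩ := setLIntegral_cone hν x hd hA (by rwa [add_sub_cancel])
      (measurable_halfGaussian x (-n)).ennreal_ofReal
    refine ⟨h1.nullMeasurableSet, ?_⟩
    rw [h2]
    refine setLIntegral_congr_fun_ae hA ?_
    filter_upwards [hker rfl] with y hy hyA
    have hyx : y ≠ x := by
      rintro rfl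
      exact hlt.ne (hAp hyA)
    rw [hy hyA, lintegral_ray_halfGaussian hyx hd]

/-- In an enclosure, the radiation leaving a regular boundary point arrives at the boundary. -/
theorem lintegral_kernel (hR : R = interior (closure R)) (hb : Bornology.IsBounded R)
    (hc : CoveredByPlanes (frontier R)) {x n : E3} (hx : HasOuterNormal R x n) :
    ∫⁻ y in frontier R, ENNReal.ofReal (kernel R x y) ∂(μHE[2] : Measure E3) = 1 := by
  classical
  have hRo : IsOpen R := hR ▸ isOpen_interior
  obtain ⟨P, hP, hcov⟩ := hc
  have hflat := ae_isFlatAt_of_mem_plane hP hcov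
  set V : Set E3 := frontier R ∩ {y | openSegment ℝ x y ⊆ R} with hV
  have hvm : MeasurableSet {y | openSegment ℝ x y ⊆ R} :=
    (measurableSet_visible hRo).preimage (measurable_const.prodMk measurable_id)
  have hVm : MeasurableSet V := isClosed_frontier.measurableSet.inter hvm
  let e : Fin P.card → E3 × ℝ := fun j => (P.equivFin.symm j).1
  have heP (j) : e j ∈ P := (P.equivFin.symm j).2
  let H : Fin P.card → Set E3 := fun j => plane (e j).1 (e j).2
  have hHm (j) : MeasurableSet (H j) := (isClosed_plane _ _).measurableSet
  -- The visible boundary is split among the planes; a point on several planes goes to the first of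
  -- them.
  let A : Fin P.card → Set E3 := fun j => V ∩ disjointed H j
  have hAm (j) : MeasurableSet (A j) := hVm.inter
    (disjointedRec (fun t i ht => ht.diff (hHm i)) (hHm j))
  have hAdisj : Pairwise (Function.onFun Disjoint A) := fun i j hij =>
    (disjoint_disjointed H hij).mono inter_subset_right inter_subset_right
  have hVA : V = ⋃ j, A j := by
    rw [← inter_iUnion, iUnion_disjointed, eq_comm, inter_eq_left]
    intro y hy
    obtain ⟨p, hp, hyp⟩ := hcov y hy.1
    refine mem_iUnion.2 ⟨P.equivFin ⟨p, hp⟩, ?_⟩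
    simpa only [H, e, Equiv.symm_apply_apply] using hyp
  let C : Fin P.card → Set E3 := fun j => {z | ∃ t > (0 : ℝ), x + t • (z - x) ∈ A j}
  have hplane (j) := lintegral_kernel_plane hx (hP _ (heP j)) (hAm j)
    (fun y hy => disjointed_subset H j hy.2) (fun y hy => hy.1.2) (by
      filter_upwards [hflat] with y ⟨r, hr, hfl⟩ hyA
      have := (hfl _ (heP j) (disjointed_subset H j hyA.2)).isHalfAt_or hR (hP _ (heP j)) hr hyA.1.1
      exact this.imp (fun h => ⟨hP _ (heP j), r, hr, h⟩)
        fun h => ⟨by rw [norm_neg]; exact hP _ (heP j), r, hr, h⟩)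
  have hCdisj : Pairwise (Function.onFun Disjoint C) := by
    intro i j hij
    refine disjoint_left.2 ?_
    rintro z ⟨t, ht, hzi⟩ ⟨t', ht', hzj⟩
    -- two visible points on the same ray coincide
    have key {s s' : ℝ} (hs : 0 < s) (hss : s < s') (h : x + s • (z - x) ∈ V)
        (h' : x + s' • (z - x) ∈ V) : False := by
      have h1 := openSegment_subset_iff.1 h'.2 (s / s')
        ⟨div_pos hs (hs.trans hss), (div_lt_one (hs.trans hss)).2 hss⟩
      rw [add_sub_cancel_left, smul_smul, div_mul_cancel₀ _ (hs.trans hss).ne'] at h1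
      have h2 := h.1
      rw [hRo.frontier_eq] at h2
      exact h2.2 h1
    rcases lt_trichotomy t t' with hlt | rfl | hlt
    · exact key ht hlt hzi.1 hzj.1
    · exact disjoint_left.1 (hAdisj hij) hzi hzj
    · exact key ht' hlt hzj.1 hzi.1
  have hker0 : ∫⁻ y in frontier R, ENNReal.ofReal (kernel R x y) ∂(μHE[2] : Measure E3) =
      ∫⁻ y in V, ENNReal.ofReal (kernel R x y) ∂(μHE[2] : Measure E3) := by
    have : ∀ y ∈ frontier R, ENNReal.ofReal (kernel R x y) =
        ({y | openSegment ℝ x y ⊆ R} : Set E3).indicator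
          (fun y => ENNReal.ofReal (kernel R x y)) y := fun y _ => by
      by_cases h : openSegment ℝ x y ⊆ R
      · rw [indicator_of_mem (show y ∈ {y | openSegment ℝ x y ⊆ R} from h)]
      · rw [indicator_of_notMem (show y ∉ {y | openSegment ℝ x y ⊆ R} from h), kernel, visibility,
          if_neg h]
        simp
    rw [setLIntegral_congr_fun isClosed_frontier.measurableSet this, setLIntegral_indicator hvm,
      inter_comm]
  rw [hker0, hVA, lintegral_iUnion hAm hAdisj]
  simp_rw [fun j => (hplane j).2]
  -- The sum over the planes is now the Gaussian mass of a disjoint union of cones. It is at most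
  -- the total mass one, with equality once the cones cover the inward half space.
  rw [← lintegral_iUnion₀ (fun j => (hplane j).1) (hCdisj.mono fun i j h => h.aedisjoint)]
  refine le_antisymm ?_ ?_
  · rw [← lintegral_halfGaussian (n := -n) (by rw [norm_neg]; exact hx.1) x]
    exact setLIntegral_le_lintegral _ _
  · rw [← lintegral_halfGaussian (n := -n) (by rw [norm_neg]; exact hx.1) x,
      ← setLIntegral_univ (μ := volume)]
    have hhalf : MeasurableSet {z : E3 | 0 < inner ℝ (-n) (z - x)} :=
      (isOpen_lt continuous_const (by fun_prop)).measurableSet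
    have hind : ∀ z ∈ univ, ENNReal.ofReal (halfGaussian x (-n) z) =
        {z : E3 | 0 < inner ℝ (-n) (z - x)}.indicator
          (fun z => ENNReal.ofReal (halfGaussian x (-n) z)) z := fun z _ => by
      by_cases h : 0 < inner ℝ (-n) (z - x)
      · rw [indicator_of_mem (show z ∈ {z : E3 | 0 < inner ℝ (-n) (z - x)} from h)]
      · rw [indicator_of_notMem (show z ∉ {z : E3 | 0 < inner ℝ (-n) (z - x)} from h), halfGaussian,
          max_eq_right (not_lt.1 h)]
        simp
    rw [setLIntegral_congr_fun MeasurableSet.univ hind, setLIntegral_indicator hhalf, inter_univ]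
    refine lintegral_mono_set fun z hz => ?_
    rw [mem_ofPred_eq, inner_neg_left, neg_pos] at hz
    obtain ⟨s, hs, hfr, hseg⟩ := exists_exit hRo hb hx hz
    have hyV : x + s • (z - x) ∈ V := ⟨hfr, hseg⟩
    rw [hVA] at hyV
    obtain ⟨j, hj⟩ := mem_iUnion.1 hyV
    exact mem_iUnion.2 ⟨j, s, hs, hj⟩

end Enclosure

/-! ### Plane polygons -/

theorem volume_frontier_biUnion_convex {ι : Type*} (F : Finset ι) {C : ι → Set E2}
    (hC : ∀ i ∈ F, Convex ℝ (C i)) : volume (frontier (⋃ i ∈ F, C i)) = 0 :=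
  measure_mono_null (frontier_biUnion_finset_subset F C)
    ((measure_biUnion_null_iff F.countable_toSet).2 fun i hi => (hC i hi).addHaar_frontier _)

theorem IsPolygonal.exists_parametrization {ζ : Set E3} (h : IsPolygonal ζ) :
    ∃ φ : E2 →ᵃⁱ[ℝ] E3, range φ = affineSpan ℝ (closure ζ) := by
  have hne : ζ.Nonempty := by
    rw [nonempty_iff_ne_empty]
    rintro rfl
    have h1 := h.1
    rw [vectorSpan_empty, finrank_bot] at h1
    exact two_ne_zero h1.symm
  obtain ⟨p, hp⟩ := hne
  have hspan : affineSpan ℝ (closure ζ) = affineSpan ℝ ζ := by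
    refine le_antisymm (affineSpan_le.2 ?_) (affineSpan_mono ℝ subset_closure)
    exact closure_minimal (subset_affineSpan ℝ ζ) (affineSpan ℝ ζ).closed_of_finiteDimensional
  have hfin : Module.finrank ℝ (affineSpan ℝ ζ).direction = 2 := by
    rw [direction_affineSpan]; exact h.1
  let e := ((stdOrthonormalBasis ℝ (affineSpan ℝ ζ).direction).reindex (finCongr hfin)).repr.symm
  let φ₀ : E2 →ₗᵢ[ℝ] E3 := (affineSpan ℝ ζ).direction.subtypeₗᵢ.comp e.toLinearIsometry
  let φ : E2 →ᵃⁱ[ℝ] E3 :=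
    (AffineIsometryEquiv.vaddConst ℝ p).toAffineIsometry.comp φ₀.toAffineIsometry
  refine ⟨φ, ?_⟩
  rw [hspan]
  have hpm : p ∈ affineSpan ℝ ζ := subset_affineSpan ℝ ζ hp
  ext y
  have happ (s : E2) : φ s = (e s : E3) + p := rfl
  constructor
  · rintro ⟨s, rfl⟩
    rw [happ]
    exact AffineSubspace.vadd_mem_of_mem_direction (e s).2 hpm
  · intro hy
    refine ⟨e.symm ⟨y - p, AffineSubspace.vsub_mem_direction hy hpm⟩, ?_⟩
    rw [happ]
    simp

theorem area_image_eq_zero_iff (φ : E2 →ᵃⁱ[ℝ] E3) (s : Set E2) :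
    (μHE[2] : Measure E3) (φ '' s) = 0 ↔ volume s = 0 := by
  rw [φ.isometry.euclideanHausdorffMeasure_image,
    EuclideanSpace.euclideanHausdorffMeasure_eq_volume]

/-- In planar coordinates the closure is a finite union of convex sets, whose frontiers are null;
every point of it off this planar frontier is in the relative interior. -/
theorem IsPolygonal.area_closure_diff {ζ : Set E3} (h : IsPolygonal ζ) :
    (μHE[2] : Measure E3) (closure ζ \ ζ) = 0 := by
  obtain ⟨φ, hφ⟩ := h.exists_parametrization
  have himg : φ '' (φ ⁻¹' closure ζ) = closure ζ := by
    rw [image_preimage_eq_iff, hφ]; exact subset_affineSpan ℝ _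
  have hnull : volume (frontier (φ ⁻¹' closure ζ)) = 0 := by
    obtain ⟨F, hF⟩ := h.2.2
    rw [hF, preimage_iUnion₂]
    exact volume_frontier_biUnion_convex F fun S _ =>
      (convex_convexHull ℝ _).affine_preimage φ.toAffineMap
  refine measure_mono_null (t := φ '' frontier (φ ⁻¹' closure ζ)) ?_
    ((area_image_eq_zero_iff φ _).2 hnull)
  rintro y ⟨hy, hyζ⟩
  rw [← himg] at hy
  obtain ⟨s, hs, rfl⟩ := hy
  refine ⟨s, ⟨subset_closure hs, fun hint => hyζ ?_⟩, rfl⟩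
  rw [h.2.1, ← himg, φ.intrinsicInterior_image]
  exact mem_image_of_mem _ (interior_subset_intrinsicInterior hint)

/-- A point of ζ is a relative interior point of the closure, so the closure contains the image of a
nonempty open planar set, and it exceeds ζ only by a null set. -/
theorem IsPolygonal.area_ne_zero {ζ : Set E3} (h : IsPolygonal ζ) (hne : ζ.Nonempty) :
    (μHE[2] : Measure E3) ζ ≠ 0 := by
  obtain ⟨φ, hφ⟩ := h.exists_parametrization
  intro h0
  have hcl : (μHE[2] : Measure E3) (closure ζ) = 0 := by
    refine measure_mono_null (t := ζ ∪ (closure ζ \ ζ)) (fun y hy => ?_)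
      (measure_union_null h0 h.area_closure_diff)
    by_cases hyζ : y ∈ ζ
    · exact Or.inl hyζ
    · exact Or.inr ⟨hy, hyζ⟩
  obtain ⟨p, hp⟩ := hne
  have hp' := hp
  rw [h.2.1, mem_intrinsicInterior] at hp'
  obtain ⟨q, hq, rfl⟩ := hp'
  obtain ⟨U, hU, hUq⟩ := isOpen_induced_iff.1 (isOpen_interior (s :=
    ((↑) ⁻¹' closure ζ : Set (affineSpan ℝ (closure ζ)))))
  have hqU : (q : E3) ∈ U := by
    have : q ∈ Subtype.val ⁻¹' U := by rw [hUq]; exact hq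
    exact this
  have hsub : φ '' (φ ⁻¹' U) ⊆ closure ζ := by
    rintro y ⟨s, hs, rfl⟩
    have hmem : φ s ∈ affineSpan ℝ (closure ζ) := by
      rw [← SetLike.mem_coe, ← hφ]; exact mem_range_self s
    have : (⟨φ s, hmem⟩ : affineSpan ℝ (closure ζ)) ∈ Subtype.val ⁻¹' U := hs
    rw [hUq] at this
    have h2 := interior_subset this
    exact h2
  have hq' : (q : E3) ∈ range φ := by rw [hφ]; exact q.2
  obtain ⟨s, hs⟩ := hq'
  have hpos : 0 < volume (φ ⁻¹' U) :=
    (hU.preimage φ.continuous).measure_pos _ ⟨s, by rw [mem_preimage, hs]; exact hqU⟩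
  exact hpos.ne' ((area_image_eq_zero_iff φ _).1 (measure_mono_null hsub hcl))

/-! ### Regular boundary points -/

theorem IsFlatAt.hasOuterNormal_or {A : Set E3} (hA : A = interior (closure A)) {p ν : E3} {r : ℝ}
    (hν : ‖ν‖ = 1) (hr : 0 < r) (hp : p ∈ frontier A) (h : IsFlatAt (frontier A) p ν r) :
    HasOuterNormal A p ν ∨ HasOuterNormal A p (-ν) :=
  (h.isHalfAt_or hA hν hr hp).imp (fun h => ⟨hν, r, hr, h⟩)
    fun h => ⟨by rwa [norm_neg], r, hr, h⟩

theorem CoveredByPlanes.ae_hasOuterNormal {R : Set E3} (hR : R = interior (closure R))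
    (hc : CoveredByPlanes (frontier R)) :
    ∀ᵐ p ∂(μHE[2] : Measure E3), p ∈ frontier R → ∃ n, HasOuterNormal R p n := by
  filter_upwards [hc.ae_isFlatAt] with p hp hpR
  obtain ⟨ν, hν, r, hr, h⟩ := hp hpR
  rcases h.hasOuterNormal_or hR hν hr hpR with h | h
  exacts [⟨_, h⟩, ⟨_, h⟩]

/-- Almost all common boundary points of two disjoint polyhedral sets are interior to the union
of their closures. -/
theorem ae_mem_interior_closure_union {A B : Set E3} (hA : A = interior (closure A))
    (hB : B = interior (closure B)) (hcA : CoveredByPlanes (frontier A))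
    (hcB : CoveredByPlanes (frontier B)) (hAB : Disjoint A B) :
    ∀ᵐ p ∂(μHE[2] : Measure E3), p ∈ frontier A → p ∈ frontier B →
      p ∈ interior (closure A ∪ closure B) := by
  filter_upwards [(hcA.union hcB).ae_isFlatAt] with p hp hpA hpB
  obtain ⟨ν, hν, r, hr, h⟩ := hp (Or.inl hpA)
  exact mem_interior.2 ⟨_, ball_subset_of_isFlatAt hA hB hAB hν hr hpA hpB
    (h.mono subset_union_left) (h.mono subset_union_right), Metric.isOpen_ball,
    Metric.mem_ball_self hr⟩

/-! ### Exchange coefficients in an enclosure -/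

section Exchange

variable {R : Set E3}

/-- Surface measure is not σ-finite on space, so Tonelli is applied to its restrictions to sets of
finite area. -/
theorem exchange_eq_lintegral (hR : IsOpen R) {A B : Set E3}
    (hA : (μHE[2] : Measure E3) A ≠ ∞) (hB : (μHE[2] : Measure E3) B ≠ ∞) :
    exchange R (fun x => -outerNormal R x) A B =
      (∫⁻ x in A, ∫⁻ y in B, ENNReal.ofReal (kernel R x y)
        ∂(μHE[2] : Measure E3) ∂(μHE[2] : Measure E3)).toReal := by
  have : Fact ((μHE[2] : Measure E3) A < ∞) := ⟨hA.lt_top⟩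
  have : Fact ((μHE[2] : Measure E3) B < ∞) := ⟨hB.lt_top⟩
  have h1 := integral_eq_lintegral_of_nonneg_ae (f := fun p : E3 × E3 => kernel R p.1 p.2)
    (μ := ((μHE[2] : Measure E3).restrict A).prod ((μHE[2] : Measure E3).restrict B))
    (ae_of_all _ fun p => kernel_nonneg R p.1 p.2) (measurable_kernel hR).aestronglyMeasurable
  have h2 := lintegral_prod (μ := (μHE[2] : Measure E3).restrict A)
    (ν := (μHE[2] : Measure E3).restrict B) (fun p : E3 × E3 => ENNReal.ofReal (kernel R p.1 p.2))
    (measurable_kernel hR).ennreal_ofReal.aemeasurable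
  rw [← h2, ← h1]
  rfl

theorem exchange_nonneg (A B : Set E3) : 0 ≤ exchange R (fun x => -outerNormal R x) A B :=
  integral_nonneg fun p => kernel_nonneg R p.1 p.2

/-- The exchange coefficients of a boundary piece of an enclosure sum up to its area. -/
theorem sum_exchange (hR : R = interior (closure R)) (hb : Bornology.IsBounded R)
    (hc : CoveredByPlanes (frontier R)) {K : Type*} [Fintype K] {B : K → Set E3}
    (hBm : ∀ k, NullMeasurableSet (B k) (μHE[2] : Measure E3))
    (hBR : ∀ k, B k ⊆ frontier R)
    (hBd : Pairwise (Function.onFun (AEDisjoint (μHE[2] : Measure E3)) B))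
    (hBc : (μHE[2] : Measure E3) (frontier R \ ⋃ k, B k) = 0) {A : Set E3} (hA : MeasurableSet A)
    (hAR : A ⊆ frontier R) :
    ∑ k, exchange R (fun x => -outerNormal R x) A (B k) = area A := by
  have hRo : IsOpen R := hR ▸ isOpen_interior
  have hfin : (μHE[2] : Measure E3) (frontier R) < ∞ :=
    hc.area_lt_top (hb.closure.subset frontier_subset_closure)
  have hAfin : (μHE[2] : Measure E3) A ≠ ∞ := ((measure_mono hAR).trans_lt hfin).ne
  have hBfin (k) : (μHE[2] : Measure E3) (B k) ≠ ∞ := ((measure_mono (hBR k)).trans_lt hfin).ne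
  have hunion : (⋃ k, B k : Set E3) =ᵐ[(μHE[2] : Measure E3)] frontier R :=
    (ae_le_set.2 (by rw [sdiff_eq_empty.2 (iUnion_subset hBR), measure_empty])).antisymm
      (ae_le_set.2 hBc)
  have hmeas (k) : Measurable fun x => ∫⁻ y in B k, ENNReal.ofReal (kernel R x y)
      ∂(μHE[2] : Measure E3) := by
    have : Fact ((μHE[2] : Measure E3) (B k) < ∞) := ⟨(hBfin k).lt_top⟩
    exact (measurable_kernel hRo).ennreal_ofReal.lintegral_prod_right'
  have htotal : ∑ k, ∫⁻ x in A, ∫⁻ y in B k, ENNReal.ofReal (kernel R x y)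
      ∂(μHE[2] : Measure E3) ∂(μHE[2] : Measure E3) = (μHE[2] : Measure E3) A := by
    rw [← lintegral_finsetSum _ fun k _ => hmeas k]
    -- Almost every point of A has an outer normal, and for such a point the pieces B k together
    -- receive the full kernel mass.
    have hone : ∀ᵐ x ∂(μHE[2] : Measure E3), x ∈ A →
        ∑ k, ∫⁻ y in B k, ENNReal.ofReal (kernel R x y) ∂(μHE[2] : Measure E3) = 1 := by
      filter_upwards [hc.ae_hasOuterNormal hR] with x hx hxA
      obtain ⟨n, hn⟩ := hx (hAR hxA)
      rw [← lintegral_kernel hR hb hc hn, ← setLIntegral_congr hunion,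
        lintegral_iUnion₀ hBm hBd, tsum_fintype]
    rw [setLIntegral_congr_fun_ae hA hone, setLIntegral_one]
  simp_rw [fun k => exchange_eq_lintegral hRo hAfin (hBfin k)]
  rw [← ENNReal.toReal_sum, htotal, area]
  intro k _
  refine ne_top_of_le_ne_top hAfin ?_
  rw [← htotal]
  exact Finset.single_le_sum (f := fun k => ∫⁻ x in A, ∫⁻ y in B k, ENNReal.ofReal (kernel R x y)
      ∂(μHE[2] : Measure E3) ∂(μHE[2] : Measure E3)) (fun _ _ => zero_le) (Finset.mem_univ k)

end Exchange

/-! ### The domain -/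

namespace Domain

variable (D : Domain)

theorem interior_closure_Ω : interior (closure D.Ω) = D.Ω := D.polyhedral.1.symm

theorem closure_part_subset (m : Phase) : closure (D.part m) ⊆ closure D.Ω := by
  rw [D.closure_eq]
  cases m
  exacts [subset_union_left, subset_union_right]

theorem part_subset (m : Phase) : D.part m ⊆ D.Ω := by
  rw [← D.interior_closure_Ω]
  exact (D.part_isOpen m).subset_interior_iff.2 (subset_closure.trans (D.closure_part_subset m))

theorem disjoint_parts : Disjoint (D.part .solid) (D.part .gas) :=
  disjoint_iff_inter_eq_empty.2 D.part_disjoint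

theorem interface_subset_frontier_solid : D.interface ⊆ frontier (D.part .solid) := by
  rw [D.frontier_solid]; exact subset_union_right

theorem interface_subset : D.interface ⊆ D.Ω := by
  intro p hp
  have h1 : p ∈ closure D.Ω := D.closure_part_subset .gas hp.1
  by_contra h2
  refine disjoint_left.1 D.frontier_disjoint (show p ∈ frontier D.Ω from ?_) hp
  rw [D.isOpen.frontier_eq]
  exact ⟨h1, h2⟩

/-- At the interface, solid and gas are locally complementary. -/
theorem hasOuterNormal_neg {m m' : Phase} (hmm : m ≠ m') {p n : E3} (hp : p ∈ D.interface)
    (hn : HasOuterNormal (D.part m) p n) : HasOuterNormal (D.part m') p (-n) := by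
  obtain ⟨hn1, r, hr, hA⟩ := hn
  have hA : IsHalfAt (D.part m) p n r := hA
  have hcl : closure D.Ω = closure (D.part m) ∪ closure (D.part m') := by
    rw [D.closure_eq]
    cases m <;> cases m' <;> first | exact absurd rfl hmm | rfl | exact union_comm _ _
  have hdisj : Disjoint (D.part m) (D.part m') := by
    cases m <;> cases m' <;>
      first | exact absurd rfl hmm | exact D.disjoint_parts | exact D.disjoint_parts.symm
  have hpm : p ∈ frontier (D.part m') := by
    cases m'
    exacts [D.interface_subset_frontier_solid hp, hp]
  obtain ⟨ε, hε, hball⟩ := Metric.isOpen_iff.1 D.isOpen p (D.interface_subset hp)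
  refine ⟨by rwa [norm_neg], min r ε, lt_min hr hε, ?_⟩
  have hflat : IsFlatAt (frontier (D.part m')) p (-n) (min r ε) := by
    intro y hy hym
    have hyr := Metric.ball_subset_ball (min_le_left r ε) hy
    have hyε := hball (Metric.ball_subset_ball (min_le_right r ε) hy)
    rw [inner_neg_left, neg_eq_zero]
    refine le_antisymm ?_ ?_
    · by_contra! hlt
      -- the outer open half ball is contained in the interior of the other part
      have hU : IsOpen (Metric.ball p r ∩ D.Ω ∩ {z | 0 < inner ℝ n (z - p)}) :=
        (Metric.isOpen_ball.inter D.isOpen).inter (isOpen_lt continuous_const (by fun_prop))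
      have hsub : Metric.ball p r ∩ D.Ω ∩ {z | 0 < inner ℝ n (z - p)} ⊆ closure (D.part m') := by
        rintro z ⟨⟨hz, hzΩ⟩, hz0⟩
        have := subset_closure hzΩ
        rw [hcl] at this
        exact this.resolve_left fun h => (hA.inner_le hz h).not_gt hz0
      have hyin : y ∈ interior (closure (D.part m')) := mem_interior.2 ⟨_, hsub, hU, ⟨hyr, hyε⟩, hlt⟩
      rw [← (D.part_polyhedral m').1] at hyin
      rw [(D.part_isOpen m').frontier_eq] at hym
      exact hym.2 hyin
    · by_contra! hlt
      have hyA := (hA y hyr).2 hlt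
      exact ((hdisj.symm.closure_left (D.part_isOpen m)).le_bot ⟨hym.1, hyA⟩ : _)
  have hA' : IsHalfAt (D.part m) p n (min r ε) := fun y hy =>
    hA y (Metric.ball_subset_ball (min_le_left r ε) hy)
  rcases hflat.isHalfAt_or (D.part_polyhedral m').1 (by rwa [norm_neg]) (lt_min hr hε) hpm with h | h
  · exact h
  · rw [neg_neg] at h
    exact absurd h (not_isHalfAt_of_disjoint hdisj hn1 (lt_min hr hε) hA')

/-- This lets the exchange through the gas be computed with the inner normal of the gas, the same
kernel as for the open region. If one normal fails to exist, so does the other, and both defaults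
are zero. -/
theorem outerNormal_solid {p : E3} (hp : p ∈ D.interface) :
    outerNormal (D.part .solid) p = -outerNormal (D.part .gas) p := by
  by_cases h : ∃ n, HasOuterNormal (D.part .gas) p n
  · obtain ⟨n, hn⟩ := h
    rw [hn.outerNormal_eq, (D.hasOuterNormal_neg (by rintro ⟨⟩) hp hn).outerNormal_eq]
  · rw [outerNormal_eq_zero h, neg_zero, outerNormal_eq_zero]
    rintro ⟨n, hn⟩
    exact h ⟨_, D.hasOuterNormal_neg (by rintro ⟨⟩) hp hn⟩

theorem coveredByPlanes_part (m : Phase) : CoveredByPlanes (frontier (D.part m)) :=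
  (D.part_polyhedral m).coveredByPlanes_frontier

theorem isClosed_interface : IsClosed D.interface := isClosed_frontier

theorem area_interface_lt_top : (μHE[2] : Measure E3) D.interface < ∞ :=
  (D.coveredByPlanes_part .gas).area_lt_top
    ((D.part_bounded .gas).closure.subset frontier_subset_closure)

theorem exchangeSig_eq {A B : Set E3} (hA : MeasurableSet A) (hB : MeasurableSet B)
    (hAS : A ⊆ D.interface) (hBS : B ⊆ D.interface) :
    D.exchangeSig A B = exchange (D.part .gas) (fun x => -outerNormal (D.part .gas) x) A B := by
  have : Fact ((μHE[2] : Measure E3) B < ∞) :=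
    ⟨(measure_mono hBS).trans_lt D.area_interface_lt_top⟩
  refine integral_congr_ae ?_
  have h1 := Measure.quasiMeasurePreserving_fst (μ := (μHE[2] : Measure E3).restrict A)
    (ν := (μHE[2] : Measure E3).restrict B) |>.ae (ae_restrict_mem hA)
  have h2 := Measure.quasiMeasurePreserving_snd (μ := (μHE[2] : Measure E3).restrict A)
    (ν := (μHE[2] : Measure E3).restrict B) |>.ae (ae_restrict_mem hB)
  filter_upwards [h1, h2] with p hp1 hp2
  rw [viewFactor, viewFactor, D.outerNormal_solid (hAS hp1), D.outerNormal_solid (hBS hp2)]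

/-! ### The open radiation region -/

theorem exists_hull_eq : ∃ S : Finset E3, D.hull = convexHull ℝ (S : Set E3) :=
  exists_finset_convexHull_eq D.polyhedral.2

theorem isClosed_hull : IsClosed D.hull := by
  obtain ⟨S, hS⟩ := D.exists_hull_eq
  rw [hS]
  exact isClosed_convexHull_finset S

theorem coveredByPlanes_hull : CoveredByPlanes (frontier D.hull) := by
  obtain ⟨S, hS⟩ := D.exists_hull_eq
  rw [hS]
  exact coveredByPlanes_frontier_convexHull S

theorem closure_Ω_subset_hull : closure D.Ω ⊆ D.hull := subset_convexHull ℝ _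

theorem isOpen_openRegion : IsOpen D.openRegion := isOpen_interior.sdiff isClosed_closure

theorem closure_openRegion_subset_hull : closure D.openRegion ⊆ D.hull :=
  closure_minimal (sdiff_subset.trans interior_subset) D.isClosed_hull

theorem isBounded_openRegion : Bornology.IsBounded D.openRegion :=
  (isBounded_convexHull.2 D.bounded.closure).subset
    (subset_closure.trans D.closure_openRegion_subset_hull)

theorem disjoint_Ω_openRegion : Disjoint D.Ω D.openRegion :=
  disjoint_left.2 fun _ hy hO => hO.2 (subset_closure hy)

theorem notMem_Ω_of_mem_closure_openRegion {p : E3} (hp : p ∈ closure D.openRegion) : p ∉ D.Ω :=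
  fun h => (D.disjoint_Ω_openRegion.closure_right D.isOpen).le_bot ⟨h, hp⟩

theorem bodyBoundary_subset_frontier : D.bodyBoundary ⊆ frontier D.Ω := fun p hp => by
  rw [D.isOpen.frontier_eq]
  exact ⟨hp.1, D.notMem_Ω_of_mem_closure_openRegion hp.2⟩

theorem isClosed_bodyBoundary : IsClosed D.bodyBoundary := isClosed_closure.inter isClosed_closure

theorem isClosed_phantom : IsClosed D.phantom := isClosed_frontier.inter isClosed_frontier

theorem frontier_openRegion : frontier D.openRegion = D.bodyBoundary ∪ D.phantom := by
  refine subset_antisymm (fun p hp => ?_) (union_subset (fun p hp => ?_) inter_subset_right)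
  · have hp' := hp
    rw [D.isOpen_openRegion.frontier_eq] at hp'
    by_cases hpΩ : p ∈ closure D.Ω
    · exact Or.inl ⟨hpΩ, hp'.1⟩
    · exact Or.inr ⟨⟨subset_closure (D.closure_openRegion_subset_hull hp'.1),
        fun h => hp'.2 ⟨h, hpΩ⟩⟩, hp⟩
  · rw [D.isOpen_openRegion.frontier_eq]
    exact ⟨hp.2, fun h => h.2 hp.1⟩

theorem coveredByPlanes_openRegion : CoveredByPlanes (frontier D.openRegion) := by
  rw [D.frontier_openRegion]
  exact (D.polyhedral.coveredByPlanes_frontier.mono D.bodyBoundary_subset_frontier).union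
    (D.coveredByPlanes_hull.mono inter_subset_left)

/-- A point of the closure of Ω interior to the closure of O would have points of Ω near it in the
closure of O, although Ω is open and disjoint from O. -/
theorem openRegion_regular : D.openRegion = interior (closure D.openRegion) := by
  refine subset_antisymm (D.isOpen_openRegion.subset_interior_iff.2 subset_closure) fun p hp => ?_
  refine ⟨interior_mono D.closure_openRegion_subset_hull hp, fun hpΩ => ?_⟩
  obtain ⟨y, hy, hyΩ⟩ := mem_closure_iff.1 hpΩ _ isOpen_interior hp
  exact D.notMem_Ω_of_mem_closure_openRegion (interior_subset hy) hyΩ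

/-- At almost every common boundary point Ω and O together fill a neighbourhood, which lies in the
hull; such a point is not on the frontier of the hull. -/
theorem area_bodyBoundary_inter_phantom :
    (μHE[2] : Measure E3) (D.bodyBoundary ∩ D.phantom) = 0 := by
  rw [measure_eq_zero_iff_ae_notMem]
  filter_upwards [ae_mem_interior_closure_union D.polyhedral.1 D.openRegion_regular
    D.polyhedral.coveredByPlanes_frontier D.coveredByPlanes_openRegion
    D.disjoint_Ω_openRegion] with p hp hpm
  refine hpm.2.1.2 (interior_mono (union_subset D.closure_Ω_subset_hull
    D.closure_openRegion_subset_hull) (hp (D.bodyBoundary_subset_frontier hpm.1) hpm.2.2))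

end Domain

/-! ### Control volumes -/

namespace SpaceMesh

variable {D : Domain} {I : Type*} (M : SpaceMesh D I)

theorem nonempty_index (M : SpaceMesh D I) : Nonempty I := by
  obtain ⟨p, hp⟩ := D.nonempty
  have : p ∈ ⋃ i, closure (M.ω i) := by rw [← M.cover]; exact subset_closure hp
  exact ⟨(mem_iUnion.1 this).choose⟩

theorem cell_subset (m : Phase) (i : I) : M.cell m i ⊆ M.ω i := inter_subset_left

theorem isOpen_cell (m : Phase) (i : I) : IsOpen (M.cell m i) :=
  (M.isOpen i).inter (D.part_isOpen m)

theorem isBounded (i : I) : Bornology.IsBounded (M.ω i) := D.bounded.subset (M.subset i)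

theorem vol_pos (i : I) : 0 < vol (M.ω i) :=
  ENNReal.toReal_pos ((M.isOpen i).measure_pos _ (M.isConnected i).nonempty).ne'
    (M.isBounded i).measure_lt_top.ne

/-- What the two cells miss of the control volume lies on the frontiers of the phases, which are
null. -/
theorem vol_cells (i : I) : vol (M.cell .solid i) + vol (M.cell .gas i) = vol (M.ω i) := by
  have hfin (m) : volume (M.cell m i) ≠ ∞ :=
    ((M.isBounded i).subset (M.cell_subset m i)).measure_lt_top.ne
  have hdisj : Disjoint (M.cell .solid i) (M.cell .gas i) :=
    D.disjoint_parts.mono inter_subset_right inter_subset_right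
  rw [vol, vol, ← ENNReal.toReal_add (hfin _) (hfin _),
    ← measure_union hdisj (M.isOpen_cell _ i).measurableSet, vol]
  congr 1
  refine le_antisymm (measure_mono (union_subset (M.cell_subset _ i) (M.cell_subset _ i))) ?_
  refine (measure_mono (t := (M.cell .solid i ∪ M.cell .gas i) ∪
    (frontier (D.part .solid) ∪ frontier (D.part .gas))) fun p hp => ?_).trans
    ((measure_union_le _ _).trans_eq ?_)
  · have h1 : p ∈ closure D.Ω := subset_closure (M.subset i hp)
    rw [D.closure_eq] at h1
    by_cases hs : p ∈ D.part .solid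
    · exact Or.inl (Or.inl ⟨hp, hs⟩)
    by_cases hg : p ∈ D.part .gas
    · exact Or.inl (Or.inr ⟨hp, hg⟩)
    right
    rw [(D.part_isOpen _).frontier_eq, (D.part_isOpen _).frontier_eq]
    exact h1.imp (fun h => ⟨h, hs⟩) fun h => ⟨h, hg⟩
  · rw [((D.coveredByPlanes_part _).union (D.coveredByPlanes_part _)).volume_eq_zero, add_zero]

theorem disjoint_closure {i j : I} (hij : i ≠ j) : Disjoint (M.ω i) (closure (M.ω j)) :=
  (M.disjoint i j hij).closure_right (M.isOpen i)

theorem closure_subset (i : I) : closure (M.ω i) ⊆ closure D.Ω := closure_mono (M.subset i)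

/-- Almost no point of the outer boundary is adjacent to two control volumes. -/
theorem ae_eq_of_mem_frontier (i j : I) : ∀ᵐ p ∂(μHE[2] : Measure E3), p ∈ frontier D.Ω →
    p ∈ closure (M.ω i) → p ∈ closure (M.ω j) → i = j := by
  by_cases hij : i = j
  · exact ae_of_all _ fun _ _ _ _ => hij
  filter_upwards [ae_mem_interior_closure_union (M.polyhedral i).1 (M.polyhedral j).1
    (M.polyhedral i).coveredByPlanes_frontier (M.polyhedral j).coveredByPlanes_frontier
    (M.disjoint i j hij)] with p hp hpΩ hpi hpj
  rw [D.isOpen.frontier_eq] at hpΩ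
  have hfr (k) (h : p ∈ closure (M.ω k)) : p ∈ frontier (M.ω k) := by
    rw [(M.isOpen k).frontier_eq]
    exact ⟨h, fun h => hpΩ.2 (M.subset k h)⟩
  refine absurd ?_ hpΩ.2
  rw [← D.interior_closure_Ω]
  exact interior_mono (union_subset (M.closure_subset i) (M.closure_subset j))
    (hp (hfr i hpi) (hfr j hpj))

/-- The gas keeps away from the outer boundary, so near such a point the control volume is filled by
solid up to closure. -/
theorem mem_frontier_cell_solid {i : I} {p : E3} (hp : p ∈ closure (M.ω i))
    (hpΩ : p ∈ frontier D.Ω) : p ∈ frontier (M.cell .solid i) := by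
  rw [(M.isOpen_cell _ i).frontier_eq]
  rw [D.isOpen.frontier_eq] at hpΩ
  refine ⟨?_, fun h => hpΩ.2 (M.subset i h.1)⟩
  have hpg : p ∉ closure (D.part .gas) := fun h => by
    have hpg : p ∈ frontier (D.part .gas) := by
      rw [(D.part_isOpen _).frontier_eq]
      exact ⟨h, fun h => hpΩ.2 (D.part_subset _ h)⟩
    exact hpΩ.2 (D.interface_subset hpg)
  rw [mem_closure_iff]
  intro U hU hpU
  obtain ⟨y, ⟨hyU, hyg⟩, hyi⟩ := mem_closure_iff.1 hp _ (hU.inter isClosed_closure.isOpen_compl)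
    ⟨hpU, hpg⟩
  have hy : y ∈ closure D.Ω := subset_closure (M.subset i hyi)
  rw [D.closure_eq] at hy
  obtain ⟨z, ⟨hzU, hzi⟩, hzs⟩ := mem_closure_iff.1 (hy.resolve_right hyg) _ (hU.inter (M.isOpen i))
    ⟨hyU, hyi⟩
  exact ⟨z, hzU, hzi, hzs⟩

/-- Almost no point of the interface is a boundary point of a control volume whose solid part
touches the interface there. -/
theorem ae_mem_of_mem_interface (i : I) : ∀ᵐ p ∂(μHE[2] : Measure E3), p ∈ D.interface →
    p ∈ closure (M.cell .solid i) → p ∈ M.ω i := by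
  have hc := ((D.coveredByPlanes_part .solid).union (D.coveredByPlanes_part .gas)).union
    (M.polyhedral i).coveredByPlanes_frontier
  filter_upwards [hc.ae_isFlatAt] with p hp hpS hpi
  by_contra hnot
  have hpfi : p ∈ frontier (M.ω i) := by
    rw [(M.isOpen i).frontier_eq]
    exact ⟨closure_mono (M.cell_subset _ i) hpi, hnot⟩
  obtain ⟨ν, hν, r, hr, hflat⟩ := hp (Or.inr hpfi)
  have hfs := hflat.mono (subset_union_left.trans subset_union_left :
    frontier (D.part .solid) ⊆ _)
  have hfi := hflat.mono (subset_union_right : frontier (M.ω i) ⊆ _)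
  -- the control volume coincides locally with one of the two phases
  have key {ν : E3} (hν : ‖ν‖ = 1) (hs : IsHalfAt (D.part .solid) p ν r)
      (hi : IsHalfAt (M.ω i) p ν r) : False := by
    have hcell : HasOuterNormal (M.cell .solid i) p ν := ⟨hν, r, hr, fun y hy =>
      ⟨fun h => (hs y hy).1 h.2, fun h => ⟨(hi y hy).2 h, (hs y hy).2 h⟩⟩⟩
    have hmem : p ∈ regularFrontier (M.ω i ∩ D.part .solid) ∩ D.interface :=
      ⟨⟨hcell.mem_frontier, ν, hcell⟩, hpS⟩
    -- By compatibility of the mesh, p would also be a boundary point of the gas cell, yet near p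
    -- the control volume coincides with the solid.
    rw [M.regular_interface] at hmem
    obtain ⟨y, hy, hyi, hyg⟩ := mem_closure_iff.1 hmem.1.1.1 _ Metric.isOpen_ball
      (Metric.mem_ball_self hr)
    exact disjoint_left.1 D.disjoint_parts ((hs y hy).2 ((hi y hy).1 hyi)) hyg
  -- On opposite sides of the plane the solid cell would be empty near p, although p lies in its
  -- closure.
  have key' {ν : E3} (hs : IsHalfAt (D.part .solid) p ν r)
      (hi : IsHalfAt (M.ω i) p (-ν) r) : False := by
    obtain ⟨y, hy, hyi, hys⟩ := mem_closure_iff.1 hpi _ Metric.isOpen_ball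
      (Metric.mem_ball_self hr)
    have h1 := (hs y hy).1 hys
    have h2 := (hi y hy).1 hyi
    rw [inner_neg_left] at h2
    linarith
  rcases hfs.isHalfAt_or (D.part_polyhedral _).1 hν hr (D.interface_subset_frontier_solid hpS)
    with hs | hs <;> rcases hfi.isHalfAt_or (M.polyhedral i).1 hν hr hpfi with hi | hi
  · exact key hν hs hi
  · exact key' hs hi
  · exact key' hs (by rwa [neg_neg])
  · exact key (by rwa [norm_neg]) hs hi

end SpaceMesh

/-! ### Boundary elements -/

theorem area_eq_sum {ι : Type*} (F : Finset ι) {ζ : ι → Set E3} (hm : ∀ α, MeasurableSet (ζ α))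
    (hd : ∀ α β, α ≠ β → Disjoint (ζ α) (ζ β)) (hfin : ∀ α, (μHE[2] : Measure E3) (ζ α) ≠ ∞)
    {A : Set E3} (hA : ∀ᵐ p ∂(μHE[2] : Measure E3), p ∈ A ↔ ∃ α ∈ F, p ∈ ζ α) :
    ∑ α ∈ F, area (ζ α) = area A := by
  have h : (A : Set E3) =ᵐ[(μHE[2] : Measure E3)] (⋃ α ∈ F, ζ α : Set E3) := by
    filter_upwards [hA] with p hp
    refine propext (hp.trans ?_)
    simp only [← exists_prop, ← mem_iUnion]
    rfl
  unfold area
  rw [measure_congr h, measure_biUnion_finset (fun α _ β _ hαβ => hd α β hαβ) fun α _ => hm α,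
    ENNReal.toReal_sum fun α _ => hfin α]

namespace BoundaryMesh

variable {D : Domain} {I IΩ ISig : Type*} {M : SpaceMesh D I} (B : BoundaryMesh M IΩ ISig)

theorem ζΩ_subset (α : IΩ) : B.ζΩ α ⊆ D.bodyBoundary := by
  obtain ⟨U, -, h⟩ := B.ζΩ_relOpen α
  rw [h]; exact inter_subset_right

theorem ζSig_subset (α : ISig) : B.ζSig α ⊆ D.interface := by
  obtain ⟨U, -, h⟩ := B.ζSig_relOpen α
  rw [h]; exact inter_subset_right

theorem measurableSet_ζΩ (α : IΩ) : MeasurableSet (B.ζΩ α) := by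
  obtain ⟨U, hU, h⟩ := B.ζΩ_relOpen α
  rw [h]; exact hU.measurableSet.inter D.isClosed_bodyBoundary.measurableSet

theorem measurableSet_ζSig (α : ISig) : MeasurableSet (B.ζSig α) := by
  obtain ⟨U, hU, h⟩ := B.ζSig_relOpen α
  rw [h]; exact hU.measurableSet.inter D.isClosed_interface.measurableSet

theorem measure_ζΩ_ne_top (α : IΩ) : (μHE[2] : Measure E3) (B.ζΩ α) ≠ ∞ := by
  refine ((measure_mono ((B.ζΩ_subset α).trans D.bodyBoundary_subset_frontier)).trans_lt ?_).ne
  exact D.polyhedral.coveredByPlanes_frontier.area_lt_top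
    (D.bounded.closure.subset frontier_subset_closure)

theorem measure_ζSig_ne_top (α : ISig) : (μHE[2] : Measure E3) (B.ζSig α) ≠ ∞ :=
  ((measure_mono (B.ζSig_subset α)).trans_lt D.area_interface_lt_top).ne

theorem measure_ζΩ_ne_zero (α : IΩ) : (μHE[2] : Measure E3) (B.ζΩ α) ≠ 0 :=
  (B.ζΩ_polygonal α).area_ne_zero (B.ζΩ_connected α).nonempty

theorem measure_ζSig_ne_zero (α : ISig) : (μHE[2] : Measure E3) (B.ζSig α) ≠ 0 :=
  (B.ζSig_polygonal α).area_ne_zero (B.ζSig_connected α).nonempty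

theorem area_ζΩ_pos (α : IΩ) : 0 < area (B.ζΩ α) :=
  ENNReal.toReal_pos (B.measure_ζΩ_ne_zero α) (B.measure_ζΩ_ne_top α)

theorem area_ζSig_pos (α : ISig) : 0 < area (B.ζSig α) :=
  ENNReal.toReal_pos (B.measure_ζSig_ne_zero α) (B.measure_ζSig_ne_top α)

theorem ζΩ_subset_frontier (α : IΩ) : B.ζΩ α ⊆ frontier (M.ω (B.idxΩ α)) :=
  ((B.idxΩ_iff α _).2 rfl).trans inter_subset_left

theorem ζSig_subset_frontier (α : ISig) : B.ζSig α ⊆ frontier (M.cell .solid (B.idxSig α)) :=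
  ((B.idxSig_iff α _).2 rfl).trans inter_subset_left

/-- Almost every point of `Γ_Ω` lies in a boundary element. -/
theorem ae_exists_mem_ζΩ [Countable IΩ] :
    ∀ᵐ p ∂(μHE[2] : Measure E3), p ∈ D.bodyBoundary → ∃ α, p ∈ B.ζΩ α := by
  filter_upwards [ae_all_iff.2 fun α => measure_eq_zero_iff_ae_notMem.1
    (B.ζΩ_polygonal α).area_closure_diff] with p hp hpb
  rw [B.ζΩ_cover] at hpb
  obtain ⟨α, hα⟩ := mem_iUnion.1 hpb
  exact ⟨α, by_contra fun h => hp α ⟨hα, h⟩⟩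

/-- Almost every point of the interface lies in a boundary element. -/
theorem ae_exists_mem_ζSig [Countable ISig] :
    ∀ᵐ p ∂(μHE[2] : Measure E3), p ∈ D.interface → ∃ α, p ∈ B.ζSig α := by
  filter_upwards [ae_all_iff.2 fun α => measure_eq_zero_iff_ae_notMem.1
    (B.ζSig_polygonal α).area_closure_diff] with p hp hpb
  rw [B.ζSig_cover] at hpb
  obtain ⟨α, hα⟩ := mem_iUnion.1 hpb
  exact ⟨α, by_contra fun h => hp α ⟨hα, h⟩⟩

theorem ae_eq_idxΩ (α : IΩ) (i : I) : ∀ᵐ p ∂(μHE[2] : Measure E3), p ∈ B.ζΩ α →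
    p ∈ closure (M.ω i) → B.idxΩ α = i := by
  filter_upwards [M.ae_eq_of_mem_frontier (B.idxΩ α) i] with p hp hpα
  exact hp (D.bodyBoundary_subset_frontier (B.ζΩ_subset α hpα)) (B.ζΩ_subset_frontier α hpα).1

theorem ae_mem_ω (α : ISig) : ∀ᵐ p ∂(μHE[2] : Measure E3), p ∈ B.ζSig α →
    p ∈ M.ω (B.idxSig α) := by
  filter_upwards [M.ae_mem_of_mem_interface (B.idxSig α)] with p hp hpα
  exact hp (B.ζSig_subset α hpα) (B.ζSig_subset_frontier α hpα).1

/-- Almost all of an interface element lies in its open control volume, which is disjoint from the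
closures of the others. -/
theorem ae_eq_idxSig (α : ISig) (i : I) : ∀ᵐ p ∂(μHE[2] : Measure E3), p ∈ B.ζSig α →
    p ∈ closure (M.ω i) → B.idxSig α = i := by
  filter_upwards [B.ae_mem_ω α] with p hp hpα hpi
  by_contra hne
  exact disjoint_left.1 (M.disjoint_closure hne) (hp hpα) hpi

/-- Contact with any other control volume has area zero, while the element itself has positive area.
Each element therefore irradiates exactly one node. -/
theorem mem_adjacentΩ [Fintype IΩ] {α : IΩ} {i : I} : α ∈ adjacentΩ M B i ↔ B.idxΩ α = i := by
  rw [adjacentΩ, Finset.mem_filter]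
  constructor
  · rintro ⟨-, h⟩
    by_contra hne
    refine h (measure_eq_zero_iff_ae_notMem.2 ?_)
    filter_upwards [B.ae_eq_idxΩ α i] with p hp hpm
    exact hne (hp hpm.1 hpm.2.1)
  · rintro rfl
    refine ⟨Finset.mem_univ _, ?_⟩
    rw [inter_eq_left.2 (B.ζΩ_subset_frontier α)]
    exact B.measure_ζΩ_ne_zero α

theorem mem_adjacentSig [Fintype ISig] {α : ISig} {i : I} : α ∈ adjacentSig M B i ↔ B.idxSig α = i := by
  rw [adjacentSig, Finset.mem_filter]
  constructor
  · rintro ⟨-, h⟩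
    by_contra hne
    refine h (measure_eq_zero_iff_ae_notMem.2 ?_)
    filter_upwards [B.ae_eq_idxSig α i] with p hp hpm
    exact hne (hp hpm.1 (closure_mono (M.cell_subset _ i) hpm.2.1))
  · rintro rfl
    refine ⟨Finset.mem_univ _, ?_⟩
    rw [inter_eq_left.2 (B.ζSig_subset_frontier α)]
    exact B.measure_ζSig_ne_zero α

/-- The emitting area of a node must equal the total area of the elements that irradiate it;
otherwise emission and irradiation would not balance at a uniform temperature. -/
theorem sum_area_adjacentΩ [Fintype IΩ] (i : I) : ∑ α ∈ adjacentΩ M B i, area (B.ζΩ α) =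
    area (frontier (M.cell .solid i) ∩ D.bodyBoundary) := by
  refine area_eq_sum _ B.measurableSet_ζΩ B.ζΩ_disjoint B.measure_ζΩ_ne_top ?_
  filter_upwards [B.ae_exists_mem_ζΩ, ae_all_iff.2 fun α => B.ae_eq_idxΩ α i] with p hp hpi
  constructor
  · rintro ⟨h1, h2⟩
    obtain ⟨α, hα⟩ := hp h2
    exact ⟨α, B.mem_adjacentΩ.2 (hpi α hα (closure_mono (M.cell_subset _ i) h1.1)), hα⟩
  · rintro ⟨α, hα, hpα⟩
    obtain rfl := B.mem_adjacentΩ.1 hα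
    have h := B.ζΩ_subset α hpα
    exact ⟨M.mem_frontier_cell_solid (B.ζΩ_subset_frontier α hpα).1
      (D.bodyBoundary_subset_frontier h), h⟩

theorem sum_area_adjacentSig [Fintype ISig] (i : I) : ∑ α ∈ adjacentSig M B i, area (B.ζSig α) =
    area (M.ω i ∩ D.interface) := by
  refine area_eq_sum _ B.measurableSet_ζSig B.ζSig_disjoint B.measure_ζSig_ne_top ?_
  filter_upwards [B.ae_exists_mem_ζSig, ae_all_iff.2 fun α => B.ae_eq_idxSig α i,
    ae_all_iff.2 fun α => B.ae_mem_ω α] with p hp hpi hpω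
  constructor
  · rintro ⟨h1, h2⟩
    obtain ⟨α, hα⟩ := hp h2
    exact ⟨α, B.mem_adjacentSig.2 (hpi α hα (subset_closure h1)), hα⟩
  · rintro ⟨α, hα, hpα⟩
    obtain rfl := B.mem_adjacentSig.1 hα
    exact ⟨hpω α hpα, B.ζSig_subset α hpα⟩

/-! ### Row sums of the exchange coefficients -/

theorem coeffSig_eq (α β : ISig) : coeffSig B α β =
    exchange (D.part .gas) (fun x => -outerNormal (D.part .gas) x) (B.ζSig α) (B.ζSig β) :=
  D.exchangeSig_eq (B.measurableSet_ζSig α) (B.measurableSet_ζSig β) (B.ζSig_subset α)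
    (B.ζSig_subset β)

theorem coeffSig_nonneg (α β : ISig) : 0 ≤ coeffSig B α β := by
  rw [B.coeffSig_eq]; exact exchange_nonneg _ _

theorem coeffΓ_nonneg (α β : IΩ) : 0 ≤ coeffΓ B α β := exchange_nonneg _ _

theorem sum_coeffSig [Fintype ISig] (α : ISig) : ∑ β, coeffSig B α β = area (B.ζSig α) := by
  simp_rw [B.coeffSig_eq]
  refine sum_exchange (D.part_polyhedral .gas).1 (D.part_bounded .gas) (D.coveredByPlanes_part .gas)
    (fun β => (B.measurableSet_ζSig β).nullMeasurableSet) B.ζSig_subset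
    (fun β γ h => (B.ζSig_disjoint β γ h).aedisjoint) ?_ (B.measurableSet_ζSig α) (B.ζSig_subset α)
  rw [measure_eq_zero_iff_ae_notMem]
  filter_upwards [B.ae_exists_mem_ζSig] with p hp hpm
  exact hpm.2 (mem_iUnion.2 (hp hpm.1))

theorem sum_coeffΓ [Fintype IΩ] (α : IΩ) :
    ∑ β, coeffΓ B α β + D.exchangeΓ (B.ζΩ α) D.phantom = area (B.ζΩ α) := by
  have hsub (β : IΩ) : B.ζΩ β ⊆ frontier D.openRegion := by
    rw [D.frontier_openRegion]
    exact (B.ζΩ_subset β).trans subset_union_left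
  have hnull (β : IΩ) : (μHE[2] : Measure E3) (B.ζΩ β ∩ D.phantom) = 0 :=
    measure_mono_null (inter_subset_inter_left _ (B.ζΩ_subset β)) D.area_bodyBoundary_inter_phantom
  -- The phantom is added as one further element, with index `none`, to close the enclosure.
  have h := sum_exchange (K := Option IΩ) (B := fun k => k.elim D.phantom B.ζΩ) D.openRegion_regular
    D.isBounded_openRegion D.coveredByPlanes_openRegion ?_ ?_ ?_ ?_ (B.measurableSet_ζΩ α) (hsub α)
  · rw [Fintype.sum_option, add_comm] at h
    exact h
  · rintro (_ | β)
    · exact D.isClosed_phantom.measurableSet.nullMeasurableSet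
    · exact (B.measurableSet_ζΩ β).nullMeasurableSet
  · rintro (_ | β)
    · exact inter_subset_right
    · exact hsub β
  · rintro (_ | β) (_ | γ) hne
    · exact absurd rfl hne
    · exact AEDisjoint.symm (hnull γ)
    · exact hnull β
    · exact (B.ζΩ_disjoint β γ fun h => hne (h ▸ rfl)).aedisjoint
  · rw [measure_eq_zero_iff_ae_notMem]
    filter_upwards [B.ae_exists_mem_ζΩ] with p hp hpm
    refine hpm.2 ?_
    have h1 := hpm.1
    rw [D.frontier_openRegion] at h1
    rcases h1 with h1 | h1
    · obtain ⟨β, hβ⟩ := hp h1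
      exact mem_iUnion.2 ⟨some β, hβ⟩
    · exact mem_iUnion.2 ⟨none, h1⟩

end BoundaryMesh

/-! ### The emissivity -/

section Emissivity

variable {D : Domain} (P : HeatData D)

theorem lipConst_nonneg (e : ℝ → ℝ) (r : ℝ) : 0 ≤ lipConst e r :=
  Real.sSup_nonneg fun q ⟨_, _, _, _, _, hq⟩ => hq ▸ by positivity

theorem negVariation_nonneg (e : ℝ → ℝ) (r : ℝ) : 0 ≤ negVariation e r :=
  Real.sSup_nonneg fun _ ⟨_, _, _, _, _, hv⟩ => hv ▸ Finset.sum_nonneg fun _ _ =>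
    neg_nonneg.2 (min_le_left _ _)

theorem HeatData.abs_emis_sub_le {r : ℝ} (hr : 0 ≤ r) :
    ∀ x ∈ Icc 0 r, ∀ y ∈ Icc 0 r, |P.emis x - P.emis y| ≤ lipConst P.emis r * |x - y| := by
  intro x hx y hy
  by_cases hxy : x = y
  · simp [hxy]
  · rw [← div_le_iff₀ (abs_pos.2 (sub_ne_zero.2 hxy))]
    exact le_csSup (P.emis_locLip r hr) ⟨x, hx, y, hy, hxy, rfl⟩

/-- Attainment is what makes the minimum strictly positive, hence invertible. -/
theorem HeatData.exists_minOn_eq {r : ℝ} (hr : 0 ≤ r) :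
    ∃ x ∈ Icc 0 r, minOn P.emis r = P.emis x ∧ ∀ y ∈ Icc 0 r, P.emis x ≤ P.emis y := by
  have hlip : LipschitzOnWith ⟨lipConst P.emis r, lipConst_nonneg _ _⟩ P.emis (Icc 0 r) :=
    LipschitzOnWith.of_dist_le_mul fun x hx y hy => by
      rw [Real.dist_eq, Real.dist_eq]; exact P.abs_emis_sub_le hr x hx y hy
  obtain ⟨x, hx, hmin⟩ := isCompact_Icc.exists_isMinOn (nonempty_Icc.2 hr) hlip.continuousOn
  refine ⟨x, hx, ?_, fun y hy => hmin hy⟩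
  exact IsLeast.csInf_eq ⟨mem_image_of_mem _ hx, by rintro _ ⟨y, hy, rfl⟩; exact hmin hy⟩

end Emissivity

/-! ### The radiosity equations -/

section RadiosityEquations

variable {D : Domain} (P : HeatData D) {I IΩ ISig : Type*} {M : SpaceMesh D I}
  (B : BoundaryMesh M IΩ ISig)

/-- The irradiation of the boundary elements on `Γ_Ω`. -/
noncomputable def irradianceΓ [Fintype IΩ] [DecidableEq IΩ] (u : IΩ → ℝ) (α : IΩ) : ℝ :=
  ∑ β, coeffΓ B α β * radiosityΓ P B u β +
    D.exchangeΓ (B.ζΩ α) D.phantom * (P.σ * P.θext ^ 4)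

/-- The irradiation of the boundary elements on the interface. -/
noncomputable def irradianceSig [Fintype ISig] [DecidableEq ISig] (u : ISig → ℝ) (α : ISig) : ℝ :=
  -- The vanishing term is the phantom share q = 0 of the closed cavity, kept so that both
  -- enclosures satisfy `IsRadiosity`.
  ∑ β, coeffSig B α β * radiositySig P B u β + 0 * (P.σ * P.θext ^ 4)

theorem absorbedΓ_eq [Fintype IΩ] [DecidableEq IΩ] (u : IΩ → ℝ) (α : IΩ) :
    absorbedΓ P B u α = P.emis (u α) * irradianceΓ P B u α := by
  simp only [absorbedΓ, irradianceΓ, mul_comm (coeffΓ B α _)]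
  ring

theorem absorbedSig_eq [Fintype ISig] [DecidableEq ISig] (u : ISig → ℝ) (α : ISig) :
    absorbedSig P B u α = P.emis (u α) * irradianceSig P B u α := by
  simp only [absorbedSig, irradianceSig, mul_comm (coeffSig B α _), zero_mul, add_zero]

theorem exchange_phantom_nonneg (α : IΩ) : 0 ≤ D.exchangeΓ (B.ζΩ α) D.phantom :=
  exchange_nonneg _ _

theorem isRadiosity_radiosityΓ [Fintype IΩ] [DecidableEq IΩ] {u : IΩ → ℝ} (hu : ∀ α, 0 ≤ u α) :
    IsRadiosity (fun α => area (B.ζΩ α)) (fun α => D.exchangeΓ (B.ζΩ α) D.phantom) (coeffΓ B)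
      P.σ P.θext P.emis u (radiosityΓ P B u) := by
  intro α
  have h := radiosity_unique_solution B.area_ζΩ_pos B.coeffΓ_nonneg (exchange_phantom_nonneg B)
    B.sum_coeffΓ (e := fun α => P.emis (u α)) (fun α => P.emis_pos _ (hu α))
    (fun α => P.emis_le_one _ (hu α)) (emission P B.ζΩ u + phantomEmission P B u) α
  refine h.trans ?_
  simp only [Pi.add_apply, emission, phantomEmission, radiosityΓ, radiosityMatrix]
  ring

theorem isRadiosity_radiositySig [Fintype ISig] [DecidableEq ISig] {u : ISig → ℝ}
    (hu : ∀ α, 0 ≤ u α) :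
    IsRadiosity (fun α => area (B.ζSig α)) (fun _ => 0) (coeffSig B) P.σ P.θext P.emis u
      (radiositySig P B u) := by
  intro α
  have h := radiosity_unique_solution B.area_ζSig_pos B.coeffSig_nonneg (q := fun _ => 0)
    (fun _ => le_rfl) (fun α => by rw [add_zero, B.sum_coeffSig]) (e := fun α => P.emis (u α))
    (fun α => P.emis_pos _ (hu α)) (fun α => P.emis_le_one _ (hu α)) (emission P B.ζSig u) α
  refine h.trans ?_
  simp only [emission, radiositySig, radiosityMatrix]
  ring

end RadiosityEquations

/-! ### The scheme as a nodal system -/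

section Scheme

variable {D : Domain} (P : HeatData D) {I IΩ ISig : Type*} (M : SpaceMesh D I)
  (B : BoundaryMesh M IΩ ISig) {N : ℕ} (τ : TimeGrid P.T N) (S : Approximation P M τ)

theorem TimeGrid.step_pos {T : ℝ} {N : ℕ} (τ : TimeGrid T N) (ν : Fin N) : 0 < τ.step ν :=
  sub_pos.2 (τ.strictMono Fin.castSucc_lt_succ)

theorem essInf_nonneg {α : Type*} {mα : MeasurableSpace α} {μ : Measure α} {g : α → ℝ}
    (hg : ∀ᵐ x ∂μ, 0 ≤ g x) : 0 ≤ essInf g μ := by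
  rw [essInf, Filter.liminf_eq]
  by_cases hb : BddAbove {a | ∀ᵐ x ∂μ, a ≤ g x}
  · exact le_csSup hb hg
  -- If the almost sure lower bounds are unbounded, the real supremum takes its default value zero,
  -- which is harmless here.
  · exact (Real.sSup_of_not_bddAbove hb).ge

theorem Approximation.source_nonneg (ν : Fin N) (m : Phase) (i : I)
    (h : (M.cell m i).Nonempty) : 0 ≤ S.f m ν i := by
  refine (essInf_nonneg ?_).trans (S.f_ge m ν i h)
  have hsub : Ioo (τ.t ν.castSucc) (τ.t ν.succ) ×ˢ M.cell m i ⊆ Ioo 0 P.T ×ˢ D.part m := by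
    refine prod_mono (Ioo_subset_Ioo ?_ ?_) inter_subset_right
    · rw [← τ.zero]; exact τ.strictMono.monotone (Fin.zero_le _)
    · exact (τ.strictMono.monotone (Fin.le_last _)).trans_eq τ.last
  exact ae_restrict_of_ae_restrict_of_subset hsub (P.f_nonneg m)

theorem Approximation.source_mul_vol_nonneg (ν : Fin N) (m : Phase) (i : I) :
    0 ≤ S.f m ν i * vol (M.cell m i) := by
  rcases (M.cell m i).eq_empty_or_nonempty with h | h
  · simp [h, vol]
  · exact mul_nonneg (S.source_nonneg P M τ ν m i h) ENNReal.toReal_nonneg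

open Classical in
/-- The conductance between two control volumes within one phase. -/
noncomputable def conductance [Fintype I] (m : Phase) (i j : I) : ℝ :=
  if j ∈ neighbours M m i then
    P.κ m * (area (frontier (M.cell m i) ∩ frontier (M.cell m j)) / ‖M.x i - M.x j‖) else 0

theorem conductance_nonneg [Fintype I] (m : Phase) (i j : I) : 0 ≤ conductance P M m i j := by
  unfold conductance
  split_ifs
  · exact mul_nonneg (P.κ_nonneg m) (div_nonneg ENNReal.toReal_nonneg (norm_nonneg _))
  · exact le_rfl

theorem conduction_eq [Fintype I] (m : Phase) (u : I → ℝ) (i : I) :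
    conduction P M m u i = ∑ j, conductance P M m i j * (u j - u i) := by
  classical
  simp only [conduction, conductance, ite_mul, zero_mul, Finset.sum_ite_mem, Finset.univ_inter,
    Finset.mul_sum]
  refine Finset.sum_congr rfl fun j _ => ?_
  ring

/-- The emitting surface of a control volume taking part in nonlocal radiation. -/
noncomputable def emittingArea (i : I) : ℝ :=
  area (frontier (M.cell .solid i) ∩ D.bodyBoundary) + area (M.ω i ∩ D.interface)

theorem emittingArea_eq_sum [Fintype IΩ] [Fintype ISig] (i : I) : emittingArea M i =
    ∑ α ∈ adjacentΩ M B i, area (B.ζΩ α) + ∑ α ∈ adjacentSig M B i, area (B.ζSig α) := by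
  rw [emittingArea, B.sum_area_adjacentΩ, B.sum_area_adjacentSig]

variable [Fintype IΩ] [DecidableEq IΩ] [Fintype ISig] [DecidableEq ISig]

/-- The total irradiation of a control volume. -/
noncomputable def irradiation (i : I) (w : I → ℝ) : ℝ :=
  ∑ α ∈ adjacentΩ M B i, irradianceΓ P B (fun β => w (B.idxΩ β)) α +
    ∑ α ∈ adjacentSig M B i, irradianceSig P B (fun β => w (B.idxSig β)) α

theorem irradiation_le {w : I → ℝ} {U : ℝ} (hw : ∀ j, 0 ≤ w j) (hU : ∀ j, w j ≤ U)
    (hθ : P.θext ≤ U) (i : I) :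
    irradiation P M B i w ≤ emittingArea M i * (P.σ * U ^ 4) := by
  rw [emittingArea_eq_sum M B, add_mul, Finset.sum_mul, Finset.sum_mul]
  refine add_le_add (Finset.sum_le_sum fun α _ => ?_) (Finset.sum_le_sum fun α _ => ?_)
  · exact (isRadiosity_radiosityΓ P B fun β => hw (B.idxΩ β)).irradiance_le B.area_ζΩ_pos
      B.coeffΓ_nonneg (exchange_phantom_nonneg B) B.sum_coeffΓ P.σ_pos P.θext_pos P.emis_pos
      P.emis_le_one (fun β => hw _) (fun β => hU _) hθ α
  · exact (isRadiosity_radiositySig P B fun β => hw (B.idxSig β)).irradiance_le B.area_ζSig_pos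
      B.coeffSig_nonneg (fun _ => le_rfl) (fun α => by rw [add_zero, B.sum_coeffSig]) P.σ_pos
      P.θext_pos P.emis_pos P.emis_le_one (fun β => hw _) (fun β => hU _) hθ α

theorem le_irradiation {w : I → ℝ} {L : ℝ} (hL : 0 ≤ L) (hw : ∀ j, L ≤ w j) (hθ : L ≤ P.θext)
    (i : I) : emittingArea M i * (P.σ * L ^ 4) ≤ irradiation P M B i w := by
  rw [emittingArea_eq_sum M B, add_mul, Finset.sum_mul, Finset.sum_mul]
  refine add_le_add (Finset.sum_le_sum fun α _ => ?_) (Finset.sum_le_sum fun α _ => ?_)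
  · exact (isRadiosity_radiosityΓ P B fun β => hL.trans (hw (B.idxΩ β))).le_irradiance
      B.area_ζΩ_pos B.coeffΓ_nonneg (exchange_phantom_nonneg B) B.sum_coeffΓ P.σ_pos P.emis_pos
      P.emis_le_one (fun β => hL.trans (hw _)) hL (fun β => hw _) hθ α
  · exact (isRadiosity_radiositySig P B fun β => hL.trans (hw (B.idxSig β))).le_irradiance
      B.area_ζSig_pos B.coeffSig_nonneg (fun _ => le_rfl)
      (fun α => by rw [add_zero, B.sum_coeffSig]) P.σ_pos P.emis_pos
      P.emis_le_one (fun β => hL.trans (hw _)) hL (fun β => hw _) hθ α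

theorem irradiation_sub_le {r : ℝ} (hr : P.θext ≤ r) {w w' : I → ℝ} {d : ℝ}
    (hw : ∀ j, w j ∈ Icc 0 r) (hw' : ∀ j, w' j ∈ Icc 0 r) (hd : ∀ j, |w j - w' j| ≤ d) (i : I) :
    irradiation P M B i w - irradiation P M B i w' ≤ emittingArea M i *
      (P.σ * (4 * r ^ 3 + r ^ 4 * lipConst P.emis r * (minOn P.emis r)⁻¹) * d) := by
  have hr0 : 0 ≤ r := P.θext_pos.le.trans hr
  obtain ⟨x, hx, hmin, hle⟩ := P.exists_minOn_eq hr0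
  have hem : 0 < minOn P.emis r := hmin ▸ P.emis_pos x hx.1
  rw [emittingArea_eq_sum M B, add_mul, Finset.sum_mul, Finset.sum_mul, irradiation, irradiation,
    add_sub_add_comm, ← Finset.sum_sub_distrib, ← Finset.sum_sub_distrib]
  refine add_le_add (Finset.sum_le_sum fun α _ => ?_) (Finset.sum_le_sum fun α _ => ?_)
  · exact (isRadiosity_radiosityΓ P B fun β => (hw (B.idxΩ β)).1).irradiance_sub_le B.area_ζΩ_pos
      B.coeffΓ_nonneg (exchange_phantom_nonneg B) B.sum_coeffΓ P.σ_pos P.θext_pos P.emis_pos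
      P.emis_le_one (isRadiosity_radiosityΓ P B fun β => (hw' (B.idxΩ β)).1) hr hem (fun β => hw _)
      (fun β => hw' _) (P.abs_emis_sub_le hr0) (lipConst_nonneg _ _)
      (fun y hy => hmin ▸ hle y hy) (fun β => hd _) α
  · exact (isRadiosity_radiositySig P B fun β => (hw (B.idxSig β)).1).irradiance_sub_le
      B.area_ζSig_pos B.coeffSig_nonneg (fun _ => le_rfl)
      (fun α => by rw [add_zero, B.sum_coeffSig]) P.σ_pos P.θext_pos P.emis_pos
      P.emis_le_one (isRadiosity_radiositySig P B fun β => (hw' (B.idxSig β)).1) hr hem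
      (fun β => hw _) (fun β => hw' _) (P.abs_emis_sub_le hr0) (lipConst_nonneg _ _)
      (fun y hy => hmin ▸ hle y hy) (fun β => hd _) α

variable [Fintype I]

/-- One time step of the finite volume scheme as a nodal system. -/
noncomputable def nodalSystem (ν : Fin N) (v : I → ℝ) (hv : ∀ i, 0 ≤ v i) : NodalSystem I where
  W i s := (τ.step ν)⁻¹ * ((P.energy .solid s - P.energy .solid (v i)) * vol (M.cell .solid i) +
    (P.energy .gas s - P.energy .gas (v i)) * vol (M.cell .gas i))
  slope i := (τ.step ν)⁻¹ * (P.Cε * vol (M.ω i))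
  slope_pos i := mul_pos (inv_pos.2 (τ.step_pos ν)) (mul_pos P.Cε_pos (M.vol_pos i))
  W_growth i s t hs hst := by
    have h (m) : (t - s) * P.Cε * vol (M.cell m i) ≤
        (P.energy m t - P.energy m s) * vol (M.cell m i) :=
      mul_le_mul_of_nonneg_right (by linarith [P.energy_growth m s t hs hst]) ENNReal.toReal_nonneg
    rw [← mul_sub, ← M.vol_cells i, mul_assoc]
    refine mul_le_mul_of_nonneg_left ?_ (inv_pos.2 (τ.step_pos ν)).le
    linarith [h .solid, h .gas]
  W_cont i := by
    have h1 := P.energy_continuous .solid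
    have h2 := P.energy_continuous .gas
    fun_prop
  v := v
  v_nonneg := hv
  W_v i := by simp
  c i j := conductance P M .solid i j + conductance P M .gas i j
  c_nonneg i j := add_nonneg (conductance_nonneg P M _ i j) (conductance_nonneg P M _ i j)
  σ := P.σ
  σ_pos := P.σ_pos
  θ := P.θext
  θ_pos := P.θext_pos
  e := P.emis
  e_pos := P.emis_pos
  e_le_one := P.emis_le_one
  A := emittingArea M
  A_nonneg _ := add_nonneg ENNReal.toReal_nonneg ENNReal.toReal_nonneg
  Fr i := area (frontier (M.cell .solid i) ∩ D.freeBoundary)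
  Fr_nonneg _ := ENNReal.toReal_nonneg
  F i := S.f .solid ν i * vol (M.cell .solid i) + S.f .gas ν i * vol (M.cell .gas i)
  F_nonneg i := add_nonneg (S.source_mul_vol_nonneg P M τ ν _ i)
    (S.source_mul_vol_nonneg P M τ ν _ i)
  Q := irradiation P M B
  Q_le _ _ hw hU hθ i := irradiation_le P M B hw hU hθ i
  le_Q _ _ hL hw hθ i := le_irradiation P M B hL hw hθ i

/-- All elements adjacent to node i carry the temperature u i, so the emissivity factors out of both
absorption sums. This separates the own value s from the frozen state in Q. -/
theorem residual_nodalSystem (ν : Fin N) (v : I → ℝ) (hv : ∀ i, 0 ≤ v i) (u : I → ℝ) (i : I) :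
    (nodalSystem P M B τ S ν v hv).residual i (u i) u = fvOperator P M B τ S ν v u i := by
  have h1 : ∑ α ∈ adjacentΩ M B i, absorbedΓ P B (fun β => u (B.idxΩ β)) α = P.emis (u i) *
      ∑ α ∈ adjacentΩ M B i, irradianceΓ P B (fun β => u (B.idxΩ β)) α := by
    rw [Finset.mul_sum]
    refine Finset.sum_congr rfl fun α hα => ?_
    rw [absorbedΓ_eq, B.mem_adjacentΩ.1 hα]
  have h2 : ∑ α ∈ adjacentSig M B i, absorbedSig P B (fun β => u (B.idxSig β)) α = P.emis (u i) *
      ∑ α ∈ adjacentSig M B i, irradianceSig P B (fun β => u (B.idxSig β)) α := by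
    rw [Finset.mul_sum]
    refine Finset.sum_congr rfl fun α hα => ?_
    rw [absorbedSig_eq, B.mem_adjacentSig.1 hα]
  simp only [NodalSystem.residual, nodalSystem, fvOperator, storage, conduction_eq, h1, h2,
    irradiation, emittingArea, add_mul, Finset.sum_add_distrib]
  ring

theorem source_le_sourceBound_mul (ν : Fin N) (i : I) :
    S.f .solid ν i * vol (M.cell .solid i) + S.f .gas ν i * vol (M.cell .gas i) ≤
      sourceBound P M τ S ν * vol (M.ω i) := by
  have h : S.f .solid ν i * (vol (M.cell .solid i) / vol (M.ω i)) +
      S.f .gas ν i * (vol (M.cell .gas i) / vol (M.ω i)) ≤ sourceBound P M τ S ν :=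
    le_ciSup (f := fun i => S.f .solid ν i * (vol (M.cell .solid i) / vol (M.ω i)) +
      S.f .gas ν i * (vol (M.cell .gas i) / vol (M.ω i))) (finite_range _).bddAbove i
  have hpos := M.vol_pos i
  refine le_trans (le_of_eq ?_) (mul_le_mul_of_nonneg_right h hpos.le)
  field_simp

/-- The upper bound is designed so that storing the increment (k/Cε) B already absorbs the source:
slope * (k/Cε) * B is B times the volume of the control volume. -/
theorem source_le_slope_mul (ν : Fin N) (v : I → ℝ) (hv : ∀ i, 0 ≤ v i) (i : I) :
    (nodalSystem P M B τ S ν v hv).F i ≤ (nodalSystem P M B τ S ν v hv).slope i *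
      (upperBound P M τ S ν v - (nodalSystem P M B τ S ν v hv).v i) := by
  refine (source_le_sourceBound_mul P M τ S ν i).trans ?_
  have h1 : v i ≤ ⨆ i, v i := le_ciSup (finite_range v).bddAbove i
  have h2 : τ.step ν / P.Cε * sourceBound P M τ S ν ≤ upperBound P M τ S ν v - v i := by
    have := le_max_right P.θext ((⨆ i, v i) + τ.step ν / P.Cε * sourceBound P M τ S ν)
    unfold upperBound
    linarith
  have hk := τ.step_pos ν
  have hC := P.Cε_pos
  have h3 := mul_le_mul_of_nonneg_left h2
    ((nodalSystem P M B τ S ν v hv).slope_pos i).le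
  refine le_trans (le_of_eq ?_) h3
  simp only [nodalSystem]
  field_simp

/-- The conductances cancel between both sides. Of the remaining losses, `lg1` covers the emission
terms, `lg2` the irradiation with its emissivity factor, and `lg3` the external term; their total
must stay below the storage slope. -/
theorem SmallStep.coupling_lt_growth {ν : Fin N} {v : I → ℝ} (h : SmallStep P M τ S ν v)
    (hv : ∀ i, 0 ≤ v i) (i : I) :
    (nodalSystem P M B τ S ν v hv).coupling (upperBound P M τ S ν v)
        (lipConst P.emis (upperBound P M τ S ν v)) (minOn P.emis (upperBound P M τ S ν v)) i <
      (nodalSystem P M B τ S ν v hv).growth (upperBound P M τ S ν v)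
        (lipConst P.emis (upperBound P M τ S ν v)) i := by
  have hθr : P.θext ≤ upperBound P M τ S ν v := le_max_left _ _
  unfold SmallStep at h
  set r := upperBound P M τ S ν v
  have hr0 : 0 ≤ r := P.θext_pos.le.trans hθr
  obtain ⟨x, hx, hmin, -⟩ := P.exists_minOn_eq hr0
  have hem : 0 < minOn P.emis r := hmin ▸ P.emis_pos x hx.1
  have hem1 : 1 ≤ (minOn P.emis r)⁻¹ :=
    (one_le_inv₀ hem).2 (hmin ▸ P.emis_le_one x hx.1)
  have hL := lipConst_nonneg P.emis r
  have hV := M.vol_pos i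
  have hk := τ.step_pos ν
  have hratio (a : I → ℝ) : P.σ * a i ≤ (P.σ * ⨆ i, a i / vol (M.ω i)) * vol (M.ω i) := by
    rw [mul_assoc]
    refine mul_le_mul_of_nonneg_left ?_ P.σ_pos.le
    rw [← div_le_iff₀ hV]
    exact le_ciSup (f := fun i => a i / vol (M.ω i)) (finite_range _).bddAbove i
  have h1 := hratio fun i => area (frontier (M.cell .solid i) ∩ D.bodyBoundary)
  have h2 := hratio fun i => area (frontier (M.cell .solid i) ∩ D.freeBoundary)
  have h3 := hratio fun i => area (M.ω i ∩ D.interface)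
  -- The Lipschitz part alone suffices; the nonnegative variation term is dropped.
  have hl1 : lipConst P.emis r * r ^ 4 ≤ lg1 P r := by
    have := mul_nonneg (mul_nonneg (by norm_num : (0 : ℝ) ≤ 4) (negVariation_nonneg P.emis r))
      (pow_nonneg hr0 3)
    unfold lg1
    linarith
  have hl10 : 0 ≤ lg1 P r := le_trans (by positivity) hl1
  -- In the factor 2 em⁻¹ + 1 the 1 pays for the emissivity in front of the irradiation and one em⁻¹
  -- for the Lipschitz constant of the irradiation; the second em⁻¹ is slack.
  have hl2 : lipConst P.emis r * r ^ 4 + (4 * r ^ 3 + r ^ 4 * lipConst P.emis r *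
      (minOn P.emis r)⁻¹) ≤ lg2 P r := by
    have e1 : 4 * r ^ 3 ≤ 4 * (minOn P.emis r)⁻¹ * r ^ 3 := by
      have := pow_nonneg hr0 3
      nlinarith
    have e2 : r ^ 4 * lipConst P.emis r * (2 * (minOn P.emis r)⁻¹ + 1) ≤
        max (r ^ 4) (P.θext ^ 4) * lipConst P.emis r * (2 * (minOn P.emis r)⁻¹ + 1) := by
      gcongr
      exact le_max_left _ _
    have e3 : 0 ≤ r ^ 4 * lipConst P.emis r * (minOn P.emis r)⁻¹ := by positivity
    unfold lg2
    linarith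
  have hl20 : 0 ≤ lg2 P r := le_trans (by positivity) hl2
  have hl30 : 0 ≤ lg3 P r := mul_nonneg hL (pow_nonneg P.θext_pos.le 4)
  have hb0 : 0 ≤ area (frontier (M.cell .solid i) ∩ D.bodyBoundary) := ENNReal.toReal_nonneg
  have hf0 : 0 ≤ area (frontier (M.cell .solid i) ∩ D.freeBoundary) := ENNReal.toReal_nonneg
  have hs0 : 0 ≤ area (M.ω i ∩ D.interface) := ENNReal.toReal_nonneg
  simp only [NodalSystem.coupling, NodalSystem.growth, nodalSystem, emittingArea]
  unfold ratioBody ratioFree ratioInterface at h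
  set b := area (frontier (M.cell .solid i) ∩ D.bodyBoundary)
  set f := area (frontier (M.cell .solid i) ∩ D.freeBoundary)
  set s := area (M.ω i ∩ D.interface)
  set V := vol (M.ω i)
  have hσ := P.σ_pos.le
  have k1 : P.σ * (lipConst P.emis r * r ^ 4) * (b + s + f) ≤ (P.σ * b + P.σ * f + P.σ * s) *
      lg1 P r := by
    have := mul_le_mul_of_nonneg_left hl1 (mul_nonneg hσ (add_nonneg (add_nonneg hb0 hs0) hf0))
    linarith
  have k2 : P.σ * (lipConst P.emis r * r ^ 4) * (b + s) + (b + s) * (P.σ * (4 * r ^ 3 + r ^ 4 *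
      lipConst P.emis r * (minOn P.emis r)⁻¹)) ≤ (P.σ * b + P.σ * s) * lg2 P r := by
    have := mul_le_mul_of_nonneg_left hl2 (mul_nonneg hσ (add_nonneg hb0 hs0))
    linarith
  have k3 : P.σ * (lipConst P.emis r * P.θext ^ 4) * f = P.σ * f * lg3 P r := by
    unfold lg3; ring
  have m1 := mul_le_mul_of_nonneg_right (add_le_add (add_le_add h1 h2) h3) hl10
  have m2 := mul_le_mul_of_nonneg_right (add_le_add h1 h3) hl20
  have m3 := mul_le_mul_of_nonneg_right h2 hl30
  -- Scaling the step condition by vol(ω i) / k turns its right-hand side into the storage slope of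
  -- node i.
  have hlt := mul_lt_mul_of_pos_right h (mul_pos (inv_pos.2 hk) hV)
  have hcancel (y : ℝ) : τ.step ν * y * ((τ.step ν)⁻¹ * V) = y * V := by
    field_simp
  rw [hcancel] at hlt
  linarith

end Scheme

end ConductionRadiation

/-! ### A priori bounds and unique solvability of one time step -/

theorem theorem4p2 {D : ConductionRadiation.Domain} (P : ConductionRadiation.HeatData D)
    {I IΩ ISig : Type*} [Fintype I] [Fintype IΩ] [DecidableEq IΩ] [Fintype ISig] [DecidableEq ISig]
    (M : ConductionRadiation.SpaceMesh D I) (B : ConductionRadiation.BoundaryMesh M IΩ ISig)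
    {N : ℕ} (τ : ConductionRadiation.TimeGrid P.T N)
    (S : ConductionRadiation.Approximation P M τ)
    (ν : Fin N) (v : I → ℝ) (hv : ∀ i, 0 ≤ v i) :
    (∀ u : I → ℝ, (∀ i, 0 ≤ u i) →
      (∀ i, ConductionRadiation.fvOperator P M B τ S ν v u i = 0) →
      ∀ i, u i ∈ Set.Icc (ConductionRadiation.lowerBound P v)
        (ConductionRadiation.upperBound P M τ S ν v)) ∧
    (ConductionRadiation.SmallStep P M τ S ν v →
      (∃! u : I → ℝ,
        (∀ i, u i ∈ Set.Icc (ConductionRadiation.lowerBound P v)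
          (ConductionRadiation.upperBound P M τ S ν v)) ∧
        ∀ i, ConductionRadiation.fvOperator P M B τ S ν v u i = 0) ∧
      (∃! u : I → ℝ, (∀ i, 0 ≤ u i) ∧
        ∀ i, ConductionRadiation.fvOperator P M B τ S ν v u i = 0)) := by
  have hI : Nonempty I := M.nonempty_index
  have hm0 : 0 ≤ ConductionRadiation.lowerBound P v :=
    le_min P.θext_pos.le (Real.iInf_nonneg hv)
  have hmθ : ConductionRadiation.lowerBound P v ≤ P.θext := min_le_left _ _
  have hmv (i : I) : ConductionRadiation.lowerBound P v ≤ v i :=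
    (min_le_right _ _).trans (ciInf_le (Set.finite_range v).bddBelow i)
  have hθM : P.θext ≤ ConductionRadiation.upperBound P M τ S ν v := le_max_left _ _
  have hsrc := ConductionRadiation.source_le_slope_mul P M B τ S ν v hv
  have hbound : ∀ u : I → ℝ, (∀ i, 0 ≤ u i) →
      (∀ i, ConductionRadiation.fvOperator P M B τ S ν v u i = 0) →
      ∀ i, u i ∈ Set.Icc (ConductionRadiation.lowerBound P v)
        (ConductionRadiation.upperBound P M τ S ν v) := by
    intro u hu h i
    simp only [← ConductionRadiation.residual_nodalSystem P M B τ S ν v hv] at h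
    exact ⟨ConductionRadiation.NodalSystem.le_of_residual_eq_zero_of_le _ hmθ hmv hu h i,
      ConductionRadiation.NodalSystem.le_of_residual_eq_zero _ hθM hsrc hu h i⟩
  refine ⟨hbound, fun hsmall => ?_⟩
  have hM0 := P.θext_pos.le.trans hθM
  obtain ⟨x, hx, hmin, -⟩ := P.exists_minOn_eq hM0
  have huniq := (ConductionRadiation.nodalSystem P M B τ S ν v hv).existsUnique_residual_eq_zero
    hm0 hmθ hmv hθM hsrc (ConductionRadiation.lipConst_nonneg _ _) (P.abs_emis_sub_le hM0)
    (hmin ▸ P.emis_pos x hx.1)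
    (fun w w' d hw hw' hd i => ConductionRadiation.irradiation_sub_le P M B hθM hw hw' hd i)
    (hsmall.coupling_lt_growth P M B τ S hv)
  simp only [ConductionRadiation.residual_nodalSystem] at huniq
  refine ⟨huniq, ?_⟩
  obtain ⟨u, ⟨hu, hu0⟩, hun⟩ := huniq
  -- The a priori bounds place every nonnegative solution in the box, so uniqueness there is
  -- uniqueness among all nonnegative states.
  exact ⟨u, ⟨fun i => hm0.trans (hu i).1, hu0⟩, fun w hw => hun w ⟨hbound w hw.1 hw.2, hw.2⟩⟩
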